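/- **Definitions.** For a real functional $T$ of probability distributions, put $F_{\varepsilon,x}=(1-\varepsilon)F+\varepsilon\Delta_x$ and $\mathrm{IF}(x,T,F)=\lim_{\varepsilon\downarrow0}\varepsilon^{-1}\big(T(F_{\varepsilon,x})-T(F)\big)$. The gross-error sensitivity is $\gamma^*(T,F)=\sup_x|\mathrm{IF}(x,T,F)|$, over all $x$ where the limit exists. The asymptotic variance is $\mathrm{ASV}(T,F)=E_F[\mathrm{IF}(X,T,F)^2]$. The efficiency of $T$ is the asymptotic variance of the classical estimator divided by $\mathrm{ASV}(T,F)$. An *M-functional of scale* with score $\chi$ is a functional $S$ that selects, at every distribution $P$ on $\mathbb R$ where this is possible, a number $s=S(P)>0$ with $\chi(\cdot/s)$ $P$-integrable and $\int\chi(x/s)\,dP(x)=0$. Let $\Phi$ also denote $N(0,1)$. The score is *well-behaved* if it is even, has finitely many discontinuities, is locally bounded, is $\le0$ on $(0,d)$ and $\ge0$ on $(d,\infty)$ for some $d>0$, lies in $L^2(\Phi)$, and is not $\Phi$-a.e. zero. Let $\mathcal M$ be the class of M-functionals of scale with a well-behaved score whose M-equation is solvable at $\Phi$ and which are Fisher consistent: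 $S(N(0,\sigma^2))=\sigma$ for all $\sigma>0$. Let $q=\Phi^{-1}(3/4)$, let $\mathrm{med}$ be the midpoint of the median interval, $\mathrm{MAD}(X)=q^{-1}\,\mathrm{med}\,|X-\mathrm{med}(X)|$ and $\mathrm{MAD}_0(X)=q^{-1}\,\mathrm{med}\,|X|$ (known center $0$). *Huber's M-estimators of scale* are those with score $\chi_{a,b}(x)=\max(-b,\min(b,x^2-1-a))$, $b>0$. **Setting.** Let $H$ be a centered elliptical distribution on $\mathbb R^p$ with positive definite scatter matrix $\Sigma$ having distinct eigenvalues $\lambda_1>\dots>\lambda_p$, whose standardized projections have law $F_0=N(0,1)$: for every $a$, $a^TX\sim\sqrt{a^T\Sigma a}\,Z$ with $Z\sim N(0,1)$. Let $T$ be a location functional with $T(H)=0$, let $\xi_F$ be a radial function that may depend on $F$, and put $g_F(t)=\xi_F(\|t\|)\,t$. Assume that $\xi_H$ is measurable, that $\xi_H(\|X\|)$ is not a.s. zero and that $E_H\|g_H(X)\|^2<\infty$. Let $v_{g,1}(F),\dots,v_{g,p}(F)$ be an orthonormal eigenbasis, in descending order of the eigenvalues, of the generalized spatial sign covariance matrix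 $\Sigma_g(F)=E_F[g_F(X-T(F))\,g_F(X-T(F))^T]$. Assume that $\Sigma_g(H_{\varepsilon,x})-\Sigma_g(H)=O(\varepsilon)$ as $\varepsilon\downarrow0$ for every $x$ (which holds when the influence function of $\Sigma_g$ exists at $H$). For a scale functional $S$ the corrected eigenvalue is $\lambda_{S,k}(F)=S^2(v_{g,k}(F)^TX)$, $X\sim F$. **Corollary.** $\mathrm{MAD}_0$ belongs to $\mathcal M$, with score $\operatorname{sign}(|x|-q)$, and $\mathrm{MAD}$ is Fisher consistent. For each $b>0$ there is exactly one $a$ for which $\mathcal M$ contains an M-functional with score $\chi_{a,b}$. For each $k$: 1. (Most B-robust.) For $S_0\in\{\mathrm{MAD},\mathrm{MAD}_0\}$, $\mathrm{IF}(x,\lambda_{S_0,k},H)$ exists for $H$-almost every $x$, $\gamma^*(\lambda_{S_0,k},H)<\infty$, and $\gamma^*(\lambda_{S_0,k},H)\le\gamma^*(\lambda_{S,k},H)$ for all $S\in\mathcal M$. 2. (Optimal B-robust.) Let $S_0\in\mathcal M$ have score $\chi_{a,b}$, $b>0$. Then $\mathrm{IF}(x,\lambda_{S_0,k},H)$ exists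 for every $x$, and $\lambda_{S_0,k}$ has the highest efficiency at $H$ among all $\lambda_{S,k}$ with $S\in\mathcal M$ and $\gamma^*(\lambda_{S,k},H)\le\gamma^*(\lambda_{S_0,k},H)$. Moreover, for every bound $c$ with $\gamma^*(\lambda_{\mathrm{MAD},k},H)<c<\infty$ there are $a$ and $b>0$ such that $\mathcal M$ contains functionals with score $\chi_{a,b}$, and each such $S_0$ satisfies $\gamma^*(\lambda_{S_0,k},H)=c$ and has the highest efficiency among all $S\in\mathcal M$ with $\gamma^*(\lambda_{S,k},H)\le c$. Here the classical eigenvalue estimator has asymptotic variance $2\lambda_k^2$. Statements 1 and 2 also hold with $S$ in place of $\lambda_{S,k}$ and $N(0,1)$ in place of $H$, where the classical estimator is the standard deviation, with asymptotic variance $1/2$. -/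

import Mathlib

open MeasureTheory ProbabilityTheory Filter Topology Asymptotics
open scoped ENNReal

noncomputable section

/-! ### Influence function, gross-error sensitivity, asymptotic variance -/

section Influence

variable {E : Type*} [MeasurableSpace E]

/-- The contaminated distribution `(1 - ε) F + ε Δₓ`. -/
def contaminated (F : Measure E) (x : E) (ε : ℝ) : Measure E :=
  ENNReal.ofReal (1 - ε) • F + ENNReal.ofReal ε • Measure.dirac x

/-- The influence function of the statistical functional `T` at the distribution `F` exists at the
point `x` and has the value `y`: `(T ((1 - ε) F + ε Δₓ) - T F) / ε → y` as `ε ↓ 0`. -/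
def HasInfluence (T : Measure E → ℝ) (F : Measure E) (x : E) (y : ℝ) : Prop :=
  Tendsto (fun ε : ℝ => (T (contaminated F x ε) - T F) / ε) (𝓝[>] 0) (𝓝 y)

/-- The influence function `IF(x, T, F)` (meaningful at the points where it exists). -/
def influence (T : Measure E → ℝ) (F : Measure E) (x : E) : ℝ :=
  limUnder (𝓝[>] (0 : ℝ)) (fun ε : ℝ => (T (contaminated F x ε) - T F) / ε)

/-- Gross-error sensitivity: the supremum of `|IF(x, T, F)|` over all `x` where it exists. -/
def grossErrorSensitivity (T : Measure E → ℝ) (F : Measure E) : ℝ≥0∞ :=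
  ⨆ (x : E) (y : ℝ) (_ : HasInfluence T F x y), ‖y‖ₑ

/-- Asymptotic variance `E_F[IF(X, T, F)²]`. -/
def asymptoticVariance (T : Measure E → ℝ) (F : Measure E) : ℝ≥0∞ :=
  ∫⁻ x, ‖influence T F x‖ₑ ^ 2 ∂F

/-- Asymptotic relative efficiency with respect to a reference estimator of asymptotic
variance `r`. -/
def asymptoticEfficiency (r : ℝ≥0∞) (T : Measure E → ℝ) (F : Measure E) : ℝ≥0∞ :=
  r / asymptoticVariance T F

end Influence

/-! ### M-estimators of scale -/

/-- The standard normal distribution `Φ`. -/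
abbrev stdNormal : Measure ℝ := gaussianReal 0 1

/-- `s > 0` solves the M-equation `∫ χ(x / s) dP(x) = 0`. -/
def IsScaleRoot (χ : ℝ → ℝ) (P : Measure ℝ) (s : ℝ) : Prop :=
  0 < s ∧ Integrable (fun x => χ (x / s)) P ∧ ∫ x, χ (x / s) ∂P = 0

/-- `S` is an M-functional of scale with score function `χ`: at every distribution at which the
M-equation has a solution, `S` selects one. -/
def IsMScale (χ : ℝ → ℝ) (S : Measure ℝ → ℝ) : Prop :=
  ∀ P : Measure ℝ, IsProbabilityMeasure P → (∃ s, IsScaleRoot χ P s) → IsScaleRoot χ P (S P)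

/-- Fisher consistency of a scale functional at the normal scale family. -/
def FisherConsistent (S : Measure ℝ → ℝ) : Prop :=
  ∀ σ : ℝ, 0 < σ → S (gaussianReal 0 (Real.toNNReal (σ ^ 2))) = σ

/-- Well-behaved score functions for M-estimation of scale at the normal model: even, finitely many
discontinuities, locally bounded, non-positive on `(0, d)` and non-negative on `(d, ∞)`,
square-integrable, and not null. Neither boundedness nor monotonicity nor differentiability
is required. -/
structure WellBehavedScore (χ : ℝ → ℝ) : Prop where
  even : ∀ x, χ (-x) = χ x
  finite_discontinuities : {x | ¬ ContinuousAt χ x}.Finite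
  locally_bounded : ∀ R : ℝ, ∃ M : ℝ, ∀ x, |x| ≤ R → |χ x| ≤ M
  sign_change : ∃ d : ℝ, 0 < d ∧ (∀ x, 0 < x → x < d → χ x ≤ 0) ∧ ∀ x, d < x → 0 ≤ χ x
  square_integrable : MemLp χ 2 stdNormal
  not_null : ¬ χ =ᵐ[stdNormal] 0

/-- `S` is a Fisher consistent M-estimator of scale with well-behaved score `χ`. -/
structure IsConsistentMScale (χ : ℝ → ℝ) (S : Measure ℝ → ℝ) : Prop where
  well_behaved : WellBehavedScore χ
  isMScale : IsMScale χ S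
  defined_at_model : ∃ s, IsScaleRoot χ stdNormal s
  consistent : FisherConsistent S

/-! ### The median absolute deviation and Huber's M-estimator of scale -/

/-- The median of a distribution on the line (midpoint of the median interval). -/
def med (P : Measure ℝ) : ℝ :=
  (sInf {t : ℝ | 1 / 2 ≤ P.real (Set.Iic t)} + sSup {t : ℝ | 1 / 2 ≤ P.real (Set.Ici t)}) / 2

/-- The normal quartile `Φ⁻¹(3/4)`. -/
def normalQuartile : ℝ := sInf {t : ℝ | 3 / 4 ≤ stdNormal.real (Set.Iic t)}

/-- `MAD(X) = c · med |X - med X|` with `c = 1 / Φ⁻¹(3/4)`. -/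
def mad (P : Measure ℝ) : ℝ :=
  1 / normalQuartile * med (P.map fun x => |x - med P|)

/-- The version of the MAD for a known center `0`: `c · med |X|`. -/
def madKnownCenter (P : Measure ℝ) : ℝ :=
  1 / normalQuartile * med (P.map fun x => |x|)

/-- The score function `sign(|x| - Φ⁻¹(3/4))` of the MAD. -/
def madScore (x : ℝ) : ℝ := Real.sign (|x| - normalQuartile)

/-- The score function of Huber's M-estimator of scale: `x² - 1 - a` truncated at `±b`. -/
def huberScore (a b x : ℝ) : ℝ := max (-b) (min b (x ^ 2 - 1 - a))

/-! ### Robustness optimality among M-estimators of scale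

A map `L` turns a scale functional `S` into the functional `L S` of interest: `S` itself,
or the eigenvalue functional built from `S`. -/

section Optimality

variable {E : Type*} [MeasurableSpace E]

/-- `S₀` is most B-robust: `L S₀` has the lowest gross-error sensitivity at `H` that is possible
for a Fisher consistent M-estimator of scale. -/
def IsMostBRobust (L : (Measure ℝ → ℝ) → Measure E → ℝ) (H : Measure E)
    (S₀ : Measure ℝ → ℝ) : Prop :=
  ∀ (χ : ℝ → ℝ) (S : Measure ℝ → ℝ), IsConsistentMScale χ S →
    grossErrorSensitivity (L S₀) H ≤ grossErrorSensitivity (L S) H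

/-- `S₀` is optimal B-robust for the bound `c`: `L S₀` has gross-error sensitivity at most `c`, and
the highest efficiency among all Fisher consistent M-estimators of scale with this property. -/
def IsOptimalBRobust (L : (Measure ℝ → ℝ) → Measure E → ℝ) (H : Measure E) (r c : ℝ≥0∞)
    (S₀ : Measure ℝ → ℝ) : Prop :=
  grossErrorSensitivity (L S₀) H ≤ c ∧
    ∀ (χ : ℝ → ℝ) (S : Measure ℝ → ℝ), IsConsistentMScale χ S →
      grossErrorSensitivity (L S) H ≤ c →
        asymptoticEfficiency r (L S) H ≤ asymptoticEfficiency r (L S₀) H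

/-- The MAD (with estimated and with known center) has, at `H`, an influence function almost
everywhere and a finite gross-error sensitivity, and is most B-robust. -/
def MadMostBRobust (L : (Measure ℝ → ℝ) → Measure E → ℝ) (H : Measure E) : Prop :=
  ∀ S₀ : Measure ℝ → ℝ, S₀ = mad ∨ S₀ = madKnownCenter →
    (∀ᵐ x ∂H, ∃ y, HasInfluence (L S₀) H x y) ∧
    grossErrorSensitivity (L S₀) H < ⊤ ∧
    IsMostBRobust L H S₀

/-- Huber's M-estimators have an influence function everywhere; each of them is optimal B-robust for
its own gross-error sensitivity; and each finite bound `c` above the least possible gross-error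
sensitivity (that of the MAD) is attained by one of them, which is then optimal
for `c`. -/
def HuberOptimalBRobust (L : (Measure ℝ → ℝ) → Measure E → ℝ) (H : Measure E)
    (r : ℝ≥0∞) : Prop :=
  (∀ (a b : ℝ) (S : Measure ℝ → ℝ), 0 < b → IsConsistentMScale (huberScore a b) S →
    (∀ x, ∃ y, HasInfluence (L S) H x y) ∧
    IsOptimalBRobust L H r (grossErrorSensitivity (L S) H) S) ∧
  ∀ c : ℝ≥0∞, grossErrorSensitivity (L mad) H < c → c < ⊤ →
    ∃ a b : ℝ, 0 < b ∧ (∃ S, IsConsistentMScale (huberScore a b) S) ∧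
      ∀ S, IsConsistentMScale (huberScore a b) S →
        grossErrorSensitivity (L S) H = c ∧ IsOptimalBRobust L H r c S

end Optimality

/-! ### Generalized spherical principal components and the corrected eigenvalues -/

section GSPCA

variable {p : ℕ}

/-- All standardized projections of the centered distribution `H` with scatter matrix `A` have the
law `F₀`: `aᵀX ~ √(aᵀ A a) Z` with `Z ~ F₀`, for every `a`. -/
def HasProjectedLaw (H : Measure (EuclideanSpace ℝ (Fin p))) (A : Matrix (Fin p) (Fin p) ℝ)
    (F₀ : Measure ℝ) : Prop :=
  ∀ a : EuclideanSpace ℝ (Fin p),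
    H.map (fun x => inner ℝ a x) =
      F₀.map (fun z => Real.sqrt (a.ofLp ⬝ᵥ A.mulVec a.ofLp) * z)

/-- `v` is an orthonormal basis of eigenvectors of `A`, with eigenvalues `l` in descending order. -/
def IsOrderedEigenbasis (A : Matrix (Fin p) (Fin p) ℝ) (v : Fin p → EuclideanSpace ℝ (Fin p))
    (l : Fin p → ℝ) : Prop :=
  Orthonormal ℝ v ∧ Antitone l ∧ ∀ i, A.mulVec (v i).ofLp = l i • (v i).ofLp

/-- The generalized spatial sign `g_F(x - T F)`, where `g_F(t) = ξ_F(‖t‖) t`, for a location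
functional `T` and a radial function `ξ_F` that may depend on the distribution `F`. -/
def generalizedSign (T : Measure (EuclideanSpace ℝ (Fin p)) → EuclideanSpace ℝ (Fin p))
    (ξ : Measure (EuclideanSpace ℝ (Fin p)) → ℝ → ℝ) (F : Measure (EuclideanSpace ℝ (Fin p)))
    (x : EuclideanSpace ℝ (Fin p)) : EuclideanSpace ℝ (Fin p) :=
  ξ F ‖x - T F‖ • (x - T F)

/-- The generalized spatial sign covariance matrix `E[g_F(X - T F) g_F(X - T F)ᵀ]`. -/
def gsscm (T : Measure (EuclideanSpace ℝ (Fin p)) → EuclideanSpace ℝ (Fin p))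
    (ξ : Measure (EuclideanSpace ℝ (Fin p)) → ℝ → ℝ) (F : Measure (EuclideanSpace ℝ (Fin p))) :
    Matrix (Fin p) (Fin p) ℝ :=
  Matrix.of fun i j => ∫ x, generalizedSign T ξ F x i * generalizedSign T ξ F x j ∂F

/-- `v` is a functional of GSPCA loading vectors: at each distribution, an ordered orthonormal
eigenbasis of the generalized spatial sign covariance matrix. -/
def IsGSPCA (T : Measure (EuclideanSpace ℝ (Fin p)) → EuclideanSpace ℝ (Fin p))
    (ξ : Measure (EuclideanSpace ℝ (Fin p)) → ℝ → ℝ)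
    (v : Measure (EuclideanSpace ℝ (Fin p)) → Fin p → EuclideanSpace ℝ (Fin p)) : Prop :=
  ∀ F : Measure (EuclideanSpace ℝ (Fin p)), IsProbabilityMeasure F →
    ∃ l, IsOrderedEigenbasis (gsscm T ξ F) (v F) l

/-- The corrected eigenvalue `λ_{S,k}(F) = S²(law of v_k(F)ᵀ X)`, `X ~ F`. -/
def correctedEigenvalue
    (v : Measure (EuclideanSpace ℝ (Fin p)) → Fin p → EuclideanSpace ℝ (Fin p)) (k : Fin p)
    (S : Measure ℝ → ℝ) (F : Measure (EuclideanSpace ℝ (Fin p))) : ℝ :=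
  S (F.map fun x => inner ℝ (v F k) x) ^ 2

end GSPCA

end

noncomputable section

/-! ### Contaminated distributions -/

section Contaminated

variable {E : Type*} [MeasurableSpace E]

/-! Everything reduces to a one-dimensional formula. Write B(χ) = ∫ χ(z)(z² - 1) dΦ(z)
(`scaleSensitivity`). For S in the class, with score χ, the functional has influence κ χ(z(x)) /
B(χ) at almost every x. Here κ = 1 and z(x) = x for scale itself, while κ = 2λₖ and z(x) = uₖᵀx /
√λₖ for the corrected eigenvalue. The structure `IsScaleLike` isolates what the two cases share, and
both optimality statements are proved once for it.

The formula rests on the M-equation near Φ. Scores may be unbounded, non-monotone and discontinuous,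
and S may pick any root. Moving the scale from the score to the normal density and tilting around
the sign change d of χ gives a strictly decreasing function of the scale (`tiltedMean_lt`). Hence 1
is the only root at Φ, and all roots under small contamination are near 1 (`eventually_roots_near`).
Roots exist by the intermediate value theorem where χ is continuous, and linearization gives the
limit (`tendsto_root`). The MAD with estimated center is treated directly: its center moves by O(ε),
and the two first-order effects of this shift on the window mass cancel by symmetry
(`tendsto_medianDeviation`).

The optimality is then elementary. As ∫ χ dΦ = 0, the 1 in B(χ) can be replaced by any constant.
With q² in its place, B(χ) ≤ sup|χ| ∫ |z² - q²| dΦ, with equality for sign(|z| - q); so the MAD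
minimizes sup|χ| / B(χ). With 1 + a in its place, minimizing the variance of χ / B(χ) under a bound
becomes a pointwise least squares approximation of z² - 1 - a by values in [-b, b], solved by
clipping (`huberScore_variance_le`). As b varies, b / B is continuous, comes arbitrarily close to
the value for the MAD and is unbounded, so every admissible bound is attained
(`exists_huberScore_of_bound`).

For the eigenvalue, H is a normal distribution with independent coordinates in the eigenbasis u.
Sign changes and coordinate swaps show that the sign covariance matrix has the same eigenvectors in
the same order, with distinct eigenvalues (`exists_eigenbasis_gsscm`). An O(ε) change of that matrix
moves its eigenvectors by O(ε) up to sign, and the variance along a unit vector is stationary at uₖ,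
so it changes by O(ε²). Estimating the direction therefore has no first-order effect, and only the
scale functional contributes (`isScaleLike_correctedEigenvalue`). -/

lemma isProbabilityMeasure_contaminated (F : Measure E) [IsProbabilityMeasure F] (x : E) {ε : ℝ}
    (h0 : 0 ≤ ε) (h1 : ε ≤ 1) : IsProbabilityMeasure (contaminated F x ε) := by
  constructor
  simp only [contaminated, Measure.coe_add, Measure.coe_smul, Pi.add_apply, Pi.smul_apply,
    measure_univ, smul_eq_mul, mul_one]
  rw [← ENNReal.ofReal_add (by linarith) h0]
  simp

lemma contaminated_real_apply (F : Measure E) [IsProbabilityMeasure F] (x : E) {ε : ℝ}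
    (h0 : 0 ≤ ε) (h1 : ε ≤ 1) (s : Set E) :
    (contaminated F x ε).real s = (1 - ε) * F.real s + ε * (Measure.dirac x).real s := by
  rw [contaminated, measureReal_add_apply
    (by simpa using ENNReal.mul_ne_top ENNReal.ofReal_ne_top (measure_ne_top _ _))
    (by simpa using ENNReal.mul_ne_top ENNReal.ofReal_ne_top (measure_ne_top _ _)),
    measureReal_ennreal_smul_apply,
    measureReal_ennreal_smul_apply, ENNReal.toReal_ofReal (by linarith), ENNReal.toReal_ofReal h0]

lemma contaminated_map {G : Type*} [MeasurableSpace G] (F : Measure E) (x : E) (ε : ℝ)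
    {f : E → G} (hf : Measurable f) :
    (contaminated F x ε).map f = contaminated (F.map f) (f x) ε := by
  rw [contaminated, Measure.map_add _ _ hf, Measure.map_smul, Measure.map_smul,
    Measure.map_dirac' hf, contaminated]

lemma integrable_contaminated_iff [MeasurableSingletonClass E] (F : Measure E) (x : E) {ε : ℝ}
    (h1 : ε < 1) (f : E → ℝ) :
    Integrable f (contaminated F x ε) ↔ Integrable f F := by
  rw [contaminated, integrable_add_measure,
    integrable_smul_measure (by simpa using h1) ENNReal.ofReal_ne_top]
  exact and_iff_left ((integrable_dirac (by simp)).smul_measure ENNReal.ofReal_ne_top)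

lemma integral_contaminated [MeasurableSingletonClass E] (F : Measure E) (x : E) {ε : ℝ}
    (h0 : 0 ≤ ε) (h1 : ε < 1) {f : E → ℝ} (hf : Integrable f F) :
    ∫ y, f y ∂(contaminated F x ε) = (1 - ε) * ∫ y, f y ∂F + ε * f x := by
  rw [contaminated, integral_add_measure (hf.smul_measure ENNReal.ofReal_ne_top)
    ((integrable_dirac (by simp)).smul_measure ENNReal.ofReal_ne_top), integral_smul_measure,
    integral_smul_measure, integral_dirac, ENNReal.toReal_ofReal (by linarith),
    ENNReal.toReal_ofReal h0, smul_eq_mul, smul_eq_mul]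

end Contaminated

/-! ### Rescaled normal distributions -/

lemma stdNormal_map_mul (s : ℝ) :
    stdNormal.map (fun x => s * x) = gaussianReal 0 (Real.toNNReal (s ^ 2)) := by
  have := gaussianReal_map_const_mul (μ := 0) (v := 1) s
  simp only [mul_zero, mul_one] at this
  rw [this]
  congr 1
  ext
  simp [sq_nonneg]

lemma gaussianReal_toNNReal_one : gaussianReal 0 (Real.toNNReal (1 ^ 2)) = stdNormal := by
  simp

/-- The likelihood ratio of `N(0, 1 / s²)` with respect to `N(0,1)`. -/
def scaleRatio (s z : ℝ) : ℝ := s * Real.exp (-((s ^ 2 - 1) * z ^ 2 / 2))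

lemma scaleRatio_pos {s : ℝ} (hs : 0 < s) (z : ℝ) : 0 < scaleRatio s z :=
  mul_pos hs (Real.exp_pos _)

lemma continuous_scaleRatio (s : ℝ) : Continuous (scaleRatio s) := by
  unfold scaleRatio; fun_prop

/-- This moves the scale from the argument of a possibly discontinuous score into a smooth density,
where monotonicity and differentiability in s become visible. -/
lemma stdNormal_map_div {s : ℝ} (hs : 0 < s) :
    stdNormal.map (fun x => x / s)
      = stdNormal.withDensity (fun z => ENNReal.ofReal (scaleRatio s z)) := by
  have h := gaussianReal_map_div_const (μ := 0) (v := 1) s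
  rw [zero_div] at h
  change Measure.map (fun x => x / s) (gaussianReal 0 1) = _
  rw [h, gaussianReal_of_var_ne_zero, stdNormal, gaussianReal_of_var_ne_zero _ one_ne_zero,
    ← withDensity_mul _ (by fun_prop) (by have := continuous_scaleRatio s; fun_prop)]
  · congr 1
    ext z
    simp only [Pi.mul_apply, gaussianPDF]
    rw [← ENNReal.ofReal_mul (gaussianPDFReal_nonneg _ _ _)]
    congr 1
    simp only [gaussianPDFReal, scaleRatio, sub_zero, NNReal.coe_one, mul_one, NNReal.coe_div,
      NNReal.coe_mk]
    have e1 : Real.sqrt (2 * Real.pi * (1 / s ^ 2)) = Real.sqrt (2 * Real.pi) / s := by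
      rw [mul_one_div, Real.sqrt_div (by positivity), Real.sqrt_sq hs.le]
    rw [e1, show (Real.sqrt (2 * Real.pi))⁻¹ * Real.exp (-z ^ 2 / 2) *
        (s * Real.exp (-((s ^ 2 - 1) * z ^ 2 / 2))) = (Real.sqrt (2 * Real.pi))⁻¹ * s *
        (Real.exp (-z ^ 2 / 2) * Real.exp (-((s ^ 2 - 1) * z ^ 2 / 2))) by ring, ← Real.exp_add,
        inv_div, div_eq_inv_mul]
    congr 2
    field_simp
    ring
  · intro h0
    have := congrArg NNReal.toReal h0
    simp at this
    exact hs.ne' this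

lemma measurableEmbedding_div {s : ℝ} (hs : s ≠ 0) : MeasurableEmbedding (fun x : ℝ => x / s) := by
  simp_rw [div_eq_mul_inv]
  exact (Homeomorph.mulRight₀ s⁻¹ (inv_ne_zero hs)).measurableEmbedding

/-- Dilation is a measurable embedding, so the change of variables needs no measurability of χ. -/
lemma integrable_comp_div_iff (χ : ℝ → ℝ) {s : ℝ} (hs : 0 < s) :
    Integrable (fun x => χ (x / s)) stdNormal ↔
      Integrable (fun z => χ z * scaleRatio s z) stdNormal := by
  have h := (measurableEmbedding_div hs.ne').integrable_map_iff (μ := stdNormal) (g := χ)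
  rw [stdNormal_map_div hs, integrable_withDensity_iff_integrable_smul'
    (by have := continuous_scaleRatio s; fun_prop) (by simp)] at h
  simp only [ENNReal.toReal_ofReal (scaleRatio_pos hs _).le, smul_eq_mul, mul_comm] at h
  exact h.symm

lemma integral_comp_div (χ : ℝ → ℝ) {s : ℝ} (hs : 0 < s) :
    ∫ x, χ (x / s) ∂stdNormal = ∫ z, χ z * scaleRatio s z ∂stdNormal := by
  have h := (measurableEmbedding_div hs.ne').integral_map (μ := stdNormal) χ
  rw [stdNormal_map_div hs, integral_withDensity_eq_integral_toReal_smul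
    (by have := continuous_scaleRatio s; fun_prop) (by simp)] at h
  simp only [ENNReal.toReal_ofReal (scaleRatio_pos hs _).le, smul_eq_mul, mul_comm] at h
  rw [← h]

/-! ### Moments of the standard normal distribution -/

/-- The constant score 1 is integrable at every scale, and at s = √(1/2) the likelihood ratio is a
multiple of exp(z²/4). -/
lemma integrable_exp_sq_div_four : Integrable (fun z : ℝ => Real.exp (z ^ 2 / 4)) stdNormal := by
  have h := (integrable_comp_div_iff (fun _ => 1) (s := Real.sqrt (1 / 2)) (by positivity)).1
    (integrable_const _)
  have h2 := h.const_mul (Real.sqrt (1 / 2))⁻¹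
  refine h2.congr (ae_of_all _ fun z => ?_)
  simp only [scaleRatio, one_mul]
  rw [← mul_assoc, inv_mul_cancel₀ (by positivity), one_mul, Real.sq_sqrt (by norm_num)]
  congr 1
  ring

/-- The square-integrable majorant for likelihood ratios near s = 1; its product with a score in L²
is integrable. -/
lemma memLp_exp_sq_div_eight : MemLp (fun z : ℝ => Real.exp (z ^ 2 / 8)) 2 stdNormal := by
  rw [memLp_two_iff_integrable_sq (by fun_prop)]
  refine integrable_exp_sq_div_four.congr (ae_of_all _ fun z => ?_)
  simp only [← Real.exp_nat_mul]
  congr 1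
  push_cast
  ring

lemma memLp_sq_sub (c : ℝ) : MemLp (fun z : ℝ => z ^ 2 - c) 2 stdNormal := by
  refine (memLp_exp_sq_div_eight.const_mul (8 + |c|)).mono' (by fun_prop) (ae_of_all _ fun z => ?_)
  have h1 := Real.add_one_le_exp (z ^ 2 / 8)
  have h2 : 0 ≤ z ^ 2 := sq_nonneg z
  have h3 := abs_nonneg c
  calc |z ^ 2 - c| ≤ |z ^ 2| + |c| := abs_sub _ _
    _ = z ^ 2 + |c| := by rw [abs_of_nonneg h2]
    _ ≤ _ := by nlinarith

lemma integral_sq_stdNormal : ∫ z, z ^ 2 ∂stdNormal = 1 := by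
  have h := variance_fun_id_gaussianReal (μ := 0) (v := 1)
  rw [variance_eq_integral (by fun_prop)] at h
  simpa using h

lemma integrable_mul_sq_sub {χ : ℝ → ℝ} (h : MemLp χ 2 stdNormal) (c : ℝ) :
    Integrable (fun z => χ z * (z ^ 2 - c)) stdNormal :=
  h.integrable_mul (memLp_sq_sub c)

/-! ### The M-equation at the normal model -/

/-- The mean of the score at scale `s` under the standard normal distribution. -/
def scaleMean (χ : ℝ → ℝ) (s : ℝ) : ℝ := ∫ x, χ (x / s) ∂stdNormal

/-- The sensitivity `∫ χ(z) (z² - 1) dΦ(z)` of the M-equation to changes of scale. -/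
def scaleSensitivity (χ : ℝ → ℝ) : ℝ := ∫ z, χ z * (z ^ 2 - 1) ∂stdNormal

lemma isScaleRoot_contaminated_iff (χ : ℝ → ℝ) (w s : ℝ) {ε : ℝ} (h0 : 0 ≤ ε) (h1 : ε < 1) :
    IsScaleRoot χ (contaminated stdNormal w ε) s ↔
      0 < s ∧ Integrable (fun x => χ (x / s)) stdNormal ∧
        (1 - ε) * scaleMean χ s + ε * χ (w / s) = 0 := by
  rw [IsScaleRoot, integrable_contaminated_iff _ _ h1]
  refine and_congr_right fun _ => and_congr_right fun h => ?_
  rw [integral_contaminated _ _ h0 h1 h, scaleMean]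

/-- The mean of the score, exponentially tilted around the point `d` of its change of sign. -/
def tiltedMean (χ : ℝ → ℝ) (d s : ℝ) : ℝ :=
  ∫ z, χ z * Real.exp (-((s ^ 2 - 1) * (z ^ 2 - d ^ 2) / 2)) ∂stdNormal

lemma scaleRatio_eq (d s z : ℝ) :
    scaleRatio s z = s * Real.exp (-((s ^ 2 - 1) * d ^ 2 / 2)) *
      Real.exp (-((s ^ 2 - 1) * (z ^ 2 - d ^ 2) / 2)) := by
  rw [scaleRatio, mul_assoc, ← Real.exp_add]
  congr 2
  ring

/-- The prefactor is positive, so the sign and the zeros are unchanged. The remaining exponent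
changes its sign at |z| = d together with χ, which makes the tilted mean monotone in s. -/
lemma scaleMean_eq_tiltedMean (χ : ℝ → ℝ) (d : ℝ) {s : ℝ} (hs : 0 < s) :
    scaleMean χ s = s * Real.exp (-((s ^ 2 - 1) * d ^ 2 / 2)) * tiltedMean χ d s := by
  rw [scaleMean, integral_comp_div χ hs, tiltedMean, ← integral_const_mul]
  refine integral_congr_ae (ae_of_all _ fun z => ?_)
  simp only [scaleRatio_eq d]
  ring

lemma integrable_tilted_iff (χ : ℝ → ℝ) (d : ℝ) {s : ℝ} (hs : 0 < s) :
    Integrable (fun z => χ z * Real.exp (-((s ^ 2 - 1) * (z ^ 2 - d ^ 2) / 2))) stdNormal ↔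
      Integrable (fun x => χ (x / s)) stdNormal := by
  rw [integrable_comp_div_iff χ hs]
  have hc : s * Real.exp (-((s ^ 2 - 1) * d ^ 2 / 2)) ≠ 0 := by positivity
  rw [← integrable_const_mul_iff (IsUnit.mk0 _ hc)]
  refine integrable_congr (ae_of_all _ fun z => ?_)
  simp only [scaleRatio_eq d]
  ring

lemma ae_stdNormal_ne (a : ℝ) : ∀ᵐ z ∂stdNormal, z ≠ a := by
  have : NullSingletonClass stdNormal := nullSingletonClass_gaussianReal one_ne_zero
  simp [ae_iff]

/-- A score that changes its sign at `d` has the sign of `z² - d²`, except at three points. -/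
lemma mul_sq_sub_nonneg {χ : ℝ → ℝ} {d : ℝ} (hd : 0 < d) (he : ∀ x, χ (-x) = χ x)
    (hneg : ∀ x, 0 < x → x < d → χ x ≤ 0) (hpos : ∀ x, d < x → 0 ≤ χ x) {z : ℝ} (h0 : z ≠ 0)
    (h1 : z ≠ d) (h2 : z ≠ -d) :
    (z ^ 2 < d ^ 2 ∧ χ z ≤ 0) ∨ (d ^ 2 < z ^ 2 ∧ 0 ≤ χ z) := by
  have hχ : χ z = χ |z| := by
    rcases abs_choice z with h | h <;> rw [h]
    rw [he]
  have hz : |z| ≠ d := fun h => by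
    rcases abs_choice z with h' | h' <;> rw [h'] at h
    · exact h1 h
    · exact h2 (by linarith)
  rw [hχ, ← sq_abs z]
  rcases lt_or_gt_of_ne hz with h | h
  · left
    exact ⟨by nlinarith [abs_nonneg z], hneg _ (abs_pos.2 h0) h⟩
  · right
    exact ⟨by nlinarith [abs_nonneg z], hpos _ h⟩

/-- The exponential increases or decreases with the scale according to the sign of a, and c has that
same sign. The second half serves strictness after integration. -/
lemma mul_exp_antitone {c a s t : ℝ} (hs : 0 < s) (hst : s < t)
    (h : (a < 0 ∧ c ≤ 0) ∨ (0 < a ∧ 0 ≤ c)) :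
    c * Real.exp (-((t ^ 2 - 1) * a / 2)) ≤ c * Real.exp (-((s ^ 2 - 1) * a / 2)) ∧
    (c * Real.exp (-((t ^ 2 - 1) * a / 2)) = c * Real.exp (-((s ^ 2 - 1) * a / 2)) → c = 0) := by
  have h2 : s ^ 2 < t ^ 2 := by nlinarith
  rcases h with ⟨ha, hc⟩ | ⟨ha, hc⟩
  · have hlt : Real.exp (-((s ^ 2 - 1) * a / 2)) < Real.exp (-((t ^ 2 - 1) * a / 2)) :=
      Real.exp_lt_exp.2 (by nlinarith)
    refine ⟨by nlinarith, fun h => ?_⟩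
    by_contra hne
    exact hlt.ne (mul_left_cancel₀ hne h).symm
  · have hlt : Real.exp (-((t ^ 2 - 1) * a / 2)) < Real.exp (-((s ^ 2 - 1) * a / 2)) :=
      Real.exp_lt_exp.2 (by nlinarith)
    refine ⟨by nlinarith, fun h => ?_⟩
    by_contra hne
    exact hlt.ne (mul_left_cancel₀ hne h)

/-- The integrands are ordered almost everywhere, and equal integrals would make χ null.
Integrability is assumed at both scales because an unbounded score can fail to be integrable at some
of them. -/
lemma tiltedMean_lt {χ : ℝ → ℝ} {d : ℝ} (hd : 0 < d) (he : ∀ x, χ (-x) = χ x)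
    (hneg : ∀ x, 0 < x → x < d → χ x ≤ 0) (hpos : ∀ x, d < x → 0 ≤ χ x)
    (hnull : ¬ χ =ᵐ[stdNormal] 0) {s t : ℝ} (hs : 0 < s) (hst : s < t)
    (his : Integrable (fun x => χ (x / s)) stdNormal)
    (hit : Integrable (fun x => χ (x / t)) stdNormal) :
    tiltedMean χ d t < tiltedMean χ d s := by
  rw [← integrable_tilted_iff χ d hs] at his
  rw [← integrable_tilted_iff χ d (hs.trans hst)] at hit
  set A : ℝ → ℝ := fun z => χ z * Real.exp (-((s ^ 2 - 1) * (z ^ 2 - d ^ 2) / 2)) with hA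
  set B : ℝ → ℝ := fun z => χ z * Real.exp (-((t ^ 2 - 1) * (z ^ 2 - d ^ 2) / 2)) with hB
  have key : ∀ᵐ z ∂stdNormal, B z ≤ A z ∧ (B z = A z → χ z = 0) := by
    filter_upwards [ae_stdNormal_ne 0, ae_stdNormal_ne d, ae_stdNormal_ne (-d)] with z h0 h1 h2
    have := mul_sq_sub_nonneg hd he hneg hpos h0 h1 h2
    exact mul_exp_antitone (c := χ z) (a := z ^ 2 - d ^ 2) hs hst
      (by rcases this with h | h
          · exact .inl ⟨by linarith [h.1], h.2⟩
          · exact .inr ⟨by linarith [h.1], h.2⟩)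
  have hle : tiltedMean χ d t ≤ tiltedMean χ d s :=
    integral_mono_ae hit his (key.mono fun z h => h.1)
  refine lt_of_le_of_ne hle fun heq => hnull ?_
  have := (integral_eq_iff_of_ae_le hit his (key.mono fun z h => h.1)).1 heq
  filter_upwards [this, key] with z h1 h2
  exact h2.2 h1

lemma tiltedMean_one (χ : ℝ → ℝ) (d : ℝ) : tiltedMean χ d 1 = ∫ z, χ z ∂stdNormal := by
  simp [tiltedMean]

namespace WellBehavedScore

variable {χ : ℝ → ℝ}

lemma integrable (h : WellBehavedScore χ) : Integrable χ stdNormal :=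
  h.square_integrable.integrable (by norm_num)

lemma scaleSensitivity_pos (h : WellBehavedScore χ) (h0 : ∫ z, χ z ∂stdNormal = 0) :
    0 < scaleSensitivity χ := by
  obtain ⟨d, hd, hneg, hpos⟩ := h.sign_change
  -- Since χ has mean zero, 1 can be traded for d², after which the integrand is non-negative.
  have e : scaleSensitivity χ = ∫ z, χ z * (z ^ 2 - d ^ 2) ∂stdNormal := by
    have : ∀ z, χ z * (z ^ 2 - 1) = χ z * (z ^ 2 - d ^ 2) + (d ^ 2 - 1) * χ z := fun z => by ring
    simp_rw [scaleSensitivity, this]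
    rw [integral_add (integrable_mul_sq_sub h.square_integrable _) (h.integrable.const_mul _),
      integral_const_mul, h0, mul_zero, add_zero]
  have key : ∀ᵐ z ∂stdNormal, 0 ≤ χ z * (z ^ 2 - d ^ 2) ∧
      (χ z * (z ^ 2 - d ^ 2) = 0 → χ z = 0) := by
    filter_upwards [ae_stdNormal_ne 0, ae_stdNormal_ne d, ae_stdNormal_ne (-d)] with z h0 h1 h2
    have := mul_sq_sub_nonneg hd h.even hneg hpos h0 h1 h2
    refine ⟨by rcases this with h | h <;> nlinarith, fun h0 => ?_⟩
    rcases mul_eq_zero.1 h0 with h | h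
    · exact h
    · rcases this with h' | h' <;> linarith
  rw [e]
  refine lt_of_le_of_ne (integral_nonneg_of_ae (key.mono fun z h => h.1)) fun h0 => h.not_null ?_
  have := (integral_eq_zero_iff_of_nonneg_ae (key.mono fun z h => h.1)
    (integrable_mul_sq_sub h.square_integrable _)).1 h0.symm
  filter_upwards [this, key] with z h1 h2
  exact h2.2 h1

end WellBehavedScore

/-! ### Differentiability of the mean score in the scale -/

lemma abs_scaleRatio_le {s : ℝ} (hs : s ∈ Metric.ball (1 : ℝ) (1 / 50)) (z : ℝ) :
    |scaleRatio s z| ≤ 2 * Real.exp (z ^ 2 / 8) := by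
  rw [Metric.mem_ball, Real.dist_eq, abs_lt] at hs
  rw [abs_of_pos (scaleRatio_pos (by linarith) z), scaleRatio]
  refine mul_le_mul (by linarith) (Real.exp_le_exp.2 ?_) (Real.exp_pos _).le (by norm_num)
  -- The radius 1/50 keeps the likelihood ratio below a multiple of exp(z²/50), well within the
  -- majorant exp(z²/8).
  have h1 : -(1 / 25) ≤ s ^ 2 - 1 := by nlinarith
  nlinarith [mul_le_mul_of_nonneg_right h1 (sq_nonneg z), sq_nonneg z]

lemma abs_scaleRatio_deriv_le {s : ℝ} (hs : s ∈ Metric.ball (1 : ℝ) (1 / 50)) (z : ℝ) :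
    |(1 - s ^ 2 * z ^ 2) * Real.exp (-((s ^ 2 - 1) * z ^ 2 / 2))|
      ≤ 20 * Real.exp (z ^ 2 / 8) := by
  rw [Metric.mem_ball, Real.dist_eq, abs_lt] at hs
  have hz := sq_nonneg z
  rw [abs_mul, abs_of_pos (Real.exp_pos _)]
  -- The exponent 1/8 is split as 1/10 + 1/40: the first part absorbs the polynomial factor, the
  -- second bounds the tilt.
  have h1 : |1 - s ^ 2 * z ^ 2| ≤ 20 * Real.exp (z ^ 2 / 10) := by
    have := Real.add_one_le_exp (z ^ 2 / 10)
    have h2 : s ^ 2 * z ^ 2 ≤ 2 * z ^ 2 := mul_le_mul_of_nonneg_right (by nlinarith) hz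
    have h3 : 0 ≤ s ^ 2 * z ^ 2 := by positivity
    rw [abs_le]
    constructor <;> nlinarith
  have h2 : Real.exp (-((s ^ 2 - 1) * z ^ 2 / 2)) ≤ Real.exp (z ^ 2 / 40) :=
    Real.exp_le_exp.2 (by
      have h1 : -(1 / 25) ≤ s ^ 2 - 1 := by nlinarith
      nlinarith [mul_le_mul_of_nonneg_right h1 hz])
  calc _ ≤ 20 * Real.exp (z ^ 2 / 10) * Real.exp (z ^ 2 / 40) :=
        mul_le_mul h1 h2 (Real.exp_pos _).le (by positivity)
    _ = _ := by
        rw [mul_assoc, ← Real.exp_add]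
        congr 2
        ring

lemma hasDerivAt_scaleRatio (s z : ℝ) :
    HasDerivAt (fun s => scaleRatio s z)
      ((1 - s ^ 2 * z ^ 2) * Real.exp (-((s ^ 2 - 1) * z ^ 2 / 2))) s := by
  unfold scaleRatio
  have h : HasDerivAt (fun s : ℝ => -((s ^ 2 - 1) * z ^ 2 / 2)) (-(s * z ^ 2)) s := by
    have := (((hasDerivAt_pow 2 s).sub_const 1).mul_const (z ^ 2)).div_const 2
    convert! this.neg using 1
    simp
    ring
  convert! (hasDerivAt_id s).mul h.exp using 1
  simp
  ring

section Derivative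

variable {χ : ℝ → ℝ} (h : MemLp χ 2 stdNormal)
include h

lemma integrable_comp_div_of_mem_ball {s : ℝ} (hs : s ∈ Metric.ball (1 : ℝ) (1 / 50)) :
    Integrable (fun x => χ (x / s)) stdNormal := by
  have hs0 : 0 < s := by
    rw [Metric.mem_ball, Real.dist_eq, abs_lt] at hs; linarith
  rw [integrable_comp_div_iff χ hs0]
  refine h.integrable_mul (MemLp.mono' (memLp_exp_sq_div_eight.const_mul 2)
    (continuous_scaleRatio s).aestronglyMeasurable (ae_of_all _ (abs_scaleRatio_le hs)))

/-- Only the likelihood ratio depends on s, so a score that is merely in L² suffices: the dominating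
function is a product of two square-integrable functions. -/
lemma hasDerivAt_scaleMean_of_mem_ball {s : ℝ} (hs : s ∈ Metric.ball (1 : ℝ) (1 / 50)) :
    HasDerivAt (scaleMean χ) (∫ z, χ z *
      ((1 - s ^ 2 * z ^ 2) * Real.exp (-((s ^ 2 - 1) * z ^ 2 / 2))) ∂stdNormal) s := by
  have hnhds : Metric.ball (1 : ℝ) (1 / 50) ∈ 𝓝 s := Metric.isOpen_ball.mem_nhds hs
  have hpos : ∀ t ∈ Metric.ball (1 : ℝ) (1 / 50), 0 < t := fun t ht => by
    rw [Metric.mem_ball, Real.dist_eq, abs_lt] at ht; linarith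
  have key := (hasDerivAt_integral_of_dominated_loc_of_deriv_le (μ := stdNormal) (x₀ := s)
    (F := fun s z => χ z * scaleRatio s z)
    (F' := fun s z => χ z * ((1 - s ^ 2 * z ^ 2) * Real.exp (-((s ^ 2 - 1) * z ^ 2 / 2))))
    (bound := fun z => |χ z| * (20 * Real.exp (z ^ 2 / 8))) hnhds
    (Eventually.of_forall fun t => h.1.mul (continuous_scaleRatio t).aestronglyMeasurable)
    ((integrable_comp_div_iff χ (hpos s hs)).1 (integrable_comp_div_of_mem_ball h hs))
    (h.1.mul (Continuous.aestronglyMeasurable (by fun_prop)))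
    (ae_of_all _ fun z t ht => by
      rw [Real.norm_eq_abs, abs_mul]
      exact mul_le_mul_of_nonneg_left (abs_scaleRatio_deriv_le ht z) (abs_nonneg _))
    (h.norm.integrable_mul (memLp_exp_sq_div_eight.const_mul 20))
    (ae_of_all _ fun z t _ => (hasDerivAt_scaleRatio t z).const_mul _)).2
  refine key.congr_of_eventuallyEq ?_
  filter_upwards [hnhds] with t ht
  exact integral_comp_div χ (hpos t ht)

lemma hasDerivAt_scaleMean_one : HasDerivAt (scaleMean χ) (-scaleSensitivity χ) 1 := by
  convert hasDerivAt_scaleMean_of_mem_ball h (s := 1) (by simp) using 1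
  rw [scaleSensitivity, ← integral_neg]
  refine integral_congr_ae (ae_of_all _ fun z => ?_)
  simp
  ring

lemma continuousOn_scaleMean : ContinuousOn (scaleMean χ) (Metric.ball (1 : ℝ) (1 / 50)) :=
  fun _ hs => (hasDerivAt_scaleMean_of_mem_ball h hs).continuousAt.continuousWithinAt

end Derivative

lemma scaleMean_one (χ : ℝ → ℝ) : scaleMean χ 1 = ∫ z, χ z ∂stdNormal := by simp [scaleMean]

/-- The tilted mean vanishes at s = 1 and is strictly decreasing. This fixes the sign of the mean
score on each side of 1, although the mean score itself need not be monotone. -/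
lemma WellBehavedScore.scaleMean_neg {χ : ℝ → ℝ} (h : WellBehavedScore χ)
    (h0 : ∫ z, χ z ∂stdNormal = 0) {s : ℝ} (hs : 1 < s)
    (hi : Integrable (fun x => χ (x / s)) stdNormal) : scaleMean χ s < 0 := by
  obtain ⟨d, hd, hneg, hpos⟩ := h.sign_change
  have := tiltedMean_lt hd h.even hneg hpos h.not_null one_pos hs (by simpa using h.integrable) hi
  rw [tiltedMean_one, h0] at this
  rw [scaleMean_eq_tiltedMean χ d (by linarith)]
  exact mul_neg_of_pos_of_neg (by positivity) this

lemma WellBehavedScore.scaleMean_pos {χ : ℝ → ℝ} (h : WellBehavedScore χ)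
    (h0 : ∫ z, χ z ∂stdNormal = 0) {s : ℝ} (hs0 : 0 < s) (hs : s < 1)
    (hi : Integrable (fun x => χ (x / s)) stdNormal) : 0 < scaleMean χ s := by
  obtain ⟨d, hd, hneg, hpos⟩ := h.sign_change
  have := tiltedMean_lt hd h.even hneg hpos h.not_null hs0 hs hi (by simpa using h.integrable)
  rw [tiltedMean_one, h0] at this
  rw [scaleMean_eq_tiltedMean χ d hs0]
  positivity

/-! ### Roots of the M-equation under contamination -/

/-- A contaminating contribution of size at most ε M cannot balance a mean score that stays at
distance κ from zero. -/
lemma eventually_small_mul_lt (M : ℝ) {κ : ℝ} (hκ : 0 < κ) :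
    ∀ᶠ ε : ℝ in 𝓝[>] 0, 0 < ε ∧ ε < 1 ∧ ε * M < (1 - ε) * κ := by
  have h1 : Tendsto (fun ε : ℝ => (1 - ε) * κ - ε * M) (𝓝[>] 0) (𝓝 κ) := by
    have : Continuous fun ε : ℝ => (1 - ε) * κ - ε * M := by fun_prop
    have h := (this.tendsto 0).mono_left (nhdsWithin_le_nhds (s := Set.Ioi 0))
    simpa using h
  filter_upwards [h1.eventually (lt_mem_nhds hκ), self_mem_nhdsWithin,
    nhdsWithin_le_nhds (gt_mem_nhds (one_pos : (0 : ℝ) < 1))] with ε h1 h2 h3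
  exact ⟨h2, h3, by linarith⟩

lemma score_abs {χ : ℝ → ℝ} (he : ∀ x, χ (-x) = χ x) (x : ℝ) : χ |x| = χ x := by
  rcases abs_choice x with h | h <;> rw [h]
  rw [he]

/-- Under a small contamination at a point bounded away from `0`, all roots of the M-equation are
close to the scale of the model. -/
lemma WellBehavedScore.eventually_roots_near {χ : ℝ → ℝ} (h : WellBehavedScore χ)
    (h0 : ∫ z, χ z ∂stdNormal = 0) {w : ℝ → ℝ} {c : ℝ} (hc : 0 < c)
    (hw : Tendsto (fun ε => |w ε|) (𝓝[>] 0) (𝓝 c)) {δ : ℝ} (hδ : 0 < δ) (hδ' : δ < 1 / 50) :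
    ∀ᶠ ε in 𝓝[>] (0 : ℝ), ∀ s, IsScaleRoot χ (contaminated stdNormal (w ε) ε) s →
      |s - 1| ≤ δ := by
  obtain ⟨d, hd, hneg, hpos⟩ := h.sign_change
  have hball : ∀ t, |t - 1| ≤ δ → t ∈ Metric.ball (1 : ℝ) (1 / 50) := fun t ht => by
    rw [Metric.mem_ball, Real.dist_eq]; linarith
  have hia := integrable_comp_div_of_mem_ball h.square_integrable
    (hball (1 - δ) (by simp [abs_of_pos hδ]))
  have hib := integrable_comp_div_of_mem_ball h.square_integrable
    (hball (1 + δ) (by simp [abs_of_pos hδ]))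
  have hi1 : Integrable (fun x => χ (x / 1)) stdNormal := by simpa using h.integrable
  have ha := tiltedMean_lt hd h.even hneg hpos h.not_null (by linarith) (by linarith) hia hi1
  have hb := tiltedMean_lt hd h.even hneg hpos h.not_null one_pos (by linarith) hi1 hib
  rw [tiltedMean_one, h0] at ha hb
  -- The score at the contaminating point is bounded by `M₁` when the scale is too small (argument
  -- at most d), and by `M₂` when it is too large (argument at most 2c).
  obtain ⟨M₁, hM₁⟩ := h.locally_bounded d
  obtain ⟨M₂, hM₂⟩ := h.locally_bounded (2 * c)
  -- These are the distances from zero kept by the mean score for c/(2d) ≤ s < 1 - δ and for 1 + δ <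
  -- s ≤ 2c/d; scales outside these ranges are excluded by signs.
  have hκ₁ : 0 < c / (2 * d) * tiltedMean χ d (1 - δ) := by positivity
  have hκ₂ : 0 < Real.exp (-(((2 * c / d) ^ 2 - 1) * d ^ 2 / 2)) * -tiltedMean χ d (1 + δ) :=
    mul_pos (Real.exp_pos _) (by linarith)
  filter_upwards [eventually_small_mul_lt M₁ hκ₁, eventually_small_mul_lt M₂ hκ₂,
    hw.eventually (lt_mem_nhds (show c / 2 < c by linarith)),
    hw.eventually (gt_mem_nhds (show c < 2 * c by linarith))] with ε he₁ he₂ hw₁ hw₂ s hs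
  rw [isScaleRoot_contaminated_iff _ _ _ he₁.1.le he₁.2.1] at hs
  obtain ⟨hs0, hi, heq⟩ := hs
  have hws : χ (w ε / s) = χ (|w ε| / s) := by
    rw [← score_abs h.even, abs_div, abs_of_pos hs0]
  rw [hws] at heq
  have hw0 : 0 < |w ε| / s := by
    have : 0 < |w ε| := by linarith
    positivity
  by_contra hcon
  rw [not_le, lt_abs] at hcon
  rcases hcon with hcon | hcon
  · have hg : scaleMean χ s ≤ Real.exp (-(((2 * c / d) ^ 2 - 1) * d ^ 2 / 2)) *
        tiltedMean χ d (1 + δ) ∨ χ (|w ε| / s) ≤ 0 := by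
      rcases lt_or_ge (|w ε| / s) d with h1 | h1
      · exact .inr (hneg _ hw0 h1)
      · left
        have hsw : s ≤ 2 * c / d := by
          rw [le_div_iff₀ hs0] at h1
          rw [le_div_iff₀ hd]
          linarith
        have htl := tiltedMean_lt hd h.even hneg hpos h.not_null (by linarith)
          (show 1 + δ < s by linarith) hib hi
        rw [scaleMean_eq_tiltedMean χ d hs0]
        have hexp : Real.exp (-(((2 * c / d) ^ 2 - 1) * d ^ 2 / 2)) ≤
            s * Real.exp (-((s ^ 2 - 1) * d ^ 2 / 2)) := by
          have h2 : s ^ 2 ≤ (2 * c / d) ^ 2 := by nlinarith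
          have h3 : Real.exp (-(((2 * c / d) ^ 2 - 1) * d ^ 2 / 2)) ≤
              Real.exp (-((s ^ 2 - 1) * d ^ 2 / 2)) := Real.exp_le_exp.2 (by nlinarith)
          nlinarith [Real.exp_pos (-((s ^ 2 - 1) * d ^ 2 / 2))]
        nlinarith [Real.exp_pos (-(((2 * c / d) ^ 2 - 1) * d ^ 2 / 2))]
    have hgneg := h.scaleMean_neg h0 (show 1 < s by linarith) hi
    have h1ε : 0 < 1 - ε := by linarith [he₁.2.1]
    have hχ : 0 < χ (|w ε| / s) := by
      by_contra hle
      have : ε * χ (|w ε| / s) ≤ 0 := mul_nonpos_of_nonneg_of_nonpos he₁.1.le (by linarith)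
      have := mul_neg_of_pos_of_neg h1ε hgneg
      linarith
    have hg' := hg.resolve_right (by linarith)
    have hM : χ (|w ε| / s) ≤ M₂ := by
      refine (le_abs_self _).trans (hM₂ _ ?_)
      rw [abs_of_pos hw0, div_le_iff₀ hs0]
      nlinarith
    have := mul_le_mul_of_nonneg_left hM he₁.1.le
    have := mul_le_mul_of_nonneg_left hg' h1ε.le
    linarith [he₂.2.2]
  · have hg : c / (2 * d) * tiltedMean χ d (1 - δ) ≤ scaleMean χ s ∨ 0 ≤ χ (|w ε| / s) := by
      rcases lt_or_ge d (|w ε| / s) with h1 | h1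
      · exact .inr (hpos _ h1)
      · left
        have hsw : c / (2 * d) ≤ s := by
          rw [div_le_iff₀ hs0] at h1
          rw [div_le_iff₀ (by positivity)]
          linarith
        have htl := tiltedMean_lt hd h.even hneg hpos h.not_null hs0
          (show s < 1 - δ by linarith) hi hia
        rw [scaleMean_eq_tiltedMean χ d hs0]
        have hexp : 1 ≤ Real.exp (-((s ^ 2 - 1) * d ^ 2 / 2)) := by
          refine Real.one_le_exp ?_
          have : s ^ 2 ≤ 1 := by nlinarith
          nlinarith [sq_nonneg d]
        refine mul_le_mul ?_ htl.le ha.le (by positivity)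
        exact hsw.trans (le_mul_of_one_le_right hs0.le hexp)
    have hgpos := h.scaleMean_pos h0 hs0 (show s < 1 by linarith) hi
    have h1ε : 0 < 1 - ε := by linarith [he₁.2.1]
    have hχ : χ (|w ε| / s) < 0 := by
      by_contra hle
      have : 0 ≤ ε * χ (|w ε| / s) := mul_nonneg he₁.1.le (by linarith)
      have := mul_pos h1ε hgpos
      linarith
    have hg' := hg.resolve_right (by linarith)
    have hM : -M₁ ≤ χ (|w ε| / s) := by
      have hle : |w ε| / s ≤ d := by
        by_contra hlt
        exact absurd (hpos _ (not_le.1 hlt)) (by linarith)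
      exact (abs_le.1 (hM₁ _ (by rwa [abs_of_pos hw0]))).1
    have := mul_le_mul_of_nonneg_left hM he₁.1.le
    have := mul_le_mul_of_nonneg_left hg' h1ε.le
    linarith [he₁.2.2]

/-- For a bounded monotone score the roots stay close to the scale of the model under any small
contamination. -/
lemma WellBehavedScore.eventually_roots_near_of_monotone {χ : ℝ → ℝ} (h : WellBehavedScore χ)
    (h0 : ∫ z, χ z ∂stdNormal = 0) (hm : MonotoneOn χ (Set.Ici 0)) {b : ℝ} (hb : ∀ x, |χ x| ≤ b)
    (w : ℝ → ℝ) {δ : ℝ} (hδ : 0 < δ) (hδ' : δ < 1 / 50) :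
    ∀ᶠ ε in 𝓝[>] (0 : ℝ), ∀ s, IsScaleRoot χ (contaminated stdNormal (w ε) ε) s →
      |s - 1| ≤ δ := by
  have hball : ∀ t, |t - 1| ≤ δ → t ∈ Metric.ball (1 : ℝ) (1 / 50) := fun t ht => by
    rw [Metric.mem_ball, Real.dist_eq]; linarith
  have hia := integrable_comp_div_of_mem_ball h.square_integrable
    (hball (1 - δ) (by simp [abs_of_pos hδ]))
  have hib := integrable_comp_div_of_mem_ball h.square_integrable
    (hball (1 + δ) (by simp [abs_of_pos hδ]))
  have hga := h.scaleMean_pos h0 (by linarith) (by linarith) hia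
  have hgb := h.scaleMean_neg h0 (by linarith) hib
  -- For a score increasing in |x| the mean score is itself decreasing in s. Together with
  -- boundedness this replaces the tilting, and the contaminating points may be arbitrary, in
  -- particular near 0.
  have hanti : ∀ s t, 0 < s → s ≤ t → Integrable (fun x => χ (x / s)) stdNormal →
      Integrable (fun x => χ (x / t)) stdNormal → scaleMean χ t ≤ scaleMean χ s := by
    intro s t hs hst his hit
    refine integral_mono hit his fun x => ?_
    have ht : 0 < t := hs.trans_le hst
    change χ (x / t) ≤ χ (x / s)
    rw [← score_abs h.even (x / s), ← score_abs h.even (x / t), abs_div, abs_div, abs_of_pos hs,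
      abs_of_pos ht]
    exact hm (by simp; positivity) (by simp; positivity)
      (div_le_div_of_nonneg_left (abs_nonneg x) hs hst)
  filter_upwards [eventually_small_mul_lt b hga, eventually_small_mul_lt b (neg_pos.2 hgb)]
    with ε he₁ he₂ s hs
  rw [isScaleRoot_contaminated_iff _ _ _ he₁.1.le he₁.2.1] at hs
  obtain ⟨hs0, hi, heq⟩ := hs
  by_contra hcon
  have h1ε : 0 < 1 - ε := by linarith [he₁.2.1]
  have hbs := abs_le.1 (hb (w ε / s))
  rw [not_le, lt_abs] at hcon
  rcases hcon with hcon | hcon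
  · have := mul_le_mul_of_nonneg_left (hanti (1 + δ) s (by linarith) (by linarith) hib hi) h1ε.le
    have := mul_le_mul_of_nonneg_left hbs.2 he₁.1.le
    linarith [he₂.2.2]
  · have := mul_le_mul_of_nonneg_left (hanti s (1 - δ) hs0 (by linarith) hi hia) h1ε.le
    have := mul_le_mul_of_nonneg_left hbs.1 he₁.1.le
    linarith [he₁.2.2]

/-- Where the score is continuous, the M-equation stays solvable under small contamination. -/
lemma WellBehavedScore.eventually_exists_root {χ : ℝ → ℝ} (h : WellBehavedScore χ)
    (h0 : ∫ z, χ z ∂stdNormal = 0) {w : ℝ → ℝ} {c : ℝ} (hχ : ContinuousAt χ c)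
    (hw : Tendsto (fun ε => |w ε|) (𝓝[>] 0) (𝓝 c)) :
    ∀ᶠ ε in 𝓝[>] (0 : ℝ), ∃ s, IsScaleRoot χ (contaminated stdNormal (w ε) ε) s := by
  -- A finite set is closed, so χ is continuous on a whole neighborhood of c. This gives continuity
  -- of the contaminated equation on an interval of scales around 1.
  have hU : {x | ¬ ContinuousAt χ x}ᶜ ∈ 𝓝 c :=
    h.finite_discontinuities.isClosed.isOpen_compl.mem_nhds (by simpa using hχ)
  have hdiv : Tendsto (fun p : ℝ × ℝ => p.1 / p.2) (𝓝 c ×ˢ 𝓝 1) (𝓝 c) := by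
    have : ContinuousAt (fun p : ℝ × ℝ => p.1 / p.2) (c, 1) :=
      continuousAt_fst.div continuousAt_snd one_ne_zero
    simpa [ContinuousAt, nhds_prod_eq] using this
  obtain ⟨U, hUc, V, hV1, hUV⟩ := mem_prod_iff.1 (hdiv hU)
  obtain ⟨r, hr, hrV⟩ := Metric.mem_nhds_iff.1 hV1
  set δ := min (r / 2) (1 / 100) with hδdef
  have hδ : 0 < δ := by positivity
  have hδr : δ < r := (min_le_left _ _).trans_lt (by linarith)
  have hδ' : δ < 1 / 50 := (min_le_right _ _).trans_lt (by norm_num)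
  have hball : ∀ t, |t - 1| ≤ δ → t ∈ Metric.ball (1 : ℝ) (1 / 50) := fun t ht => by
    rw [Metric.mem_ball, Real.dist_eq]; linarith
  have hia := integrable_comp_div_of_mem_ball h.square_integrable
    (hball (1 - δ) (by simp [abs_of_pos hδ]))
  have hib := integrable_comp_div_of_mem_ball h.square_integrable
    (hball (1 + δ) (by simp [abs_of_pos hδ]))
  have hga := h.scaleMean_pos h0 (by linarith) (by linarith) hia
  have hgb := h.scaleMean_neg h0 (by linarith) hib
  obtain ⟨M, hM⟩ := h.locally_bounded (2 * (c + 1))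
  have hc0 : 0 ≤ c := ge_of_tendsto' hw fun _ => abs_nonneg _
  filter_upwards [eventually_small_mul_lt M hga, eventually_small_mul_lt M (neg_pos.2 hgb),
    hw.eventually hUc, hw.eventually (gt_mem_nhds (show c < c + 1 by linarith))]
    with ε he₁ he₂ hwU hw1
  have hws : ∀ s, 0 < s → χ (w ε / s) = χ (|w ε| / s) := fun s hs0 => by
    rw [← score_abs h.even, abs_div, abs_of_pos hs0]
  have hbd : ∀ s, 1 / 2 ≤ s → |χ (|w ε| / s)| ≤ M := fun s hs => hM _ (by
    have hs0 : 0 < s := by linarith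
    rw [abs_div, abs_abs, abs_of_pos hs0, div_le_iff₀ hs0]
    nlinarith)
  have hcont : ContinuousOn (fun s => (1 - ε) * scaleMean χ s + ε * χ (|w ε| / s))
      (Set.Icc (1 - δ) (1 + δ)) := by
    have hsub : Set.Icc (1 - δ) (1 + δ) ⊆ Metric.ball (1 : ℝ) (1 / 50) := fun t ht =>
      hball t (abs_le.2 ⟨by linarith [ht.1], by linarith [ht.2]⟩)
    refine ((continuousOn_scaleMean h.square_integrable).mono hsub |>.const_mul _).add
      (ContinuousOn.const_mul ?_ _)
    intro s hs
    have hsV : s ∈ V := hrV (by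
      rw [Metric.mem_ball, Real.dist_eq, abs_lt]
      constructor <;> linarith [hs.1, hs.2])
    have h1 : ContinuousAt χ (|w ε| / s) := by
      have : (|w ε|, s) ∈ U ×ˢ V := ⟨hwU, hsV⟩
      simpa using hUV this
    exact (ContinuousAt.comp (f := fun s => |w ε| / s) h1
      (continuousAt_const.div continuousAt_id (by
        have := hs.1; change s ≠ 0; linarith))).continuousWithinAt
  have h1ε : 0 < 1 - ε := by linarith [he₁.2.1]
  have hmem : (0 : ℝ) ∈ Set.Icc ((1 - ε) * scaleMean χ (1 + δ) + ε * χ (|w ε| / (1 + δ)))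
      ((1 - ε) * scaleMean χ (1 - δ) + ε * χ (|w ε| / (1 - δ))) := by
    have h1 := mul_le_mul_of_nonneg_left (abs_le.1 (hbd (1 + δ) (by linarith))).2 he₁.1.le
    have h2 := mul_le_mul_of_nonneg_left (abs_le.1 (hbd (1 - δ) (by linarith))).1 he₁.1.le
    constructor
    · linarith [he₂.2.2]
    · linarith [he₁.2.2]
  obtain ⟨s, hs, hs0⟩ := intermediate_value_Icc' (by linarith) hcont hmem
  refine ⟨s, (isScaleRoot_contaminated_iff _ _ _ he₁.1.le he₁.2.1).2 ⟨by linarith [hs.1],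
    integrable_comp_div_of_mem_ball h.square_integrable
      (hball s (abs_le.2 ⟨by linarith [hs.1], by linarith [hs.2]⟩)), ?_⟩⟩
  rw [hws s (by linarith [hs.1])]
  exact hs0

/-- The influence of the contaminating point on a localized root of the M-equation. -/
lemma WellBehavedScore.tendsto_root {χ : ℝ → ℝ} (h : WellBehavedScore χ)
    (h0 : ∫ z, χ z ∂stdNormal = 0) {w : ℝ → ℝ} {c : ℝ} (hχ : ContinuousAt χ c)
    (hw : Tendsto (fun ε => |w ε|) (𝓝[>] 0) (𝓝 c))
    (hloc : ∀ δ : ℝ, 0 < δ → δ < 1 / 50 → ∀ᶠ ε in 𝓝[>] (0 : ℝ), ∀ s,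
      IsScaleRoot χ (contaminated stdNormal (w ε) ε) s → |s - 1| ≤ δ)
    {t : ℝ → ℝ}
    (ht : ∀ᶠ ε in 𝓝[>] (0 : ℝ), IsScaleRoot χ (contaminated stdNormal (w ε) ε) (t ε)) :
    Tendsto (fun ε => (t ε - 1) / ε) (𝓝[>] 0) (𝓝 (χ c / scaleSensitivity χ)) := by
  have ht1 : Tendsto t (𝓝[>] 0) (𝓝 1) := by
    rw [Metric.tendsto_nhds]
    intro η hη
    have hm : 0 < min (η / 2) (1 / 100) := by positivity
    filter_upwards [hloc _ hm ((min_le_right _ _).trans_lt (by norm_num)), ht] with ε h1 h2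
    rw [Real.dist_eq]
    exact ((h1 _ h2).trans (min_le_left _ _)).trans_lt (by linarith)
  have hB := h.scaleSensitivity_pos h0
  -- The continuous extension of the difference quotient also covers those ε for which the root
  -- equals 1. The root equation then reads (1 - ε)(t - 1) · slope + ε χ(|w|/t) = 0, which is solved
  -- for (t - 1)/ε.
  have hslope : Tendsto (fun ε => dslope (scaleMean χ) 1 (t ε)) (𝓝[>] 0)
      (𝓝 (-scaleSensitivity χ)) := by
    have hd := hasDerivAt_scaleMean_one h.square_integrable
    have := (continuousAt_dslope_same.2 hd.differentiableAt).tendsto.comp ht1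
    rwa [dslope_same, hd.deriv] at this
  have hχt : Tendsto (fun ε => χ (|w ε| / t ε)) (𝓝[>] 0) (𝓝 (χ c)) := by
    have := hw.div ht1 one_ne_zero
    rw [div_one] at this
    exact hχ.tendsto.comp this
  have h1ε : Tendsto (fun ε : ℝ => 1 - ε) (𝓝[>] 0) (𝓝 1) := by
    have : Continuous fun ε : ℝ => 1 - ε := by fun_prop
    simpa using (this.tendsto 0).mono_left (nhdsWithin_le_nhds (s := Set.Ioi 0))
  have hlim := (hχt.div (h1ε.mul hslope) (by simpa using hB.ne')).neg
  rw [one_mul, div_neg, neg_neg] at hlim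
  refine hlim.congr' ?_
  filter_upwards [ht, self_mem_nhdsWithin, nhdsWithin_le_nhds (gt_mem_nhds one_pos),
    hslope.eventually (gt_mem_nhds (show -scaleSensitivity χ < 0 by linarith))] with ε h1 h2 h3 h4
  have h2' : 0 < ε := h2
  rw [isScaleRoot_contaminated_iff _ _ _ h2'.le h3] at h1
  obtain ⟨hs0, -, heq⟩ := h1
  have hws : χ (w ε / t ε) = χ (|w ε| / t ε) := by
    rw [← score_abs h.even, abs_div, abs_of_pos hs0]
  rw [hws] at heq
  have hsl := sub_smul_dslope (scaleMean χ) 1 (t ε)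
  rw [scaleMean_one, h0, sub_zero, smul_eq_mul] at hsl
  rw [← hsl] at heq
  have h1ε : 1 - ε ≠ 0 := by linarith
  change -(χ (|w ε| / t ε) / ((1 - ε) * dslope (scaleMean χ) 1 (t ε))) = (t ε - 1) / ε
  field_simp [h4.ne, h1ε]
  linarith

/-! ### The median -/

section Median

variable (P : Measure ℝ) [IsProbabilityMeasure P]

lemma compl_Iic_real (t : ℝ) : P.real (Set.Ioi t) = 1 - P.real (Set.Iic t) := by
  rw [← Set.compl_Iic, probReal_compl_eq_one_sub measurableSet_Iic]

lemma tendsto_real_Iic_atTop : Tendsto (fun t => P.real (Set.Iic t)) atTop (𝓝 1) := by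
  simpa only [← cdf_eq_real] using tendsto_cdf_atTop P

lemma tendsto_real_Iic_atBot : Tendsto (fun t => P.real (Set.Iic t)) atBot (𝓝 0) := by
  simpa only [← cdf_eq_real] using tendsto_cdf_atBot P

lemma real_Ici_le {s t : ℝ} (h : s < t) : P.real (Set.Ici t) ≤ 1 - P.real (Set.Iic s) := by
  rw [← compl_Iic_real]
  exact measureReal_mono (Set.Ici_subset_Ioi.2 h)

lemma le_real_Ici (t : ℝ) : 1 - P.real (Set.Iic t) ≤ P.real (Set.Ici t) := by
  rw [← compl_Iic_real]
  exact measureReal_mono Set.Ioi_subset_Ici_self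

lemma lowerMedians_nonempty : {t : ℝ | 1 / 2 ≤ P.real (Set.Iic t)}.Nonempty :=
  (((tendsto_real_Iic_atTop P).eventually (lt_mem_nhds (by norm_num : (1 / 2 : ℝ) < 1))).mono
    fun _ h => h.le).exists

lemma lowerMedians_bddBelow : BddBelow {t : ℝ | 1 / 2 ≤ P.real (Set.Iic t)} := by
  obtain ⟨a, ha⟩ := ((tendsto_real_Iic_atBot P).eventually
    (gt_mem_nhds (by norm_num : (0 : ℝ) < 1 / 2))).exists
  refine ⟨a, fun t (ht : 1 / 2 ≤ P.real (Set.Iic t)) => ?_⟩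
  by_contra hlt
  have : P.real (Set.Iic t) ≤ P.real (Set.Iic a) :=
    measureReal_mono (Set.Iic_subset_Iic.2 (not_le.1 hlt).le)
  linarith

lemma upperMedians_nonempty : {t : ℝ | 1 / 2 ≤ P.real (Set.Ici t)}.Nonempty := by
  obtain ⟨a, ha⟩ := ((tendsto_real_Iic_atBot P).eventually
    (gt_mem_nhds (by norm_num : (0 : ℝ) < 1 / 2))).exists
  refine ⟨a, ?_⟩
  have := le_real_Ici P a
  simp only [Set.mem_ofPred_eq]
  linarith

lemma upperMedians_bddAbove : BddAbove {t : ℝ | 1 / 2 ≤ P.real (Set.Ici t)} := by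
  obtain ⟨a, ha⟩ := ((tendsto_real_Iic_atTop P).eventually
    (lt_mem_nhds (by norm_num : (1 / 2 : ℝ) < 1))).exists
  refine ⟨a, fun t (ht : 1 / 2 ≤ P.real (Set.Ici t)) => ?_⟩
  by_contra hlt
  have := real_Ici_le P (not_le.1 hlt)
  linarith

/-- The strict inequality puts both ends of the median interval on the same side of t, so the
midpoint convention does no harm. -/
lemma med_le {t : ℝ} (h : 1 / 2 < P.real (Set.Iic t)) : med P ≤ t := by
  have h1 : sInf {t : ℝ | 1 / 2 ≤ P.real (Set.Iic t)} ≤ t := csInf_le (lowerMedians_bddBelow P) h.le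
  have h2 : sSup {t : ℝ | 1 / 2 ≤ P.real (Set.Ici t)} ≤ t := by
    refine csSup_le (upperMedians_nonempty P) fun s hs => ?_
    simp only [Set.mem_ofPred_eq] at hs
    by_contra hlt
    have := real_Ici_le P (not_le.1 hlt)
    linarith
  rw [med]
  linarith

lemma le_med {t : ℝ} (h : P.real (Set.Iic t) < 1 / 2) : t ≤ med P := by
  have h1 : t ≤ sInf {t : ℝ | 1 / 2 ≤ P.real (Set.Iic t)} := by
    refine le_csInf (lowerMedians_nonempty P) fun s hs => ?_
    simp only [Set.mem_ofPred_eq] at hs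
    by_contra hlt
    have : P.real (Set.Iic s) ≤ P.real (Set.Iic t) :=
      measureReal_mono (Set.Iic_subset_Iic.2 (not_le.1 hlt).le)
    linarith
  have h2 : t ≤ sSup {t : ℝ | 1 / 2 ≤ P.real (Set.Ici t)} := by
    refine le_csSup (upperMedians_bddAbove P) ?_
    have := le_real_Ici P t
    simp only [Set.mem_ofPred_eq]
    linarith
  rw [med]
  linarith

lemma med_eq_of_forall {t : ℝ} (h1 : ∀ s, t < s → 1 / 2 < P.real (Set.Iic s))
    (h2 : ∀ s, s < t → P.real (Set.Iic s) < 1 / 2) : med P = t :=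
  le_antisymm (le_of_forall_gt_imp_ge_of_dense fun s hs => med_le P (h1 s hs))
    (le_of_forall_lt_imp_le_of_dense fun s hs => le_med P (h2 s hs))

end Median

open scoped Pointwise in
lemma med_map_mul (P : Measure ℝ) {c : ℝ} (hc : 0 < c) :
    med (P.map fun x => c * x) = c * med P := by
  have hm : Measurable fun x : ℝ => c * x := by fun_prop
  have h1 : {t : ℝ | 1 / 2 ≤ (P.map fun x => c * x).real (Set.Iic t)}
      = c • {t : ℝ | 1 / 2 ≤ P.real (Set.Iic t)} := by
    ext t
    rw [Set.mem_smul_set_iff_inv_smul_mem₀ hc.ne', Set.mem_ofPred_eq, Set.mem_ofPred_eq,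
      map_measureReal_apply hm measurableSet_Iic]
    have : (fun x => c * x) ⁻¹' Set.Iic t = Set.Iic (c⁻¹ • t) := by
      ext x
      simp [le_inv_mul_iff₀ hc]
    rw [this]
  have h2 : {t : ℝ | 1 / 2 ≤ (P.map fun x => c * x).real (Set.Ici t)}
      = c • {t : ℝ | 1 / 2 ≤ P.real (Set.Ici t)} := by
    ext t
    rw [Set.mem_smul_set_iff_inv_smul_mem₀ hc.ne', Set.mem_ofPred_eq, Set.mem_ofPred_eq,
      map_measureReal_apply hm measurableSet_Ici]
    have : (fun x => c * x) ⁻¹' Set.Ici t = Set.Ici (c⁻¹ • t) := by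
      ext x
      simp [inv_mul_le_iff₀ hc]
    rw [this]
  rw [med, h1, h2, Real.sInf_smul_of_nonneg hc.le, Real.sSup_smul_of_nonneg hc.le, med]
  simp only [smul_eq_mul]
  ring

lemma madKnownCenter_map_mul (P : Measure ℝ) {c : ℝ} (hc : 0 < c) :
    madKnownCenter (P.map fun x => c * x) = c * madKnownCenter P := by
  have : (P.map fun x => c * x).map (fun x => |x|) = (P.map fun x => |x|).map fun x => c * x := by
    rw [Measure.map_map (by fun_prop) (by fun_prop), Measure.map_map (by fun_prop) (by fun_prop)]
    congr 1
    ext x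
    simp [abs_mul, abs_of_pos hc]
  rw [madKnownCenter, this, med_map_mul _ hc, madKnownCenter]
  ring

lemma mad_map_mul (P : Measure ℝ) {c : ℝ} (hc : 0 < c) :
    mad (P.map fun x => c * x) = c * mad P := by
  have : (P.map fun x => c * x).map (fun x => |x - med (P.map fun x => c * x)|)
      = (P.map fun x => |x - med P|).map fun x => c * x := by
    rw [Measure.map_map (by fun_prop) (by fun_prop), Measure.map_map (by fun_prop) (by fun_prop),
      med_map_mul _ hc]
    congr 1
    ext x
    simp [← mul_sub, abs_mul, abs_of_pos hc]
  rw [mad, this, med_map_mul _ hc, mad]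
  ring

/-! ### The standard normal distribution function -/

/-- The standard normal distribution function. -/
def normalCDF (t : ℝ) : ℝ := stdNormal.real (Set.Iic t)

instance : NullSingletonClass stdNormal := nullSingletonClass_gaussianReal one_ne_zero

lemma normalCDF_sub {a b : ℝ} (h : a ≤ b) :
    stdNormal.real (Set.Icc a b) = normalCDF b - normalCDF a := by
  rw [measureReal_congr (Ioc_ae_eq_Icc (μ := stdNormal)).symm, ← Set.Iic_sdiff_Iic,
    measureReal_sdiff (Set.Iic_subset_Iic.2 h) measurableSet_Iic, normalCDF, normalCDF]

lemma normalCDF_eq_integral (t : ℝ) :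
    normalCDF t = normalCDF 0 + ∫ x in (0 : ℝ)..t, gaussianPDFReal 0 1 x := by
  have h : ∀ t, normalCDF t = ∫ x in Set.Iic t, gaussianPDFReal 0 1 x := fun t => by
    rw [normalCDF, measureReal_def, gaussianReal_apply_eq_integral 0 one_ne_zero,
      ENNReal.toReal_ofReal (integral_nonneg fun x => gaussianPDFReal_nonneg 0 1 x)]
  rw [h, h, ← intervalIntegral.integral_Iic_sub_Iic
    (integrable_gaussianPDFReal 0 1).integrableOn (integrable_gaussianPDFReal 0 1).integrableOn]
  ring

lemma continuous_gaussianPDFReal : Continuous (gaussianPDFReal 0 1) := by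
  unfold gaussianPDFReal
  fun_prop

lemma hasDerivAt_normalCDF (t : ℝ) : HasDerivAt normalCDF (gaussianPDFReal 0 1 t) t := by
  have h := (continuous_gaussianPDFReal.integral_hasStrictDerivAt 0 t).hasDerivAt.const_add
    (normalCDF 0)
  exact h.congr_of_eventuallyEq (Eventually.of_forall normalCDF_eq_integral)

lemma strictMono_normalCDF : StrictMono normalCDF :=
  strictMono_of_hasDerivAt_pos hasDerivAt_normalCDF
    fun x => gaussianPDFReal_pos 0 1 x one_ne_zero

lemma continuous_normalCDF : Continuous normalCDF :=
  continuous_iff_continuousAt.2 fun t => (hasDerivAt_normalCDF t).continuousAt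

lemma normalCDF_neg (t : ℝ) : normalCDF (-t) = 1 - normalCDF t := by
  have h : stdNormal.map (fun x => -x) = stdNormal := by
    have := gaussianReal_map_neg (μ := 0) (v := 1)
    rwa [neg_zero] at this
  have h1 : normalCDF (-t) = stdNormal.real (Set.Ici t) := by
    rw [normalCDF, ← h, map_measureReal_apply (by fun_prop) measurableSet_Iic,
      show (fun x : ℝ => -x) ⁻¹' Set.Iic (-t) = Set.Ici t by ext; simp, h]
  rw [h1, measureReal_congr (Ioi_ae_eq_Ici (μ := stdNormal)).symm, compl_Iic_real, normalCDF]

lemma normalCDF_zero : normalCDF 0 = 1 / 2 := by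
  have := normalCDF_neg 0
  rw [neg_zero] at this
  linarith

lemma normalCDF_quartile : normalCDF normalQuartile = 3 / 4 := by
  obtain ⟨a, ha⟩ := ((tendsto_real_Iic_atTop stdNormal).eventually
    (lt_mem_nhds (by norm_num : (3 / 4 : ℝ) < 1))).exists
  have ha' : 3 / 4 < normalCDF a := ha
  have h0a : 0 ≤ a := by
    by_contra hlt
    have := strictMono_normalCDF (not_le.1 hlt)
    rw [normalCDF_zero] at this
    linarith
  obtain ⟨t, -, ht⟩ := intermediate_value_Icc h0a continuous_normalCDF.continuousOn
    (show (3 / 4 : ℝ) ∈ Set.Icc _ _ from ⟨by rw [normalCDF_zero]; norm_num, ha'.le⟩)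
  have : {t : ℝ | 3 / 4 ≤ stdNormal.real (Set.Iic t)} = Set.Ici t := by
    ext s
    change 3 / 4 ≤ normalCDF s ↔ t ≤ s
    rw [← ht, strictMono_normalCDF.le_iff_le]
  rw [normalQuartile, this, csInf_Ici, ht]

lemma normalQuartile_pos : 0 < normalQuartile := by
  rw [← strictMono_normalCDF.lt_iff_lt, normalCDF_zero, normalCDF_quartile]
  norm_num

lemma normalCDF_neg_quartile : normalCDF (-normalQuartile) = 1 / 4 := by
  rw [normalCDF_neg, normalCDF_quartile]
  norm_num

/-! ### The MAD under contamination of the normal model -/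

/-- The common absolute value `1 / (4 q φ(q))` of the influence of the MAD. -/
def madInfluence : ℝ := 1 / (4 * normalQuartile * gaussianPDFReal 0 1 normalQuartile)

lemma gaussianPDFReal_quartile_pos : 0 < gaussianPDFReal 0 1 normalQuartile :=
  gaussianPDFReal_pos 0 1 _ one_ne_zero

lemma madInfluence_pos : 0 < madInfluence := by
  have := normalQuartile_pos
  have := gaussianPDFReal_quartile_pos
  unfold madInfluence
  positivity

/-- A first-order expansion along increments of order ε, divided by ε and not by the increment,
which may vanish. -/
lemma hasDerivAt_tendsto_div {f : ℝ → ℝ} {f' a : ℝ} (hf : HasDerivAt f f' a) {g : ℝ → ℝ}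
    {K : ℝ} (hg : ∀ᶠ ε in 𝓝[>] (0 : ℝ), |g ε| ≤ K * ε) :
    Tendsto (fun ε => (f (a + g ε) - f a - f' * g ε) / ε) (𝓝[>] 0) (𝓝 0) := by
  have hgO : g =O[𝓝[>] 0] (fun ε : ℝ => ε) := by
    refine IsBigO.of_bound K ?_
    filter_upwards [hg, self_mem_nhdsWithin] with ε h1 h2
    rwa [Real.norm_eq_abs, Real.norm_eq_abs, abs_of_pos (show (0 : ℝ) < ε from h2)]
  have hid : Tendsto (fun ε : ℝ => ε) (𝓝[>] 0) (𝓝 0) :=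
    tendsto_id.mono_left nhdsWithin_le_nhds
  have hg0 : Tendsto g (𝓝[>] 0) (𝓝 0) := hgO.trans_tendsto hid
  have h1 := (hasDerivAt_iff_isLittleO_nhds_zero.1 hf).comp_tendsto hg0
  have h2 := (h1.trans_isBigO hgO).tendsto_div_nhds_zero
  refine h2.congr fun ε => ?_
  simp [mul_comm]

lemma map_abs_sub_contaminated_real (w m : ℝ) {ε t : ℝ} (h0 : 0 ≤ ε) (h1 : ε ≤ 1) (ht : 0 ≤ t) :
    ((contaminated stdNormal w ε).map fun x => |x - m|).real (Set.Iic t) =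
      (1 - ε) * (normalCDF (t + m) + normalCDF (t - m) - 1) +
        ε * (Measure.dirac w).real (Set.Icc (m - t) (m + t)) := by
  have hpre : (fun x : ℝ => |x - m|) ⁻¹' Set.Iic t = Set.Icc (m - t) (m + t) := by
    ext x
    simp only [Set.mem_preimage, Set.mem_Iic, abs_le, Set.mem_Icc]
    constructor <;> rintro ⟨h1, h2⟩ <;> constructor <;> linarith
  rw [map_measureReal_apply (by fun_prop) measurableSet_Iic, hpre,
    contaminated_real_apply _ _ h0 h1, normalCDF_sub (by linarith),
    show m - t = -(t - m) by ring, normalCDF_neg, add_comm m t]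
  ring

section Path

variable {w m : ℝ → ℝ} {K : ℝ} (hm : ∀ᶠ ε in 𝓝[>] (0 : ℝ), |m ε| ≤ K * ε)
include hm

/-- The center enters the two terms with opposite signs and the same derivative φ(q), so its
first-order effect cancels. This is why estimating the center leaves the influence of the MAD
unchanged. -/
lemma tendsto_normalCDF_window (k : ℝ) :
    Tendsto (fun ε => (normalCDF (normalQuartile * (1 + k * ε) + m ε) +
      normalCDF (normalQuartile * (1 + k * ε) - m ε) - 1 - 1 / 2) / ε) (𝓝[>] 0)
      (𝓝 (k / (2 * madInfluence))) := by
  have hq := normalQuartile_pos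
  have hφ := gaussianPDFReal_quartile_pos
  have hb1 : ∀ᶠ ε in 𝓝[>] (0 : ℝ), |normalQuartile * k * ε + m ε| ≤
      (|normalQuartile * k| + K) * ε := by
    filter_upwards [hm, self_mem_nhdsWithin] with ε h1 (h2 : 0 < ε)
    refine (abs_add_le _ _).trans ?_
    rw [abs_mul, abs_of_pos h2]
    linarith
  have hb2 : ∀ᶠ ε in 𝓝[>] (0 : ℝ), |normalQuartile * k * ε - m ε| ≤
      (|normalQuartile * k| + K) * ε := by
    filter_upwards [hm, self_mem_nhdsWithin] with ε h1 (h2 : 0 < ε)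
    refine (abs_sub _ _).trans ?_
    rw [abs_mul, abs_of_pos h2]
    linarith
  have l1 := hasDerivAt_tendsto_div (hasDerivAt_normalCDF normalQuartile) hb1
  have l2 := hasDerivAt_tendsto_div (hasDerivAt_normalCDF normalQuartile) hb2
  have l3 := (l1.add l2).add_const (k / (2 * madInfluence))
  rw [add_zero, zero_add] at l3
  refine l3.congr' ?_
  filter_upwards [self_mem_nhdsWithin] with ε (hε : 0 < ε)
  rw [normalCDF_quartile, madInfluence,
    show normalQuartile + (normalQuartile * k * ε + m ε) = normalQuartile * (1 + k * ε) + m ε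
      by ring,
    show normalQuartile + (normalQuartile * k * ε - m ε) = normalQuartile * (1 + k * ε) - m ε
      by ring]
  field_simp
  ring

end Path

/-- The deviation, in the first order, of the mass of a window around the quartiles from one half,
without the mass of the contaminating point. -/
lemma tendsto_window_mass {m : ℝ → ℝ} {K : ℝ} (hm : ∀ᶠ ε in 𝓝[>] (0 : ℝ), |m ε| ≤ K * ε) (k : ℝ) :
    Tendsto (fun ε => ((1 - ε) * (normalCDF (normalQuartile * (1 + k * ε) + m ε) +
      normalCDF (normalQuartile * (1 + k * ε) - m ε) - 1) - 1 / 2) / ε) (𝓝[>] 0)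
      (𝓝 (k / (2 * madInfluence) - 1 / 2)) := by
  have h := tendsto_normalCDF_window hm k
  have hid : Tendsto (fun ε : ℝ => ε) (𝓝[>] 0) (𝓝 0) := tendsto_id.mono_left nhdsWithin_le_nhds
  have h2 := h.sub ((hid.mul h).add_const (1 / 2))
  rw [zero_mul, zero_add] at h2
  refine h2.congr' ?_
  filter_upwards [self_mem_nhdsWithin] with ε (hε : 0 < ε)
  field_simp
  ring

lemma eventually_one_add_mul_pos (k : ℝ) : ∀ᶠ ε in 𝓝[>] (0 : ℝ), 0 < 1 + k * ε := by
  have : Continuous fun ε : ℝ => 1 + k * ε := by fun_prop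
  have h := (this.tendsto 0).mono_left (nhdsWithin_le_nhds (s := Set.Ioi 0))
  rw [mul_zero, add_zero] at h
  exact h.eventually (lt_mem_nhds one_pos)

lemma eventually_mem_Ioo : ∀ᶠ ε in 𝓝[>] (0 : ℝ), 0 < ε ∧ ε < 1 :=
  (eventually_small_mul_lt 0 one_pos).mono fun _ h => ⟨h.1, h.2.1⟩

instance isProbabilityMeasure_map_abs_sub (P : Measure ℝ) [IsProbabilityMeasure P] (m : ℝ) :
    IsProbabilityMeasure (P.map fun x => |x - m|) :=
  Measure.isProbabilityMeasure_map (by fun_prop)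

section Path

variable {w m : ℝ → ℝ} {K : ℝ}

/-- First order upper bound for the median of the absolute deviations from a center that tends to
`0`, in terms of a lower bound for the mass which the contaminating point gives to the window. -/
lemma eventually_medianDeviation_le (hm : ∀ᶠ ε in 𝓝[>] (0 : ℝ), |m ε| ≤ K * ε) {lo k : ℝ}
    (hlo : ∀ᶠ ε in 𝓝[>] (0 : ℝ), lo ≤ (Measure.dirac (w ε)).real
      (Set.Icc (m ε - normalQuartile * (1 + k * ε)) (m ε + normalQuartile * (1 + k * ε))))
    (hk : madInfluence * (1 - 2 * lo) < k) :
    ∀ᶠ ε in 𝓝[>] (0 : ℝ),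
      1 / normalQuartile * med ((contaminated stdNormal (w ε) ε).map fun x => |x - m ε|)
        ≤ 1 + k * ε := by
  have hc := madInfluence_pos
  have hq := normalQuartile_pos
  -- Beyond 1/2, the window has mass ε (k/(2 `madInfluence`) - 1/2) to first order, plus at least ε
  -- `lo` from the contaminating point. The condition on k makes this excess positive.
  have hpos : -lo < k / (2 * madInfluence) - 1 / 2 := by
    rw [lt_sub_iff_add_lt, lt_div_iff₀ (by positivity)]
    linarith
  filter_upwards [(tendsto_window_mass hm k).eventually (lt_mem_nhds hpos), hlo,
    eventually_mem_Ioo, eventually_one_add_mul_pos k] with ε h1 h2 ⟨h3, h4⟩ h5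
  have := isProbabilityMeasure_contaminated stdNormal (w ε) h3.le h4.le
  rw [one_div, inv_mul_le_iff₀ hq]
  refine med_le _ ?_
  rw [map_abs_sub_contaminated_real _ _ h3.le h4.le (by positivity)]
  rw [lt_div_iff₀ h3] at h1
  nlinarith

lemma eventually_le_medianDeviation (hm : ∀ᶠ ε in 𝓝[>] (0 : ℝ), |m ε| ≤ K * ε) {hi k : ℝ}
    (hhi : ∀ᶠ ε in 𝓝[>] (0 : ℝ), (Measure.dirac (w ε)).real
      (Set.Icc (m ε - normalQuartile * (1 + k * ε)) (m ε + normalQuartile * (1 + k * ε))) ≤ hi)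
    (hk : k < madInfluence * (1 - 2 * hi)) :
    ∀ᶠ ε in 𝓝[>] (0 : ℝ), 1 + k * ε ≤
      1 / normalQuartile * med ((contaminated stdNormal (w ε) ε).map fun x => |x - m ε|) := by
  have hc := madInfluence_pos
  have hq := normalQuartile_pos
  have hneg : k / (2 * madInfluence) - 1 / 2 < -hi := by
    rw [sub_lt_iff_lt_add, div_lt_iff₀ (by positivity)]
    linarith
  filter_upwards [(tendsto_window_mass hm k).eventually (gt_mem_nhds hneg), hhi,
    eventually_mem_Ioo, eventually_one_add_mul_pos k] with ε h1 h2 ⟨h3, h4⟩ h5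
  have := isProbabilityMeasure_contaminated stdNormal (w ε) h3.le h4.le
  rw [one_div, le_inv_mul_iff₀ hq]
  refine le_med _ ?_
  rw [map_abs_sub_contaminated_real _ _ h3.le h4.le (by positivity)]
  rw [div_lt_iff₀ h3] at h1
  nlinarith

lemma dirac_real_mem (x : ℝ) (s : Set ℝ) :
    0 ≤ (Measure.dirac x).real s ∧ (Measure.dirac x).real s ≤ 1 :=
  ⟨measureReal_nonneg, measureReal_le_one⟩

/-- The median of a contaminated standard normal distribution is of the order of the
contamination. -/
lemma exists_abs_med_contaminated_le (w : ℝ → ℝ) :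
    ∃ K, ∀ᶠ ε in 𝓝[>] (0 : ℝ), |med (contaminated stdNormal (w ε) ε)| ≤ K * ε := by
  have hφ : 0 < gaussianPDFReal 0 1 0 := gaussianPDFReal_pos 0 1 0 one_ne_zero
  -- Twice the critical slope 1/(2φ(0)), which leaves a strict margin wherever the contaminating
  -- point lies.
  set K := 1 / gaussianPDFReal 0 1 0 with hK
  have hK0 : 0 < K := by positivity
  have key : ∀ κ : ℝ, Tendsto (fun ε => ((1 - ε) * normalCDF (κ * ε) - 1 / 2) / ε) (𝓝[>] 0)
      (𝓝 (gaussianPDFReal 0 1 0 * κ - 1 / 2)) := by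
    intro κ
    have hb : ∀ᶠ ε in 𝓝[>] (0 : ℝ), |κ * ε| ≤ |κ| * ε := by
      filter_upwards [self_mem_nhdsWithin] with ε (hε : 0 < ε)
      rw [abs_mul, abs_of_pos hε]
    have h1 := hasDerivAt_tendsto_div (hasDerivAt_normalCDF 0) hb
    have h1' := h1.add_const (gaussianPDFReal 0 1 0 * κ)
    have h2 : Tendsto (fun ε : ℝ => normalCDF (κ * ε)) (𝓝[>] 0) (𝓝 (1 / 2)) := by
      have : Continuous fun ε : ℝ => normalCDF (κ * ε) := by
        have := continuous_normalCDF; fun_prop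
      have := (this.tendsto 0).mono_left (nhdsWithin_le_nhds (s := Set.Ioi 0))
      rwa [mul_zero, normalCDF_zero] at this
    have h3 := h1'.sub h2
    rw [zero_add] at h3
    refine h3.congr' ?_
    filter_upwards [self_mem_nhdsWithin] with ε (hε : 0 < ε)
    rw [normalCDF_zero, zero_add]
    field_simp
    ring
  refine ⟨K, ?_⟩
  have hu := (key K).eventually (lt_mem_nhds (show 0 < gaussianPDFReal 0 1 0 * K - 1 / 2 by
    rw [hK, mul_one_div_cancel hφ.ne']; norm_num))
  have hl := (key (-K)).eventually (gt_mem_nhds (show gaussianPDFReal 0 1 0 * -K - 1 / 2 < -1 by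
    rw [mul_neg, hK, mul_one_div_cancel hφ.ne']; norm_num))
  filter_upwards [hu, hl, eventually_mem_Ioo] with ε h1 h2 ⟨h3, h4⟩
  have := isProbabilityMeasure_contaminated stdNormal (w ε) h3.le h4.le
  have hcdf : ∀ t, (contaminated stdNormal (w ε) ε).real (Set.Iic t) =
      (1 - ε) * normalCDF t + ε * (Measure.dirac (w ε)).real (Set.Iic t) := fun t =>
    contaminated_real_apply _ _ h3.le h4.le _
  rw [abs_le]
  constructor
  · refine le_med _ ?_
    have := dirac_real_mem (w ε) (Set.Iic (-(K * ε)))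
    rw [hcdf]
    rw [div_lt_iff₀ h3, neg_mul] at h2
    nlinarith
  · refine med_le _ ?_
    have := dirac_real_mem (w ε) (Set.Iic (K * ε))
    rw [hcdf]
    rw [lt_div_iff₀ h3] at h1
    nlinarith

/-- The scaled median of the absolute deviations from a center that tends to `0` at the order of the
contamination changes at most by `madInfluence` in the first order. -/
lemma eventually_abs_medianDeviation_sub_one_le
    (hm : ∀ᶠ ε in 𝓝[>] (0 : ℝ), |m ε| ≤ K * ε) {k : ℝ} (hk : madInfluence < k) :
    ∀ᶠ ε in 𝓝[>] (0 : ℝ),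
      |1 / normalQuartile * med ((contaminated stdNormal (w ε) ε).map fun x => |x - m ε|) - 1|
        ≤ k * ε := by
  filter_upwards [eventually_medianDeviation_le (w := w) (lo := 0) (k := k) hm
    (Eventually.of_forall fun ε => (dirac_real_mem _ _).1) (by linarith),
    eventually_le_medianDeviation (w := w) (hi := 1) (k := -k) hm
    (Eventually.of_forall fun ε => (dirac_real_mem _ _).2) (by linarith)] with ε h1 h2
  rw [abs_le]
  constructor <;> linarith

lemma tendsto_slope_of_eventually_le {T : ℝ → ℝ} {a : ℝ}
    (h1 : ∀ k, a < k → ∀ᶠ ε in 𝓝[>] (0 : ℝ), T ε ≤ 1 + k * ε)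
    (h2 : ∀ k, k < a → ∀ᶠ ε in 𝓝[>] (0 : ℝ), 1 + k * ε ≤ T ε) :
    Tendsto (fun ε => (T ε - 1) / ε) (𝓝[>] 0) (𝓝 a) := by
  rw [tendsto_order]
  constructor
  · intro k hk
    obtain ⟨k', hk', hk''⟩ := exists_between hk
    filter_upwards [h2 k' hk'', self_mem_nhdsWithin] with ε h (hε : 0 < ε)
    rw [lt_div_iff₀ hε]
    nlinarith
  · intro k hk
    obtain ⟨k', hk', hk''⟩ := exists_between hk
    filter_upwards [h1 k' hk', self_mem_nhdsWithin] with ε h (hε : 0 < ε)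
    rw [div_lt_iff₀ hε]
    nlinarith

/-- The influence of the contaminating point on the scaled median of the absolute deviations. -/
lemma tendsto_medianDeviation {c : ℝ} (hm : ∀ᶠ ε in 𝓝[>] (0 : ℝ), |m ε| ≤ K * ε)
    (hw : Tendsto (fun ε => |w ε|) (𝓝[>] 0) (𝓝 c)) (hc : c ≠ normalQuartile) :
    Tendsto (fun ε =>
      (1 / normalQuartile * med ((contaminated stdNormal (w ε) ε).map fun x => |x - m ε|) - 1) / ε)
      (𝓝[>] 0) (𝓝 (if c < normalQuartile then -madInfluence else madInfluence)) := by
  have hid : Tendsto (fun ε : ℝ => ε) (𝓝[>] 0) (𝓝 0) := tendsto_id.mono_left nhdsWithin_le_nhds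
  have hm0 : Tendsto m (𝓝[>] 0) (𝓝 0) :=
    squeeze_zero_norm' hm (by simpa using hid.const_mul K)
  have hwin : ∀ k, Tendsto (fun ε => normalQuartile * (1 + k * ε)) (𝓝[>] 0)
      (𝓝 normalQuartile) := fun k => by
    simpa using ((hid.const_mul k).const_add 1).const_mul normalQuartile
  split_ifs with hlt
  -- A point inside the quartiles eventually lies in the window for every slope k. The upper and
  -- lower thresholds then coincide at -`madInfluence`; a point outside gives +`madInfluence`.
  · have hin : ∀ k, ∀ᶠ ε in 𝓝[>] (0 : ℝ), (Measure.dirac (w ε)).real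
        (Set.Icc (m ε - normalQuartile * (1 + k * ε)) (m ε + normalQuartile * (1 + k * ε)))
          = 1 := fun k => by
      have h0 : Tendsto (fun ε => normalQuartile * (1 + k * ε) - |m ε| - |w ε|) (𝓝[>] 0)
          (𝓝 (normalQuartile - |0| - c)) := ((hwin k).sub hm0.abs).sub hw
      rw [abs_zero, sub_zero] at h0
      filter_upwards [h0.eventually (lt_mem_nhds (sub_pos.2 hlt))] with ε hε
      rw [measureReal_def, Measure.dirac_apply' _ measurableSet_Icc, Set.indicator_of_mem]
      · simp
      · have h1 := abs_le.1 (le_refl |m ε|)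
        have h2 := abs_le.1 (le_refl |w ε|)
        constructor <;> linarith
    refine tendsto_slope_of_eventually_le (fun k hk => ?_) fun k hk => ?_
    · exact eventually_medianDeviation_le hm ((hin k).mono fun ε h => h.ge) (by linarith)
    · exact eventually_le_medianDeviation hm ((hin k).mono fun ε h => h.le) (by linarith)
  · have hgt : normalQuartile < c := lt_of_le_of_ne (not_lt.1 hlt) (Ne.symm hc)
    have hout : ∀ k, ∀ᶠ ε in 𝓝[>] (0 : ℝ), (Measure.dirac (w ε)).real
        (Set.Icc (m ε - normalQuartile * (1 + k * ε)) (m ε + normalQuartile * (1 + k * ε)))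
          = 0 := fun k => by
      have h0 : Tendsto (fun ε => |w ε| - |m ε| - normalQuartile * (1 + k * ε)) (𝓝[>] 0)
          (𝓝 (c - |0| - normalQuartile)) := (hw.sub hm0.abs).sub (hwin k)
      rw [abs_zero, sub_zero] at h0
      filter_upwards [h0.eventually (lt_mem_nhds (sub_pos.2 hgt))] with ε hε
      rw [measureReal_def, Measure.dirac_apply' _ measurableSet_Icc, Set.indicator_of_notMem]
      · simp
      · rintro ⟨h1, h2⟩
        have h3 := abs_sub_abs_le_abs_sub (w ε) (m ε)
        have h4 : |w ε - m ε| ≤ normalQuartile * (1 + k * ε) := abs_le.2 ⟨by linarith, by linarith⟩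
        linarith
    refine tendsto_slope_of_eventually_le (fun k hk => ?_) fun k hk => ?_
    · exact eventually_medianDeviation_le hm ((hout k).mono fun ε h => h.ge) (by linarith)
    · exact eventually_le_medianDeviation hm ((hout k).mono fun ε h => h.le) (by linarith)

end Path

/-- The MAD, with estimated or known center, is a scaled median of absolute deviations from a center
that tends to `0` at the order of the contamination. -/
lemma exists_center_of_mad {S : Measure ℝ → ℝ} (hS : S = mad ∨ S = madKnownCenter) (w : ℝ → ℝ) :
    ∃ (m : ℝ → ℝ) (K : ℝ), (∀ᶠ ε in 𝓝[>] (0 : ℝ), |m ε| ≤ K * ε) ∧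
      ∀ ε, S (contaminated stdNormal (w ε) ε) =
        1 / normalQuartile * med ((contaminated stdNormal (w ε) ε).map fun x => |x - m ε|) := by
  rcases hS with rfl | rfl
  · obtain ⟨K, hK⟩ := exists_abs_med_contaminated_le w
    exact ⟨_, K, hK, fun ε => rfl⟩
  · exact ⟨fun _ => 0, 0, by simp, fun ε => by simp [madKnownCenter]⟩

lemma map_mul_of_mad {S : Measure ℝ → ℝ} (hS : S = mad ∨ S = madKnownCenter) (P : Measure ℝ)
    {c : ℝ} (hc : 0 < c) : S (P.map fun x => c * x) = c * S P := by
  rcases hS with rfl | rfl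
  · exact mad_map_mul P hc
  · exact madKnownCenter_map_mul P hc

lemma med_map_abs_stdNormal : med (stdNormal.map fun x => |x|) = normalQuartile := by
  have : IsProbabilityMeasure (stdNormal.map fun x => |x|) :=
    Measure.isProbabilityMeasure_map (by fun_prop)
  have hq := normalQuartile_pos
  have hcdf : ∀ t, 0 ≤ t → (stdNormal.map fun x => |x|).real (Set.Iic t) =
      2 * normalCDF t - 1 := fun t ht => by
    rw [map_measureReal_apply (by fun_prop) measurableSet_Iic,
      show (fun x : ℝ => |x|) ⁻¹' Set.Iic t = Set.Icc (-t) t by ext; simp [abs_le],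
      normalCDF_sub (by linarith), normalCDF_neg]
    ring
  refine med_eq_of_forall _ (fun s hs => ?_) fun s hs => ?_
  · have := strictMono_normalCDF hs
    rw [normalCDF_quartile] at this
    rw [hcdf s (by linarith)]
    linarith
  · have h2 : (stdNormal.map fun x => |x|).real (Set.Iic s) ≤
        (stdNormal.map fun x => |x|).real (Set.Iic (max s 0)) :=
      measureReal_mono (Set.Iic_subset_Iic.2 (le_max_left _ _))
    have := strictMono_normalCDF (max_lt hs hq)
    rw [normalCDF_quartile] at this
    rw [hcdf _ (le_max_right _ _)] at h2
    linarith

lemma med_stdNormal : med stdNormal = 0 := by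
  refine med_eq_of_forall _ (fun s hs => ?_) fun s hs => ?_
  · rw [← normalCDF_zero]
    exact strictMono_normalCDF hs
  · rw [← normalCDF_zero]
    exact strictMono_normalCDF hs

lemma fisherConsistent_of_mad {S : Measure ℝ → ℝ} (hS : S = mad ∨ S = madKnownCenter) :
    FisherConsistent S := by
  intro σ hσ
  rw [← stdNormal_map_mul, map_mul_of_mad hS _ hσ]
  have hq := normalQuartile_pos
  have h0 : madKnownCenter stdNormal = 1 := by
    rw [madKnownCenter, med_map_abs_stdNormal]
    field_simp
  rcases hS with rfl | rfl
  · rw [mad, med_stdNormal]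
    simp only [sub_zero]
    change σ * madKnownCenter stdNormal = σ
    rw [h0, mul_one]
  · rw [h0, mul_one]

/-! ### The MAD with known center is an M-functional of scale -/

lemma real_Iio_add_Ioi_le_one (P : Measure ℝ) [IsProbabilityMeasure P] (t : ℝ) :
    P.real (Set.Iio t) + P.real (Set.Ioi t) ≤ 1 := by
  have hd : Disjoint (Set.Iio t) (Set.Ioi t) :=
    Set.disjoint_left.2 fun x (h1 : x < t) (h2 : t < x) => lt_asymm h1 h2
  rw [← measureReal_union hd measurableSet_Ioi]
  exact measureReal_le_one

/-- If some point divides the mass equally, then so does the midpoint of the median interval. -/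
lemma med_balanced (P : Measure ℝ) [IsProbabilityMeasure P] (h0 : P.real (Set.Iio 0) = 0) {t : ℝ}
    (ht : 0 < t) (h : P.real (Set.Iio t) = P.real (Set.Ioi t)) :
    0 < med P ∧ P.real (Set.Iio (med P)) = P.real (Set.Ioi (med P)) := by
  have hle := real_Iio_add_Ioi_le_one P t
  have hA : t ∈ {t : ℝ | 1 / 2 ≤ P.real (Set.Iic t)} := by
    have := compl_Iic_real P t
    simp only [Set.mem_ofPred_eq]
    linarith
  have hB : t ∈ {t : ℝ | 1 / 2 ≤ P.real (Set.Ici t)} := by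
    have : P.real (Set.Ici t) = 1 - P.real (Set.Iio t) := by
      rw [← Set.compl_Iio, probReal_compl_eq_one_sub measurableSet_Iio]
    simp only [Set.mem_ofPred_eq]
    linarith
  have hL := csInf_le (lowerMedians_bddBelow P) hA
  have hU := le_csSup (upperMedians_bddAbove P) hB
  have hL0 : 0 ≤ sInf {t : ℝ | 1 / 2 ≤ P.real (Set.Iic t)} := by
    refine le_csInf (lowerMedians_nonempty P) fun a ha => ?_
    simp only [Set.mem_ofPred_eq] at ha
    by_contra hlt
    have : P.real (Set.Iic a) ≤ P.real (Set.Iio 0) :=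
      measureReal_mono (Set.Iic_subset_Iio.2 (not_le.1 hlt))
    linarith
  refine ⟨by rw [med]; linarith, ?_⟩
  -- A degenerate median interval is just t; otherwise the midpoint lies strictly inside and has
  -- half of the mass on either side.
  rcases (hL.trans hU).eq_or_lt with heq | hlt
  · have : med P = t := by rw [med]; linarith
    rw [this, h]
  · have h1 : sInf {t : ℝ | 1 / 2 ≤ P.real (Set.Iic t)} < med P := by rw [med]; linarith
    have h2 : med P < sSup {t : ℝ | 1 / 2 ≤ P.real (Set.Ici t)} := by rw [med]; linarith
    obtain ⟨a, ha, ha'⟩ := exists_lt_of_csInf_lt (lowerMedians_nonempty P) h1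
    obtain ⟨b, hb, hb'⟩ := exists_lt_of_lt_csSup (upperMedians_nonempty P) h2
    simp only [Set.mem_ofPred_eq] at ha hb
    have h3 : P.real (Set.Iic a) ≤ P.real (Set.Iio (med P)) :=
      measureReal_mono (Set.Iic_subset_Iio.2 ha')
    have h4 : P.real (Set.Ici b) ≤ P.real (Set.Ioi (med P)) :=
      measureReal_mono (Set.Ici_subset_Ioi.2 hb')
    have := real_Iio_add_Ioi_le_one P (med P)
    linarith

lemma madScore_eq (x : ℝ) : madScore x =
    {x | normalQuartile < |x|}.indicator (fun _ => (1 : ℝ)) x -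
      {x | |x| < normalQuartile}.indicator (fun _ => (1 : ℝ)) x := by
  unfold madScore
  rcases lt_trichotomy |x| normalQuartile with h | h | h
  · rw [Real.sign_of_neg (by linarith), Set.indicator_of_notMem, Set.indicator_of_mem] <;>
      simp [h, h.le]
  · rw [h, sub_self, Real.sign_zero, Set.indicator_of_notMem, Set.indicator_of_notMem] <;> simp [h]
  · rw [Real.sign_of_pos (by linarith), Set.indicator_of_mem, Set.indicator_of_notMem] <;>
      simp [h, h.le]

lemma measurable_madScore : Measurable madScore := by
  have : madScore = fun x => {x | normalQuartile < |x|}.indicator (fun _ => (1 : ℝ)) x -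
      {x | |x| < normalQuartile}.indicator (fun _ => (1 : ℝ)) x := funext madScore_eq
  rw [this]
  exact (measurable_const.indicator (measurableSet_lt measurable_const (by fun_prop))).sub
    (measurable_const.indicator (measurableSet_lt (by fun_prop) measurable_const))

lemma abs_madScore_le (x : ℝ) : |madScore x| ≤ 1 := by
  unfold madScore
  rcases Real.sign_apply_eq (|x| - normalQuartile) with h | h | h <;> rw [h] <;> simp

/-- The score vanishes at ±q, so atoms at the threshold do not count. With such atoms the equation
can be unsolvable, which is why the median is compared with a root already known to exist. -/
lemma isScaleRoot_madScore_iff (P : Measure ℝ) [IsProbabilityMeasure P] {s : ℝ} (hs : 0 < s) :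
    IsScaleRoot madScore P s ↔
      (P.map fun x => |x|).real (Set.Iio (normalQuartile * s)) =
        (P.map fun x => |x|).real (Set.Ioi (normalQuartile * s)) := by
  have hm1 : MeasurableSet {x : ℝ | normalQuartile * s < |x|} :=
    measurableSet_lt measurable_const (by fun_prop)
  have hm2 : MeasurableSet {x : ℝ | |x| < normalQuartile * s} :=
    measurableSet_lt (by fun_prop) measurable_const
  have h1 : (P.map fun x => |x|).real (Set.Iio (normalQuartile * s)) =
      P.real {x : ℝ | |x| < normalQuartile * s} := by
    rw [map_measureReal_apply (by fun_prop) measurableSet_Iio]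
    rfl
  have h2 : (P.map fun x => |x|).real (Set.Ioi (normalQuartile * s)) =
      P.real {x : ℝ | normalQuartile * s < |x|} := by
    rw [map_measureReal_apply (by fun_prop) measurableSet_Ioi]
    rfl
  have e : (fun x => madScore (x / s)) = fun x =>
      {x : ℝ | normalQuartile * s < |x|}.indicator (fun _ => (1 : ℝ)) x -
        {x : ℝ | |x| < normalQuartile * s}.indicator (fun _ => (1 : ℝ)) x := by
    ext x
    rw [madScore_eq]
    simp only [Set.indicator_apply, Set.mem_ofPred_eq, abs_div, abs_of_pos hs, lt_div_iff₀ hs,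
      div_lt_iff₀ hs]
  have hi1 : Integrable ({x : ℝ | normalQuartile * s < |x|}.indicator (fun _ => (1 : ℝ))) P :=
    (integrable_const _).indicator hm1
  have hi2 : Integrable ({x : ℝ | |x| < normalQuartile * s}.indicator (fun _ => (1 : ℝ))) P :=
    (integrable_const _).indicator hm2
  rw [IsScaleRoot, e, integral_sub hi1 hi2, integral_indicator_const _ hm1,
    integral_indicator_const _ hm2, h1, h2]
  simp only [smul_eq_mul, mul_one]
  constructor
  · rintro ⟨-, -, h⟩
    linarith
  · intro h
    exact ⟨hs, hi1.sub hi2, by linarith⟩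

lemma isMScale_madScore : IsMScale madScore madKnownCenter := by
  rintro P hP ⟨s, hs⟩
  have hq := normalQuartile_pos
  have hs0 := hs.1
  have : IsProbabilityMeasure (P.map fun x => |x|) :=
    Measure.isProbabilityMeasure_map (by fun_prop)
  rw [isScaleRoot_madScore_iff P hs0] at hs
  have h0 : (P.map fun x => |x|).real (Set.Iio 0) = 0 := by
    rw [map_measureReal_apply (by fun_prop) measurableSet_Iio]
    have : (fun x : ℝ => |x|) ⁻¹' Set.Iio 0 = ∅ := by
      ext x
      simp
    simp [this]
  obtain ⟨h1, h2⟩ := med_balanced _ h0 (mul_pos hq hs0) hs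
  rw [isScaleRoot_madScore_iff P (by rw [madKnownCenter]; positivity)]
  have : normalQuartile * madKnownCenter P = med (P.map fun x => |x|) := by
    rw [madKnownCenter]
    field_simp
  rw [this, h2]

lemma continuousAt_madScore {x : ℝ} (hx : |x| ≠ normalQuartile) : ContinuousAt madScore x := by
  have hcont : Tendsto (fun y : ℝ => |y|) (𝓝 x) (𝓝 |x|) := continuous_abs.tendsto x
  rcases lt_or_gt_of_ne hx with h | h
  · have : madScore =ᶠ[𝓝 x] fun _ => -1 := by
      filter_upwards [hcont.eventually (gt_mem_nhds h)] with y hy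
      rw [madScore, Real.sign_of_neg (by linarith)]
    exact continuousAt_const.congr this.symm
  · have : madScore =ᶠ[𝓝 x] fun _ => 1 := by
      filter_upwards [hcont.eventually (lt_mem_nhds h)] with y hy
      rw [madScore, Real.sign_of_pos (by linarith)]
    exact continuousAt_const.congr this.symm

lemma memLp_of_abs_le {χ : ℝ → ℝ} (hm : Measurable χ) {b : ℝ} (hb : ∀ x, |χ x| ≤ b) :
    MemLp χ 2 stdNormal :=
  MemLp.of_bound hm.aestronglyMeasurable b (ae_of_all _ hb)

lemma wellBehavedScore_madScore : WellBehavedScore madScore where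
  even x := by simp [madScore]
  finite_discontinuities := by
    refine (Set.toFinite {normalQuartile, -normalQuartile}).subset fun x hx => ?_
    by_contra hne
    refine hx (continuousAt_madScore fun h => hne ?_)
    rcases abs_choice x with h' | h' <;> rw [h'] at h
    · exact .inl h
    · exact .inr (by simp [← h])
  locally_bounded _ := ⟨1, fun x _ => abs_madScore_le x⟩
  sign_change := ⟨normalQuartile, normalQuartile_pos, fun x h0 h => by
      rw [madScore, abs_of_pos h0, Real.sign_of_neg (by linarith)]
      norm_num, fun x h => by
      rw [madScore, abs_of_pos (normalQuartile_pos.trans h), Real.sign_of_pos (by linarith)]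
      norm_num⟩
  square_integrable := memLp_of_abs_le measurable_madScore abs_madScore_le
  not_null h := by
    obtain ⟨x, hx, h1, h2⟩ := (h.and ((ae_stdNormal_ne normalQuartile).and
      (ae_stdNormal_ne (-normalQuartile)))).exists
    rw [madScore, Pi.zero_apply, Real.sign_eq_zero_iff, sub_eq_zero] at hx
    rcases abs_choice x with h' | h' <;> rw [h'] at hx
    · exact h1 hx
    · exact h2 (by linarith)

lemma integral_madScore : ∫ z, madScore z ∂stdNormal = 0 := by
  have : IsProbabilityMeasure (stdNormal.map fun x => |x|) :=
    Measure.isProbabilityMeasure_map (by fun_prop)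
  have hq := normalQuartile_pos
  have hset : ∀ t, (fun x : ℝ => |x|) ⁻¹' Set.Iic t = Set.Icc (-t) t := fun t => by
    ext; simp [abs_le]
  have hset' : ∀ t, (fun x : ℝ => |x|) ⁻¹' Set.Iio t = Set.Ioo (-t) t := fun t => by
    ext; simp [abs_lt]
  have h : IsScaleRoot madScore stdNormal 1 := by
    rw [isScaleRoot_madScore_iff _ one_pos, mul_one, compl_Iic_real,
      map_measureReal_apply (by fun_prop) measurableSet_Iio,
      map_measureReal_apply (by fun_prop) measurableSet_Iic, hset, hset',
      measureReal_congr (Ioo_ae_eq_Icc (μ := stdNormal)), normalCDF_sub (by linarith),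
      normalCDF_neg_quartile, normalCDF_quartile]
    norm_num
  simpa using h.2.2

lemma isConsistentMScale_madScore : IsConsistentMScale madScore madKnownCenter where
  well_behaved := wellBehavedScore_madScore
  isMScale := isMScale_madScore
  defined_at_model := ⟨1, one_pos, by simpa using wellBehavedScore_madScore.integrable,
    by simpa using integral_madScore⟩
  consistent := fisherConsistent_of_mad (.inr rfl)

/-- The influence of the MAD is that of the M-functional of scale with score `madScore`. -/
lemma madInfluence_eq : madInfluence = 1 / scaleSensitivity madScore := by
  have hq := normalQuartile_pos
  have hwb := wellBehavedScore_madScore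
  -- Any point beyond the quartile would do: the influence there is computed both from the median
  -- and from the M-equation, and limits are unique.
  have hc : ContinuousAt madScore (normalQuartile + 1) :=
    continuousAt_madScore (by rw [abs_of_pos (by linarith)]; linarith)
  have hw : Tendsto (fun _ : ℝ => |normalQuartile + 1|) (𝓝[>] 0) (𝓝 (normalQuartile + 1)) := by
    rw [abs_of_pos (by linarith)]
    exact tendsto_const_nhds
  obtain ⟨m, K, hm, hS⟩ := exists_center_of_mad (.inr rfl) fun _ => normalQuartile + 1
  have h1 := tendsto_medianDeviation hm hw (by linarith)
  rw [if_neg (by linarith)] at h1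
  have h2 := hwb.tendsto_root integral_madScore hc hw
    (fun δ h h' => hwb.eventually_roots_near integral_madScore (by linarith) hw h h')
    (t := fun ε => madKnownCenter (contaminated stdNormal (normalQuartile + 1) ε)) (by
      filter_upwards [hwb.eventually_exists_root integral_madScore hc hw, eventually_mem_Ioo]
        with ε h ⟨h3, h4⟩
      exact isMScale_madScore _ (isProbabilityMeasure_contaminated _ _ h3.le h4.le) h)
  rw [madScore, abs_of_pos (by linarith), Real.sign_of_pos (by linarith)] at h2
  simp only [hS] at h2
  exact tendsto_nhds_unique h1 h2

/-! ### Consistent M-functionals of scale -/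

lemma isScaleRoot_map_mul (χ : ℝ → ℝ) (P : Measure ℝ) {c : ℝ} (hc : 0 < c) (s : ℝ) :
    IsScaleRoot χ (P.map fun x => c * x) s ↔ IsScaleRoot χ P (s / c) := by
  have he : MeasurableEmbedding fun x : ℝ => c * x :=
    (Homeomorph.mulLeft₀ c hc.ne').measurableEmbedding
  have e : ∀ x, c * x / s = x / (s / c) := fun x => by rw [div_div_eq_mul_div, mul_comm]
  rw [IsScaleRoot, IsScaleRoot, he.integrable_map_iff, he.integral_map]
  simp only [Function.comp_def, e, div_pos_iff_of_pos_right hc]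

lemma WellBehavedScore.eq_one_of_isScaleRoot {χ : ℝ → ℝ} (h : WellBehavedScore χ)
    (h0 : ∫ z, χ z ∂stdNormal = 0) {s : ℝ} (hs : IsScaleRoot χ stdNormal s) : s = 1 := by
  obtain ⟨hs0, hi, heq⟩ := hs
  change scaleMean χ s = 0 at heq
  rcases lt_trichotomy s 1 with hlt | rfl | hgt
  · exact absurd heq (h.scaleMean_pos h0 hs0 hlt hi).ne'
  · rfl
  · exact absurd heq (h.scaleMean_neg h0 hgt hi).ne

lemma IsConsistentMScale.integral_eq_zero {χ : ℝ → ℝ} {S : Measure ℝ → ℝ}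
    (h : IsConsistentMScale χ S) : ∫ z, χ z ∂stdNormal = 0 := by
  have h1 := h.isMScale stdNormal inferInstance h.defined_at_model
  have h2 := h.consistent 1 one_pos
  rw [gaussianReal_toNNReal_one] at h2
  rw [h2] at h1
  simpa using h1.2.2

-- Any selection of roots works: at a normal distribution the M-equation has a single root, so
-- consistency is automatic.
open Classical in
lemma WellBehavedScore.exists_isConsistentMScale {χ : ℝ → ℝ} (h : WellBehavedScore χ)
    (h0 : ∫ z, χ z ∂stdNormal = 0) : ∃ S, IsConsistentMScale χ S := by
  have h1 : IsScaleRoot χ stdNormal 1 :=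
    ⟨one_pos, by simpa using h.integrable, by simpa using h0⟩
  set S : Measure ℝ → ℝ := fun P => if hP : ∃ s, IsScaleRoot χ P s then hP.choose else 1 with hS
  have hroot : ∀ P, (∃ s, IsScaleRoot χ P s) → IsScaleRoot χ P (S P) := fun P hP => by
    simp only [hS, dif_pos hP]
    exact hP.choose_spec
  refine ⟨S, h, fun P _ => hroot P, ⟨1, h1⟩, fun σ hσ => ?_⟩
  rw [← stdNormal_map_mul]
  have := hroot (stdNormal.map fun x => σ * x)
    ⟨σ, (isScaleRoot_map_mul χ _ hσ _).2 (by rwa [div_self hσ.ne'])⟩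
  rw [isScaleRoot_map_mul χ _ hσ] at this
  have := h.eq_one_of_isScaleRoot h0 this
  rwa [div_eq_one_iff_eq hσ.ne'] at this

/-! ### Huber's scores -/

section Huber

variable {a b : ℝ}

lemma abs_huberScore_le (hb : 0 < b) (x : ℝ) : |huberScore a b x| ≤ b := by
  rw [huberScore, abs_le]
  exact ⟨le_max_left _ _, max_le (by linarith) (min_le_left _ _)⟩

lemma continuous_huberScore (a b : ℝ) : Continuous (huberScore a b) := by
  unfold huberScore
  fun_prop

lemma huberScore_neg (x : ℝ) : huberScore a b (-x) = huberScore a b x := by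
  simp [huberScore]

lemma monotoneOn_huberScore : MonotoneOn (huberScore a b) (Set.Ici 0) := by
  intro x (hx : 0 ≤ x) y _ hxy
  unfold huberScore
  have : x ^ 2 ≤ y ^ 2 := pow_le_pow_left₀ hx hxy 2
  gcongr

lemma memLp_huberScore (hb : 0 < b) : MemLp (huberScore a b) 2 stdNormal :=
  memLp_of_abs_le (continuous_huberScore a b).measurable (abs_huberScore_le hb)

lemma integrable_huberScore (hb : 0 < b) : Integrable (huberScore a b) stdNormal :=
  (memLp_huberScore hb).integrable (by norm_num)

lemma huberScore_eq_bound (hb : 0 < b) {x : ℝ} (hx : 1 + a + b ≤ x ^ 2) : huberScore a b x = b := by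
  rw [huberScore, min_eq_left (by linarith), max_eq_right (by linarith)]

lemma exists_huberScore_eq_bound (a : ℝ) (hb : 0 < b) : ∃ x, 0 < x ∧ huberScore a b x = b := by
  refine ⟨1 + |1 + a + b|, by positivity, huberScore_eq_bound hb ?_⟩
  nlinarith [le_abs_self (1 + a + b), abs_nonneg (1 + a + b)]

lemma huberScore_antitone {a' : ℝ} (h : a ≤ a') (x : ℝ) :
    huberScore a' b x ≤ huberScore a b x := by
  unfold huberScore
  gcongr

lemma abs_huberScore_sub_le (a b a' b' x : ℝ) :
    |huberScore a b x - huberScore a' b' x| ≤ |a - a'| + |b - b'| := by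
  unfold huberScore
  refine (abs_max_sub_max_le_max _ _ _ _).trans (max_le ?_ ?_)
  · rw [show -b - -b' = -(b - b') by ring, abs_neg]
    linarith [abs_nonneg (a - a')]
  · refine (abs_min_sub_min_le_max _ _ _ _).trans (max_le ?_ ?_)
    · linarith [abs_nonneg (a - a')]
    · rw [show x ^ 2 - 1 - a - (x ^ 2 - 1 - a') = -(a - a') by ring, abs_neg]
      linarith [abs_nonneg (b - b')]

instance : stdNormal.IsOpenPosMeasure :=
  (gaussianReal_absolutelyContinuous' 0 one_ne_zero).isOpenPosMeasure

/-- Otherwise the score would be non-negative with mean zero, hence identically zero by continuity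
and full support, yet it attains b. The result provides the sign change √(1 + a). -/
lemma one_add_pos_of_integral_huberScore (hb : 0 < b)
    (h : ∫ z, huberScore a b z ∂stdNormal = 0) : 0 < 1 + a := by
  by_contra hle
  have hnn : ∀ z, 0 ≤ huberScore a b z := fun z => by
    rw [huberScore]
    exact le_max_of_le_right (le_min hb.le (by nlinarith [sq_nonneg z]))
  have h1 := (integral_eq_zero_iff_of_nonneg hnn (integrable_huberScore hb)).1 h
  have h2 := ((continuous_huberScore a b).ae_eq_iff_eq stdNormal continuous_zero).1 h1
  obtain ⟨x, -, hx⟩ := exists_huberScore_eq_bound a hb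
  rw [h2, Pi.zero_apply] at hx
  exact hb.ne hx

lemma wellBehavedScore_huberScore (hb : 0 < b) (h : ∫ z, huberScore a b z ∂stdNormal = 0) :
    WellBehavedScore (huberScore a b) where
  even _ := huberScore_neg _
  finite_discontinuities := by
    simp [(continuous_huberScore a b).continuousAt]
  locally_bounded _ := ⟨b, fun x _ => abs_huberScore_le hb x⟩
  sign_change := by
    have ha := one_add_pos_of_integral_huberScore hb h
    refine ⟨Real.sqrt (1 + a), Real.sqrt_pos.2 ha, fun x h0 hx => ?_, fun x hx => ?_⟩
    · have : x ^ 2 < 1 + a := (Real.lt_sqrt h0.le).1 hx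
      rw [huberScore]
      exact max_le (by linarith) ((min_le_right _ _).trans (by linarith))
    · have : 1 + a < x ^ 2 := by
        have h1 := Real.sqrt_nonneg (1 + a)
        exact (Real.sqrt_lt' (by linarith)).1 hx
      rw [huberScore]
      exact le_max_of_le_right (le_min hb.le (by linarith))
  square_integrable := memLp_huberScore hb
  not_null h1 := by
    have h2 := ((continuous_huberScore a b).ae_eq_iff_eq stdNormal continuous_zero).1 h1
    obtain ⟨x, -, hx⟩ := exists_huberScore_eq_bound a hb
    rw [h2, Pi.zero_apply] at hx
    exact hb.ne hx

lemma exists_isConsistentMScale_huberScore_iff (hb : 0 < b) :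
    (∃ S, IsConsistentMScale (huberScore a b) S) ↔ ∫ z, huberScore a b z ∂stdNormal = 0 :=
  ⟨fun ⟨_, hS⟩ => hS.integral_eq_zero, fun h =>
    (wellBehavedScore_huberScore hb h).exists_isConsistentMScale h⟩

lemma integral_huberScore_anti (hb : 0 < b) {a' : ℝ} (h : a ≤ a') :
    ∫ z, huberScore a' b z ∂stdNormal ≤ ∫ z, huberScore a b z ∂stdNormal :=
  integral_mono (integrable_huberScore hb) (integrable_huberScore hb) (huberScore_antitone h)

/-- Scores decrease with the shift, so equal means force equal continuous scores; at √(1 + a) they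
nevertheless differ. -/
lemma not_both_integral_huberScore_eq_zero (hb : 0 < b) {a' : ℝ} (h : a < a')
    (h1 : ∫ z, huberScore a b z ∂stdNormal = 0) (h2 : ∫ z, huberScore a' b z ∂stdNormal = 0) :
    False := by
  have ha := one_add_pos_of_integral_huberScore hb h1
  have h3 := (integral_eq_iff_of_ae_le (integrable_huberScore hb) (integrable_huberScore hb)
    (ae_of_all _ (huberScore_antitone h.le))).1 (h2.trans h1.symm)
  have h4 := ((continuous_huberScore a' b).ae_eq_iff_eq stdNormal (continuous_huberScore a b)).1 h3
  have h5 := congrFun h4 (Real.sqrt (1 + a))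
  rw [huberScore, huberScore, Real.sq_sqrt ha.le, show 1 + a - 1 - a = 0 by ring,
    min_eq_right hb.le, max_eq_right (show -b ≤ 0 by linarith)] at h5
  have h6 : max (-b) (min b (1 + a - 1 - a')) < 0 :=
    max_lt (by linarith) ((min_le_right _ _).trans_lt (by linarith))
  exact h6.ne h5

lemma integral_huberScore_unique (hb : 0 < b) {a' : ℝ}
    (h1 : ∫ z, huberScore a b z ∂stdNormal = 0) (h2 : ∫ z, huberScore a' b z ∂stdNormal = 0) :
    a = a' := by
  rcases lt_trichotomy a a' with h | h | h
  · exact (not_both_integral_huberScore_eq_zero hb h h1 h2).elim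
  · exact h
  · exact (not_both_integral_huberScore_eq_zero hb h h2 h1).elim

lemma abs_integral_huberScore_sub_le {a' b' : ℝ} (hb : 0 < b) (hb' : 0 < b') :
    |∫ z, huberScore a b z ∂stdNormal - ∫ z, huberScore a' b' z ∂stdNormal|
      ≤ |a - a'| + |b - b'| := by
  rw [← integral_sub (integrable_huberScore hb) (integrable_huberScore hb')]
  have := norm_integral_le_of_norm_le_const (μ := stdNormal)
    (f := fun z => huberScore a b z - huberScore a' b' z)
    (ae_of_all _ (abs_huberScore_sub_le a b a' b'))
  simpa using this

lemma exists_integral_huberScore_eq_zero (hb : 0 < b) :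
    ∃ a, ∫ z, huberScore a b z ∂stdNormal = 0 := by
  have hcont : Continuous fun a => ∫ z, huberScore a b z ∂stdNormal := by
    refine (LipschitzWith.of_dist_le_mul (K := 1) fun a a' => ?_).continuous
    have := abs_integral_huberScore_sub_le (a := a) (a' := a') hb hb
    simpa [Real.dist_eq] using this
  have h1 : 0 ≤ ∫ z, huberScore (-1) b z ∂stdNormal := integral_nonneg fun z => by
    rw [Pi.zero_apply, huberScore]
    exact le_max_of_le_right (le_min hb.le (by nlinarith [sq_nonneg z]))
  -- The shift 1 + b is chosen so that the score lies below b(z² - 1), which has mean zero.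
  have h2 : ∫ z, huberScore (1 + b) b z ∂stdNormal ≤ 0 := by
    have hi : Integrable (fun z : ℝ => b * (z ^ 2 - 1)) stdNormal :=
      ((memLp_sq_sub 1).integrable (by norm_num)).const_mul b
    have h3 := integral_mono (integrable_huberScore (a := 1 + b) hb) hi fun z => by
      change huberScore (1 + b) b z ≤ b * (z ^ 2 - 1)
      have hz := sq_nonneg z
      rw [huberScore]
      refine max_le (by nlinarith) ?_
      rcases le_total (z ^ 2) 2 with h | h
      · refine (min_le_right _ _).trans ?_
        nlinarith
      · refine (min_le_left _ _).trans ?_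
        nlinarith
    rw [integral_const_mul, integral_sub ((memLp_sq_sub 0).integrable (by norm_num) |>.congr
      (ae_of_all _ fun z => by simp)) (integrable_const _), integral_sq_stdNormal] at h3
    simpa using h3
  obtain ⟨a, -, ha⟩ := intermediate_value_Icc' (show (-1 : ℝ) ≤ 1 + b by linarith)
    hcont.continuousOn ⟨h2, h1⟩
  exact ⟨a, ha⟩

lemma existsUnique_huber (hb : 0 < b) : ∃! a : ℝ, ∃ S, IsConsistentMScale (huberScore a b) S := by
  simp only [exists_isConsistentMScale_huberScore_iff hb]
  obtain ⟨a, ha⟩ := exists_integral_huberScore_eq_zero hb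
  exact ⟨a, ha, fun a' ha' => integral_huberScore_unique hb ha' ha⟩

end Huber

/-! ### Extremal properties -/

/-- The free constant acts as a Lagrange multiplier for the centering: q² is used for the MAD and 1
+ a for Huber's scores. -/
lemma integral_mul_sq_sub {χ : ℝ → ℝ} (h : MemLp χ 2 stdNormal) (h0 : ∫ z, χ z ∂stdNormal = 0)
    (c : ℝ) : ∫ z, χ z * (z ^ 2 - c) ∂stdNormal = scaleSensitivity χ := by
  have : ∀ z, χ z * (z ^ 2 - c) = χ z * (z ^ 2 - 1) + (1 - c) * χ z := fun z => by ring
  simp_rw [this]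
  rw [integral_add (integrable_mul_sq_sub h _)
    ((h.integrable (by norm_num)).const_mul _), integral_const_mul, h0, mul_zero,
    add_zero, scaleSensitivity]

lemma madScore_mul (z : ℝ) :
    madScore z * (z ^ 2 - normalQuartile ^ 2) = |z ^ 2 - normalQuartile ^ 2| := by
  have hq := normalQuartile_pos
  have hz := abs_nonneg z
  rw [← sq_abs z, madScore]
  generalize |z| = y at *
  rcases lt_trichotomy y normalQuartile with h | h | h
  · rw [Real.sign_of_neg (by linarith), abs_of_neg (by nlinarith)]
    ring
  · simp [h]
  · rw [Real.sign_of_pos (by linarith), abs_of_pos (by nlinarith)]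
    ring

/-- Among the scores that are bounded by `M`, that of the MAD has the largest sensitivity. -/
lemma scaleSensitivity_le_of_bounded {χ : ℝ → ℝ} (h : MemLp χ 2 stdNormal)
    (h0 : ∫ z, χ z ∂stdNormal = 0) {M : ℝ} (hM : ∀ᵐ z ∂stdNormal, |χ z| ≤ M) :
    scaleSensitivity χ ≤ M * scaleSensitivity madScore := by
  have hmad := wellBehavedScore_madScore.square_integrable
  rw [← integral_mul_sq_sub h h0 (normalQuartile ^ 2),
    ← integral_mul_sq_sub hmad integral_madScore (normalQuartile ^ 2), ← integral_const_mul]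
  refine integral_mono_ae (integrable_mul_sq_sub h _)
    ((integrable_mul_sq_sub hmad _).const_mul _) ?_
  filter_upwards [hM] with z hz
  rw [madScore_mul]
  calc _ ≤ |χ z * (z ^ 2 - normalQuartile ^ 2)| := le_abs_self _
    _ = |χ z| * |z ^ 2 - normalQuartile ^ 2| := abs_mul _ _
    _ ≤ _ := mul_le_mul_of_nonneg_right hz (abs_nonneg _)

/-- Clipping is the metric projection onto [-b, b]. -/
lemma clip_closest {b u x : ℝ} (hb : 0 < b) (hx : |x| ≤ b) :
    (max (-b) (min b u) - u) ^ 2 ≤ (x - u) ^ 2 := by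
  obtain ⟨h1, h2⟩ := abs_le.1 hx
  rcases le_total u (-b) with h | h
  · rw [min_eq_right (by linarith), max_eq_left h]
    nlinarith
  · rcases le_total b u with h' | h'
    · rw [min_eq_left h', max_eq_right (by linarith)]
      nlinarith
    · rw [min_eq_right h', max_eq_right h, sub_self]
      nlinarith [sq_nonneg (x - u)]

/-- Huber's score minimizes the variance of the standardized score among all scores which satisfy
the same bound after standardization. -/
lemma huberScore_variance_le {χ : ℝ → ℝ} (h : MemLp χ 2 stdNormal) {a b : ℝ} (hb : 0 < b)
    (h0 : ∫ z, χ z ∂stdNormal = 0) (hB : 0 < scaleSensitivity χ)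
    (h0' : ∫ z, huberScore a b z ∂stdNormal = 0) (hB' : 0 < scaleSensitivity (huberScore a b))
    (hbd : ∀ᵐ z ∂stdNormal, |χ z / scaleSensitivity χ| ≤ b / scaleSensitivity (huberScore a b)) :
    ∫ z, (huberScore a b z / scaleSensitivity (huberScore a b)) ^ 2 ∂stdNormal ≤
      ∫ z, (χ z / scaleSensitivity χ) ^ 2 ∂stdNormal := by
  set B := scaleSensitivity χ with hBdef
  set B' := scaleSensitivity (huberScore a b) with hBdef'
  have hh := memLp_huberScore (a := a) hb
  have e1 := integral_mul_sq_sub h h0 (1 + a)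
  have e2 := integral_mul_sq_sub hh h0' (1 + a)
  have i1 : Integrable (fun z => (χ z / B) ^ 2) stdNormal := by
    simpa only [div_eq_mul_inv, mul_pow] using h.integrable_sq.mul_const (B⁻¹ ^ 2)
  have i2 : Integrable (fun z => (huberScore a b z / B') ^ 2) stdNormal := by
    simpa only [div_eq_mul_inv, mul_pow] using hh.integrable_sq.mul_const (B'⁻¹ ^ 2)
  have i3 := (integrable_mul_sq_sub h (1 + a)).const_mul (2 / (B * B'))
  have i4 := (integrable_mul_sq_sub hh (1 + a)).const_mul (2 / (B' * B'))
  -- The competitor is rescaled to the sensitivity and the bound of Huber's score, and both are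
  -- compared with z² - 1 - a. The cross terms integrate to the same number 2/B', so only the
  -- variances remain.
  have key := integral_mono_ae (i2.sub i4) (i1.sub i3) (by
    filter_upwards [hbd] with z hz
    simp only [Pi.sub_apply]
    have hx : |χ z / B * B'| ≤ b := by
      rw [abs_mul, abs_of_pos hB']
      rwa [le_div_iff₀ hB'] at hz
    have hc := clip_closest (u := z ^ 2 - 1 - a) hb hx
    rw [← huberScore] at hc
    have hc' := div_le_div_of_nonneg_right hc (sq_nonneg B')
    have t1 : (huberScore a b z - (z ^ 2 - 1 - a)) ^ 2 / B' ^ 2 =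
        (huberScore a b z / B') ^ 2 - 2 / (B' * B') * (huberScore a b z * (z ^ 2 - (1 + a))) +
          ((z ^ 2 - 1 - a) / B') ^ 2 := by
      field_simp
      ring
    have t2 : (χ z / B * B' - (z ^ 2 - 1 - a)) ^ 2 / B' ^ 2 =
        (χ z / B) ^ 2 - 2 / (B * B') * (χ z * (z ^ 2 - (1 + a))) +
          ((z ^ 2 - 1 - a) / B') ^ 2 := by
      field_simp
      ring
    rw [t1, t2] at hc'
    linarith)
  simp only [Pi.sub_apply] at key
  rw [integral_sub i2 i4, integral_sub i1 i3, integral_const_mul, integral_const_mul, e1, e2,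
    ← hBdef, ← hBdef'] at key
  have t3 : 2 / (B' * B') * B' = 2 / (B * B') * B := by field_simp
  linarith

/-- A clipped value lies between 0 and z² - 1 - a, so ∫ χ² ≤ B. Expanding 0 ≤ ∫ (χ - (z² - 1))² then
gives the bound. It is uniform in b and makes b/B unbounded. -/
lemma scaleSensitivity_huberScore_le {a b : ℝ} (hb : 0 < b)
    (h0 : ∫ z, huberScore a b z ∂stdNormal = 0) :
    scaleSensitivity (huberScore a b) ≤ ∫ z, (z ^ 2 - 1) ^ 2 ∂stdNormal := by
  have hh := memLp_huberScore (a := a) hb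
  have e := integral_mul_sq_sub hh h0 (1 + a)
  have i1 := hh.integrable_sq
  have i2 := integrable_mul_sq_sub hh (1 + a)
  have i3 := integrable_mul_sq_sub hh 1
  have i4 := (memLp_sq_sub 1).integrable_sq
  have h1 : ∫ z, huberScore a b z ^ 2 ∂stdNormal ≤ scaleSensitivity (huberScore a b) := by
    rw [← e]
    refine integral_mono i1 i2 fun z => ?_
    change huberScore a b z ^ 2 ≤ huberScore a b z * (z ^ 2 - (1 + a))
    rw [huberScore]
    rcases le_total (z ^ 2 - 1 - a) (-b) with h | h
    · rw [min_eq_right (by linarith), max_eq_left h]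
      nlinarith
    · rcases le_total b (z ^ 2 - 1 - a) with h' | h'
      · rw [min_eq_left h', max_eq_right (by linarith)]
        nlinarith
      · rw [min_eq_right h', max_eq_right h]
        nlinarith
  have h2 : 0 ≤ ∫ z, (huberScore a b z - (z ^ 2 - 1)) ^ 2 ∂stdNormal :=
    integral_nonneg fun z => sq_nonneg _
  have h3 : ∀ z, (huberScore a b z - (z ^ 2 - 1)) ^ 2 =
      huberScore a b z ^ 2 - 2 * (huberScore a b z * (z ^ 2 - 1)) + (z ^ 2 - 1) ^ 2 :=
    fun z => by ring
  simp_rw [h3] at h2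
  have i5 : Integrable (fun z => huberScore a b z ^ 2 - 2 * (huberScore a b z * (z ^ 2 - 1)))
    stdNormal := i1.sub (i3.const_mul 2)
  rw [integral_add i5 i4, integral_sub i1 (i3.const_mul 2),
    integral_const_mul] at h2
  change 0 ≤ _ - 2 * scaleSensitivity (huberScore a b) + _ at h2
  linarith

/-- For small bounds the sensitivity of Huber's score is close to the largest possible one. -/
lemma le_scaleSensitivity_huberScore {a b : ℝ} (hb : 0 < b)
    (h0 : ∫ z, huberScore a b z ∂stdNormal = 0) :
    b * (scaleSensitivity madScore - b) ≤ scaleSensitivity (huberScore a b) := by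
  have hh := memLp_huberScore (a := a) hb
  have hmad := wellBehavedScore_madScore.square_integrable
  have i1 := (integrable_mul_sq_sub hmad (1 + a)).const_mul b
  rw [← integral_mul_sq_sub hh h0 (1 + a), ← integral_mul_sq_sub hmad integral_madScore (1 + a)]
  have := integral_mono (i1.sub (integrable_const (b ^ 2))) (integrable_mul_sq_sub hh (1 + a))
    fun z => by
      simp only [Pi.sub_apply]
      have h1 : madScore z * (z ^ 2 - (1 + a)) ≤ |z ^ 2 - (1 + a)| := by
        refine (le_abs_self _).trans ?_
        rw [abs_mul]
        exact mul_le_of_le_one_left (abs_nonneg _) (abs_madScore_le z)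
      -- Where the score is clipped the product equals b|z² - 1 - a|; elsewhere that quantity is at
      -- most b², so the left side is not positive.
      have h2 : b * |z ^ 2 - (1 + a)| - b ^ 2 ≤ huberScore a b z * (z ^ 2 - (1 + a)) := by
        rw [huberScore]
        rcases le_total (z ^ 2 - 1 - a) (-b) with h | h
        · rw [min_eq_right (by linarith), max_eq_left h, abs_of_nonpos (by linarith)]
          nlinarith
        · rcases le_total b (z ^ 2 - 1 - a) with h' | h'
          · rw [min_eq_left h', max_eq_right (by linarith), abs_of_nonneg (by linarith)]
            nlinarith
          · rw [min_eq_right h', max_eq_right h]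
            have : |z ^ 2 - (1 + a)| ≤ b := abs_le.2 ⟨by linarith, by linarith⟩
            nlinarith [sq_nonneg (z ^ 2 - 1 - a)]
      have h3 := mul_le_mul_of_nonneg_left h1 hb.le
      linarith
  simp only [Pi.sub_apply] at this
  rw [integral_sub i1 (integrable_const _), integral_const_mul] at this
  simp only [integral_const, probReal_univ, smul_eq_mul, one_mul] at this
  linarith

lemma abs_scaleSensitivity_huberScore_sub_le {a b a' b' : ℝ} (hb : 0 < b) (hb' : 0 < b') :
    |scaleSensitivity (huberScore a b) - scaleSensitivity (huberScore a' b')| ≤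
      (|a - a'| + |b - b'|) * ∫ z, |z ^ 2 - 1| ∂stdNormal := by
  have i := ((memLp_sq_sub 1).integrable (by norm_num : (1 : ℝ≥0∞) ≤ 2)).norm
  rw [scaleSensitivity, scaleSensitivity, ← integral_sub
    (integrable_mul_sq_sub (memLp_huberScore hb) 1)
    (integrable_mul_sq_sub (memLp_huberScore hb') 1), ← integral_const_mul]
  refine norm_integral_le_of_norm_le (μ := stdNormal) (f := fun z : ℝ =>
    huberScore a b z * (z ^ 2 - 1) - huberScore a' b' z * (z ^ 2 - 1))
    (i.const_mul (|a - a'| + |b - b'|)) (ae_of_all _ fun z => ?_)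
  rw [← sub_mul, norm_mul, Real.norm_eq_abs]
  exact mul_le_mul_of_nonneg_right (abs_huberScore_sub_le a b a' b' z) (norm_nonneg _)

/-- The consistent shift of Huber's score depends continuously on the bound. -/
lemma continuousAt_huberShift {A : ℝ → ℝ}
    (hA : ∀ b, 0 < b → ∫ z, huberScore (A b) b z ∂stdNormal = 0) {b₀ : ℝ} (hb₀ : 0 < b₀) :
    ContinuousAt A b₀ := by
  have hlim : ∀ a, Tendsto (fun b => ∫ z, huberScore a b z ∂stdNormal) (𝓝 b₀)
      (𝓝 (∫ z, huberScore a b₀ z ∂stdNormal)) := fun a => by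
    rw [tendsto_iff_dist_tendsto_zero]
    have h0 : Tendsto (fun b => |b - b₀|) (𝓝 b₀) (𝓝 0) := by
      have : Continuous fun b => |b - b₀| := by fun_prop
      simpa using this.tendsto b₀
    refine squeeze_zero' (Eventually.of_forall fun _ => dist_nonneg) ?_ h0
    filter_upwards [lt_mem_nhds hb₀] with b hb
    simpa [Real.dist_eq] using abs_integral_huberScore_sub_le (a := a) (a' := a) hb hb₀
  -- For a fixed trial shift the sign of the mean persists for nearby bounds, and monotonicity in
  -- the shift then locates the consistent one.
  rw [ContinuousAt, tendsto_order]
  constructor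
  · intro a ha
    have hpos : 0 < ∫ z, huberScore a b₀ z ∂stdNormal := by
      refine lt_of_le_of_ne ?_ fun h => ha.ne (integral_huberScore_unique hb₀ h.symm (hA b₀ hb₀))
      rw [← hA b₀ hb₀]
      exact integral_huberScore_anti hb₀ ha.le
    filter_upwards [(hlim a).eventually (lt_mem_nhds hpos), lt_mem_nhds hb₀] with b h1 h2
    by_contra hle
    have := integral_huberScore_anti h2 (not_lt.1 hle)
    rw [hA b h2] at this
    linarith
  · intro a ha
    have hneg : ∫ z, huberScore a b₀ z ∂stdNormal < 0 := by
      refine lt_of_le_of_ne ?_ fun h => ha.ne (integral_huberScore_unique hb₀ (hA b₀ hb₀) h)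
      rw [← hA b₀ hb₀]
      exact integral_huberScore_anti hb₀ ha.le
    filter_upwards [(hlim a).eventually (gt_mem_nhds hneg), lt_mem_nhds hb₀] with b h1 h2
    by_contra hle
    have := integral_huberScore_anti h2 (not_lt.1 hle)
    rw [hA b h2] at this
    linarith

/-- Every bound above that of the MAD is attained by a standardized score of Huber. -/
lemma exists_huberScore_of_bound {c : ℝ} (hc : madInfluence < c) :
    ∃ a b : ℝ, 0 < b ∧ ∫ z, huberScore a b z ∂stdNormal = 0 ∧
      b / scaleSensitivity (huberScore a b) = c := by
  have hA' : ∀ b : ℝ, ∃ a, 0 < b → ∫ z, huberScore a b z ∂stdNormal = 0 := fun b => by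
    by_cases hb : 0 < b
    · obtain ⟨a, ha⟩ := exists_integral_huberScore_eq_zero hb
      exact ⟨a, fun _ => ha⟩
    · exact ⟨0, fun h => absurd h hb⟩
  choose A hA using hA'
  have hmad := madInfluence_pos
  have hc0 : 0 < c := hmad.trans hc
  have hB : 0 < scaleSensitivity madScore :=
    wellBehavedScore_madScore.scaleSensitivity_pos integral_madScore
  have hpos : ∀ b, 0 < b → 0 < scaleSensitivity (huberScore (A b) b) := fun b hb =>
    (wellBehavedScore_huberScore hb (hA b hb)).scaleSensitivity_pos (hA b hb)
  have hcont : ContinuousOn (fun b => b / scaleSensitivity (huberScore (A b) b)) (Set.Ioi 0) := by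
    intro b₀ (hb₀ : 0 < b₀)
    refine ContinuousAt.continuousWithinAt (continuousAt_id.div ?_ (hpos b₀ hb₀).ne')
    rw [ContinuousAt, tendsto_iff_dist_tendsto_zero]
    have h0 : Tendsto (fun b => (|A b - A b₀| + |b - b₀|) * ∫ z, |z ^ 2 - 1| ∂stdNormal) (𝓝 b₀)
        (𝓝 0) := by
      have h1 := ((continuousAt_huberShift hA hb₀).tendsto.sub_const (A b₀)).abs
      have h2 : Tendsto (fun b => |b - b₀|) (𝓝 b₀) (𝓝 |b₀ - b₀|) :=
        (tendsto_id.sub_const b₀).abs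
      simpa using (h1.add h2).mul_const (∫ z, |z ^ 2 - 1| ∂stdNormal)
    refine squeeze_zero' (Eventually.of_forall fun _ => dist_nonneg) ?_ h0
    filter_upwards [lt_mem_nhds hb₀] with b hb
    exact abs_scaleSensitivity_huberScore_sub_le hb hb₀
  rw [madInfluence_eq] at hc
  have hc' : 1 / c < scaleSensitivity madScore := by
    rw [div_lt_iff₀ hB] at hc
    rw [div_lt_iff₀ hc0]
    linarith
  -- Half of the gap, so that `scaleSensitivity madScore` - b₁ ≥ 1/c and the ratio at b₁ is at most
  -- c.
  set b₁ := (scaleSensitivity madScore - 1 / c) / 2 with hb₁def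
  have hb₁ : 0 < b₁ := by linarith
  set V := ∫ z, (z ^ 2 - 1) ^ 2 ∂stdNormal with hV
  -- As the sensitivity is at most V, the value c V pushes the ratio to at least c; the maximum
  -- keeps the interval ordered.
  set b₂ := max b₁ (c * V) with hb₂def
  have hb₂ : 0 < b₂ := hb₁.trans_le (le_max_left _ _)
  have h1 : b₁ / scaleSensitivity (huberScore (A b₁) b₁) ≤ c := by
    have := le_scaleSensitivity_huberScore hb₁ (hA b₁ hb₁)
    rw [div_le_iff₀ (hpos b₁ hb₁)]
    have h2 : 1 / c ≤ scaleSensitivity madScore - b₁ := by linarith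
    have h3 := mul_le_mul_of_nonneg_left h2 hb₁.le
    have h4 := mul_le_mul_of_nonneg_left (h3.trans this) hc0.le
    calc b₁ = c * (b₁ * (1 / c)) := by field_simp
      _ ≤ _ := h4
  have h2 : c ≤ b₂ / scaleSensitivity (huberScore (A b₂) b₂) := by
    rw [le_div_iff₀ (hpos b₂ hb₂)]
    exact (mul_le_mul_of_nonneg_left (scaleSensitivity_huberScore_le hb₂ (hA b₂ hb₂)) hc0.le).trans
      (le_max_right _ _)
  obtain ⟨b, hb, hbc⟩ := intermediate_value_Icc (le_max_left b₁ (c * V))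
    (hcont.mono fun x hx => hb₁.trans_le hx.1) ⟨h1, h2⟩
  have hb0 : 0 < b := hb₁.trans_le hb.1
  exact ⟨A b, b, hb0, hA b hb0, hbc⟩

/-! ### Functionals that behave like a scale functional at the normal model -/

/-- In the first order, the contamination of `H` at `x` acts on `L S` as the contamination of the
standard normal distribution at `z x` acts on `κ S`. -/
structure IsScaleLike {E : Type*} [MeasurableSpace E] (L : (Measure ℝ → ℝ) → Measure E → ℝ)
    (H : Measure E) (κ : ℝ) (z : E → ℝ) : Prop where
  pos : 0 < κ
  measurable : Measurable z
  surjective : Function.Surjective z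
  law : H.map z = stdNormal
  -- The path is the same for all S. The dilation stays inside S because the choice of a root need
  -- not be scale equivariant, and only |w| is required to converge because eigenvectors are
  -- determined up to sign.
  path : ∀ x, ∃ σ w : ℝ → ℝ, (∀ᶠ ε in 𝓝[>] (0 : ℝ), 0 < σ ε) ∧
    Tendsto (fun ε => |w ε|) (𝓝[>] 0) (𝓝 |z x|) ∧
    ∀ S : Measure ℝ → ℝ, FisherConsistent S →
      (∀ᶠ ε in 𝓝[>] (0 : ℝ), 0 < S ((contaminated stdNormal (w ε) ε).map fun t => σ ε * t)) →
      ∀ y, HasInfluence (L S) H x (κ * y) ↔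
        Tendsto (fun ε => (S ((contaminated stdNormal (w ε) ε).map fun t => σ ε * t) / σ ε - 1) / ε)
          (𝓝[>] 0) (𝓝 y)

lemma ContinuousAt.score_abs {χ : ℝ → ℝ} (he : ∀ x, χ (-x) = χ x) {t : ℝ}
    (h : ContinuousAt χ t) : ContinuousAt χ |t| := by
  rcases abs_choice t with h' | h' <;> rw [h']
  · exact h
  · have e : χ = fun x => χ (-x) := funext fun x => (he x).symm
    rw [e]
    exact ContinuousAt.comp (f := fun x => -x) (by rwa [neg_neg]) continuousAt_neg

lemma HasInfluence.influence_eq {E : Type*} [MeasurableSpace E] {T : Measure E → ℝ} {F : Measure E}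
    {x : E} {y : ℝ} (h : HasInfluence T F x y) : influence T F x = y :=
  h.limUnder_eq

lemma HasInfluence.le_grossErrorSensitivity {E : Type*} [MeasurableSpace E] {T : Measure E → ℝ}
    {F : Measure E} {x : E} {y : ℝ} (h : HasInfluence T F x y) :
    ‖y‖ₑ ≤ grossErrorSensitivity T F :=
  le_iSup_of_le x (le_iSup₂_of_le y h le_rfl)

namespace IsScaleLike

variable {E : Type*} [MeasurableSpace E] {L : (Measure ℝ → ℝ) → Measure E → ℝ} {H : Measure E}
  {κ : ℝ} {z : E → ℝ} (hL : IsScaleLike L H κ z) {χ : ℝ → ℝ} {S : Measure ℝ → ℝ}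
include hL

/-- After division by σ, whichever root S selects at the dilated law is a root at the undilated one,
and all these roots share the same first-order limit. Equivariance of S is not needed. -/
lemma hasInfluence_of_roots_near (hS : IsConsistentMScale χ S) {x : E}
    (hc : ContinuousAt χ (z x))
    (hloc : ∀ w : ℝ → ℝ, Tendsto (fun ε => |w ε|) (𝓝[>] 0) (𝓝 |z x|) →
      ∀ δ : ℝ, 0 < δ → δ < 1 / 50 → ∀ᶠ ε in 𝓝[>] (0 : ℝ), ∀ s,
      IsScaleRoot χ (contaminated stdNormal (w ε) ε) s → |s - 1| ≤ δ) :
    HasInfluence (L S) H x (κ * (χ (z x) / scaleSensitivity χ)) := by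
  have hwb := hS.well_behaved
  have h0 := hS.integral_eq_zero
  have hc' := hc.score_abs hwb.even
  obtain ⟨σ, w, hσ, hw, hiff⟩ := hL.path x
  have hroot : ∀ᶠ ε in 𝓝[>] (0 : ℝ), IsScaleRoot χ (contaminated stdNormal (w ε) ε)
      (S ((contaminated stdNormal (w ε) ε).map fun t => σ ε * t) / σ ε) := by
    filter_upwards [hwb.eventually_exists_root h0 hc' hw, eventually_mem_Ioo, hσ]
      with ε ⟨s, hs⟩ ⟨h3, h4⟩ hσε
    have hp := isProbabilityMeasure_contaminated stdNormal (w ε) h3.le h4.le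
    rw [← isScaleRoot_map_mul χ _ hσε]
    refine hS.isMScale _ (Measure.isProbabilityMeasure_map (by fun_prop)) ⟨s * σ ε, ?_⟩
    rw [isScaleRoot_map_mul χ _ hσε, mul_div_cancel_right₀ _ hσε.ne']
    exact hs
  rw [hiff S hS.consistent]
  · rw [← score_abs hwb.even (z x)]
    exact hwb.tendsto_root h0 hc' hw (hloc w hw) hroot
  · filter_upwards [hroot, hσ] with ε h1 h2
    exact (div_pos_iff_of_pos_right h2).1 h1.1

lemma hasInfluence_of_ne_zero (hS : IsConsistentMScale χ S) {x : E}
    (hc : ContinuousAt χ (z x)) (hx : z x ≠ 0) :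
    HasInfluence (L S) H x (κ * (χ (z x) / scaleSensitivity χ)) :=
  hL.hasInfluence_of_roots_near hS hc fun _ hw _ h1 h2 =>
    hS.well_behaved.eventually_roots_near hS.integral_eq_zero (abs_pos.2 hx) hw h1 h2

lemma ae_of_ae {p : ℝ → Prop} (h : ∀ᵐ t ∂stdNormal, p t) : ∀ᵐ x ∂H, p (z x) := by
  rw [← hL.law] at h
  exact ae_of_ae_map hL.measurable.aemeasurable h

omit hL in
lemma ae_regular (hχ : WellBehavedScore χ) : ∀ᵐ t ∂stdNormal, ContinuousAt χ t ∧ t ≠ 0 := by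
  have h1 : ∀ᵐ t ∂stdNormal, t ∉ {x | ¬ ContinuousAt χ x} :=
    measure_eq_zero_iff_ae_notMem.1 (hχ.finite_discontinuities.measure_zero _)
  filter_upwards [h1, ae_stdNormal_ne 0] with t h2 h3
  exact ⟨by simpa using h2, h3⟩

lemma ae_hasInfluence (hS : IsConsistentMScale χ S) :
    ∀ᵐ x ∂H, HasInfluence (L S) H x (κ * (χ (z x) / scaleSensitivity χ)) := by
  filter_upwards [hL.ae_of_ae (ae_regular hS.well_behaved)] with x hx
  exact hL.hasInfluence_of_ne_zero hS hx.1 hx.2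

lemma asymptoticVariance_eq (hS : IsConsistentMScale χ S) :
    asymptoticVariance (L S) H = ENNReal.ofReal (κ ^ 2) *
      ENNReal.ofReal (∫ t, (χ t / scaleSensitivity χ) ^ 2 ∂stdNormal) := by
  have hm := hS.well_behaved.square_integrable
  have hi : Integrable (fun t => (χ t / scaleSensitivity χ) ^ 2) stdNormal := by
    simpa only [div_eq_mul_inv, mul_pow] using hm.integrable_sq.mul_const _
  have hae : AEMeasurable (fun t => ENNReal.ofReal ((χ t / scaleSensitivity χ) ^ 2)) (H.map z) := by
    rw [hL.law]
    exact hi.aemeasurable.ennreal_ofReal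
  rw [asymptoticVariance, ofReal_integral_eq_lintegral_ofReal hi (ae_of_all _ fun t => sq_nonneg _),
    ← hL.law, lintegral_map' hae hL.measurable.aemeasurable,
    ← lintegral_const_mul' _ _ ENNReal.ofReal_ne_top]
  refine lintegral_congr_ae ?_
  filter_upwards [hL.ae_hasInfluence hS] with x hx
  rw [hx.influence_eq, Real.enorm_eq_ofReal_abs, ← ENNReal.ofReal_pow (abs_nonneg _), sq_abs,
    ← ENNReal.ofReal_mul (sq_nonneg _), mul_pow]

/-- Surjectivity of z realizes almost every argument of the score as a point where the influence
exists, so the supremum bounds the standardized score. -/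
lemma ae_le_of_grossErrorSensitivity_le (hS : IsConsistentMScale χ S) {m : ℝ} (hm : 0 ≤ m)
    (h : grossErrorSensitivity (L S) H ≤ ENNReal.ofReal (κ * m)) :
    ∀ᵐ t ∂stdNormal, |χ t / scaleSensitivity χ| ≤ m := by
  filter_upwards [ae_regular hS.well_behaved] with t ht
  obtain ⟨x, rfl⟩ := hL.surjective t
  have h1 := (hL.hasInfluence_of_ne_zero hS ht.1 ht.2).le_grossErrorSensitivity.trans h
  rw [Real.enorm_eq_ofReal_abs, ENNReal.ofReal_le_ofReal_iff (mul_nonneg hL.pos.le hm), abs_mul,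
    abs_of_pos hL.pos] at h1
  exact le_of_mul_le_mul_left h1 hL.pos

/-! #### The MAD -/

lemma hasInfluence_mad (hS : S = mad ∨ S = madKnownCenter) {x : E} (hx : |z x| ≠ normalQuartile) :
    HasInfluence (L S) H x
      (κ * if |z x| < normalQuartile then -madInfluence else madInfluence) := by
  obtain ⟨σ, w, hσ, hw, hiff⟩ := hL.path x
  obtain ⟨m, K, hm, hSm⟩ := exists_center_of_mad hS w
  have hpos : ∀ᶠ ε in 𝓝[>] (0 : ℝ), 0 < S (contaminated stdNormal (w ε) ε) := by
    filter_upwards [eventually_abs_medianDeviation_sub_one_le (w := w) hm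
      (lt_add_one madInfluence), eventually_one_add_mul_pos (-(madInfluence + 1))] with ε h1 h2
    rw [hSm]
    linarith [(abs_le.1 h1).1]
  rw [hiff S (fisherConsistent_of_mad hS)]
  · refine (tendsto_medianDeviation hm hw hx).congr' ?_
    filter_upwards [hσ] with ε h
    rw [map_mul_of_mad hS _ h, mul_div_cancel_left₀ _ h.ne', hSm]
  · filter_upwards [hσ, hpos] with ε h h'
    rw [map_mul_of_mad hS _ h]
    positivity

/-- This also covers |z x| = q, where the limit is not computed: if it exists, it obeys the
two-sided first-order bound. -/
lemma abs_le_of_hasInfluence_mad (hS : S = mad ∨ S = madKnownCenter) {x : E} {y : ℝ}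
    (hy : HasInfluence (L S) H x y) : |y| ≤ κ * madInfluence := by
  obtain ⟨σ, w, hσ, hw, hiff⟩ := hL.path x
  obtain ⟨m, K, hm, hSm⟩ := exists_center_of_mad hS w
  have hpos : ∀ᶠ ε in 𝓝[>] (0 : ℝ), 0 < S (contaminated stdNormal (w ε) ε) := by
    filter_upwards [eventually_abs_medianDeviation_sub_one_le (w := w) hm
      (lt_add_one madInfluence), eventually_one_add_mul_pos (-(madInfluence + 1))] with ε h1 h2
    rw [hSm]
    linarith [(abs_le.1 h1).1]
  have hκ := hL.pos
  rw [show y = κ * (y / κ) by field_simp, hiff S (fisherConsistent_of_mad hS) (by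
    filter_upwards [hσ, hpos] with ε h h'
    rw [map_mul_of_mad hS _ h]
    positivity)] at hy
  have hle : |y / κ| ≤ madInfluence := by
    refine le_of_forall_gt_imp_ge_of_dense fun k hk => ?_
    refine le_of_tendsto hy.abs ?_
    filter_upwards [eventually_abs_medianDeviation_sub_one_le (w := w) hm hk, hσ,
      self_mem_nhdsWithin] with ε h1 h2 (h3 : 0 < ε)
    rw [map_mul_of_mad hS _ h2, mul_div_cancel_left₀ _ h2.ne', hSm, abs_div, abs_of_pos h3,
      div_le_iff₀ h3]
    exact h1
  rw [abs_div, abs_of_pos hκ, div_le_iff₀ hκ] at hle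
  linarith

lemma grossErrorSensitivity_mad (hS : S = mad ∨ S = madKnownCenter) :
    grossErrorSensitivity (L S) H = ENNReal.ofReal (κ * madInfluence) := by
  have hq := normalQuartile_pos
  refine le_antisymm ?_ ?_
  · refine iSup_le fun x => iSup₂_le fun y hy => ?_
    rw [Real.enorm_eq_ofReal_abs]
    exact ENNReal.ofReal_le_ofReal (hL.abs_le_of_hasInfluence_mad hS hy)
  · obtain ⟨x, hx⟩ := hL.surjective 0
    have h := hL.hasInfluence_mad hS (x := x) (by rw [hx, abs_zero]; exact hq.ne)
    have h1 := h.le_grossErrorSensitivity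
    rw [if_pos (by rwa [hx, abs_zero]), Real.enorm_eq_ofReal_abs, mul_neg, abs_neg,
      abs_of_pos (mul_pos hL.pos madInfluence_pos)] at h1
    exact h1

theorem madMostBRobust : MadMostBRobust L H := by
  intro S₀ hS₀
  refine ⟨?_, ?_, fun χ S hS => ?_⟩
  · filter_upwards [hL.ae_of_ae ((ae_stdNormal_ne normalQuartile).and
      (ae_stdNormal_ne (-normalQuartile)))] with x hx
    refine ⟨_, hL.hasInfluence_mad hS₀ fun h => ?_⟩
    rcases abs_choice (z x) with h' | h' <;> rw [h'] at h
    · exact hx.1 h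
    · exact hx.2 (by linarith)
  · rw [hL.grossErrorSensitivity_mad hS₀]
    exact ENNReal.ofReal_lt_top
  · rw [hL.grossErrorSensitivity_mad hS₀]
    rcases eq_or_ne (grossErrorSensitivity (L S) H) ⊤ with h | h
    · rw [h]
      exact le_top
    have hκ := hL.pos
    have hwb := hS.well_behaved
    have h0 := hS.integral_eq_zero
    have hB := hwb.scaleSensitivity_pos h0
    -- In units of κ, the sensitivity of the competitor bounds its standardized score. The extremal
    -- inequality then gives 1 ≤ m · `scaleSensitivity madScore`.
    set m := (grossErrorSensitivity (L S) H).toReal / κ with hm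
    have hm0 : 0 ≤ m := by positivity
    have hg : grossErrorSensitivity (L S) H = ENNReal.ofReal (κ * m) := by
      rw [hm, mul_div_cancel₀ _ hκ.ne', ENNReal.ofReal_toReal h]
    have hbd := hL.ae_le_of_grossErrorSensitivity_le hS hm0 hg.le
    have h1 := scaleSensitivity_le_of_bounded hwb.square_integrable h0
      (M := m * scaleSensitivity χ) (by
        filter_upwards [hbd] with t ht
        rwa [abs_div, abs_of_pos hB, div_le_iff₀ hB] at ht)
    have hBm : 0 < scaleSensitivity madScore :=
      wellBehavedScore_madScore.scaleSensitivity_pos integral_madScore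
    rw [hg]
    refine ENNReal.ofReal_le_ofReal (mul_le_mul_of_nonneg_left ?_ hκ.le)
    rw [madInfluence_eq, div_le_iff₀ hBm]
    refine le_of_mul_le_mul_left ?_ hB
    linarith

/-! #### Huber's M-functionals -/

variable {a b : ℝ}

/-- Monotone localization of the roots includes z x = 0, so no point has to be excluded. -/
lemma hasInfluence_huber (hb : 0 < b) (hS : IsConsistentMScale (huberScore a b) S) (x : E) :
    HasInfluence (L S) H x
      (κ * (huberScore a b (z x) / scaleSensitivity (huberScore a b))) :=
  hL.hasInfluence_of_roots_near hS (continuous_huberScore a b).continuousAt fun w _ _ h1 h2 =>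
    hS.well_behaved.eventually_roots_near_of_monotone hS.integral_eq_zero monotoneOn_huberScore
      (abs_huberScore_le hb) w h1 h2

lemma grossErrorSensitivity_huber (hb : 0 < b) (hS : IsConsistentMScale (huberScore a b) S) :
    grossErrorSensitivity (L S) H =
      ENNReal.ofReal (κ * (b / scaleSensitivity (huberScore a b))) := by
  have hκ := hL.pos
  have hB := hS.well_behaved.scaleSensitivity_pos hS.integral_eq_zero
  refine le_antisymm ?_ ?_
  · refine iSup_le fun x => iSup₂_le fun y hy => ?_
    rw [tendsto_nhds_unique hy (hL.hasInfluence_huber hb hS x), Real.enorm_eq_ofReal_abs, abs_mul,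
      abs_div, abs_of_pos hκ, abs_of_pos hB]
    have := abs_huberScore_le (a := a) hb (z x)
    refine ENNReal.ofReal_le_ofReal ?_
    gcongr
  · obtain ⟨t, -, ht⟩ := exists_huberScore_eq_bound a hb
    obtain ⟨x, rfl⟩ := hL.surjective t
    have h := (hL.hasInfluence_huber hb hS x).le_grossErrorSensitivity
    rwa [ht, Real.enorm_eq_ofReal_abs, abs_of_pos (by positivity)] at h

lemma isOptimalBRobust_huber (hb : 0 < b) (hS : IsConsistentMScale (huberScore a b) S)
    (r : ℝ≥0∞) : IsOptimalBRobust L H r (grossErrorSensitivity (L S) H) S := by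
  refine ⟨le_rfl, fun χ S' hS' hle => ENNReal.div_le_div_left ?_ _⟩
  have hB := hS.well_behaved.scaleSensitivity_pos hS.integral_eq_zero
  have hB' := hS'.well_behaved.scaleSensitivity_pos hS'.integral_eq_zero
  rw [hL.grossErrorSensitivity_huber hb hS] at hle
  have hbd := hL.ae_le_of_grossErrorSensitivity_le hS' (by positivity) hle
  rw [hL.asymptoticVariance_eq hS, hL.asymptoticVariance_eq hS']
  exact mul_le_mul' le_rfl (ENNReal.ofReal_le_ofReal
    (huberScore_variance_le hS'.well_behaved.square_integrable hb hS'.integral_eq_zero hB'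
      hS.integral_eq_zero hB hbd))

theorem huberOptimalBRobust (r : ℝ≥0∞) : HuberOptimalBRobust L H r := by
  refine ⟨fun a b S hb hS => ⟨fun x => ⟨_, hL.hasInfluence_huber hb hS x⟩,
    hL.isOptimalBRobust_huber hb hS r⟩, fun c hc hc' => ?_⟩
  have hκ := hL.pos
  rw [hL.grossErrorSensitivity_mad (.inl rfl), ENNReal.ofReal_lt_iff_lt_toReal
    (mul_pos hκ madInfluence_pos).le hc'.ne] at hc
  have hc1 : madInfluence < c.toReal / κ := by
    rw [lt_div_iff₀ hκ]
    linarith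
  obtain ⟨a, b, hb, h0, hbc⟩ := exists_huberScore_of_bound hc1
  refine ⟨a, b, hb, (exists_isConsistentMScale_huberScore_iff hb).2 h0, fun S hS => ?_⟩
  have hg : grossErrorSensitivity (L S) H = c := by
    rw [hL.grossErrorSensitivity_huber hb hS, hbc, mul_div_cancel₀ _ hκ.ne',
      ENNReal.ofReal_toReal hc'.ne]
  exact ⟨hg, hg ▸ hL.isOptimalBRobust_huber hb hS r⟩

end IsScaleLike

lemma isScaleLike_self : IsScaleLike (fun S => S) stdNormal 1 id where
  pos := one_pos
  measurable := measurable_id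
  surjective := Function.surjective_id
  law := Measure.map_id
  path x := by
    refine ⟨fun _ => 1, fun _ => x, by simp, tendsto_const_nhds, fun S hS _ y => ?_⟩
    have h1 := hS 1 one_pos
    rw [gaussianReal_toNNReal_one] at h1
    simp only [HasInfluence, h1, one_mul, div_one, Measure.map_id']

/-! ### Perturbation of eigenvectors -/

section Perturbation

variable {p : ℕ}

namespace IsOrderedEigenbasis

variable {M M' : Matrix (Fin p) (Fin p) ℝ} {u v : Fin p → EuclideanSpace ℝ (Fin p)}
  {γ μ : Fin p → ℝ}

lemma exists_orthonormalBasis (h : Orthonormal ℝ u) :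
    ∃ b : OrthonormalBasis (Fin p) ℝ (EuclideanSpace ℝ (Fin p)), ⇑b = u := by
  obtain ⟨b, hb⟩ := Orthonormal.exists_orthonormalBasis_extension_of_card_eq (𝕜 := ℝ) (v := u)
    (s := Set.univ) (by simp) (by
      refine ⟨fun i => h.1 i, fun i j hij => h.2 fun h' => hij (Subtype.ext h')⟩)
  exact ⟨b, funext fun i => hb i (Set.mem_univ i)⟩

lemma sum_inner_smul (h : Orthonormal ℝ u) (x : EuclideanSpace ℝ (Fin p)) :
    ∑ i, inner ℝ (u i) x • u i = x := by
  obtain ⟨b, rfl⟩ := exists_orthonormalBasis h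
  exact b.sum_repr' x

lemma sum_inner_sq (h : Orthonormal ℝ u) (x : EuclideanSpace ℝ (Fin p)) :
    ∑ i, inner ℝ (u i) x ^ 2 = ‖x‖ ^ 2 := by
  obtain ⟨b, rfl⟩ := exists_orthonormalBasis h
  simpa using b.sum_sq_norm_inner_right x

/-- The bilinear form of a matrix with an orthonormal eigenbasis. -/
lemma dotProduct_mulVec_eq (h : IsOrderedEigenbasis M u γ) (x y : EuclideanSpace ℝ (Fin p)) :
    x.ofLp ⬝ᵥ M.mulVec y.ofLp = ∑ i, γ i * (inner ℝ (u i) x * inner ℝ (u i) y) := by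
  have hy : y.ofLp = ∑ i, inner ℝ (u i) y • (u i).ofLp := by
    conv_lhs => rw [← sum_inner_smul h.1 y]
    simp
  have hM : M.mulVec y.ofLp = ∑ i, inner ℝ (u i) y • γ i • (u i).ofLp := by
    conv_lhs => rw [hy]
    rw [Matrix.mulVec_sum]
    simp_rw [Matrix.mulVec_smul, h.2.2]
  rw [hM, dotProduct_sum]
  refine Finset.sum_congr rfl fun i _ => ?_
  rw [dotProduct_smul, dotProduct_smul, PiLp.inner_apply (u i) x]
  simp only [dotProduct, smul_eq_mul, RCLike.inner_apply, conj_trivial]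
  ring

lemma abs_dotProduct_mulVec_sub_le {e : ℝ} (he : ∀ i j, |M' i j - M i j| ≤ e)
    (x y : EuclideanSpace ℝ (Fin p)) :
    |x.ofLp ⬝ᵥ M'.mulVec y.ofLp - x.ofLp ⬝ᵥ M.mulVec y.ofLp| ≤ p ^ 2 * e * (‖x‖ * ‖y‖) := by
  rw [← dotProduct_sub, ← Matrix.sub_mulVec]
  simp only [dotProduct, Matrix.mulVec, Matrix.sub_apply, Finset.mul_sum]
  refine (Finset.abs_sum_le_sum_abs _ _).trans ?_
  have hterm : ∀ i j, |x.ofLp i * ((M' i j - M i j) * y.ofLp j)| ≤ e * (‖x‖ * ‖y‖) := fun i j => by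
    rw [abs_mul, abs_mul]
    have h1 : |x.ofLp i| ≤ ‖x‖ := PiLp.norm_apply_le x i
    have h2 : |y.ofLp j| ≤ ‖y‖ := PiLp.norm_apply_le y j
    have h3 := (abs_nonneg _).trans (he i j)
    calc |x.ofLp i| * (|M' i j - M i j| * |y.ofLp j|) ≤ ‖x‖ * (e * ‖y‖) := by
          have := he i j
          gcongr
      _ = _ := by ring
  calc _ ≤ ∑ _i : Fin p, ∑ _j : Fin p, e * (‖x‖ * ‖y‖) :=
        Finset.sum_le_sum fun i _ => (Finset.abs_sum_le_sum_abs _ _).trans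
          (Finset.sum_le_sum fun j _ => hterm i j)
    _ = _ := by
        simp
        ring

/-- The eigenvalues of a perturbed matrix are not much smaller (Weyl's inequality, with a crude
constant). -/
lemma eigenvalue_le (h : IsOrderedEigenbasis M u γ) (h' : IsOrderedEigenbasis M' v μ) {e : ℝ}
    (he : ∀ i j, |M' i j - M i j| ≤ e) (k : Fin p) : γ k ≤ μ k + p ^ 2 * e := by
  -- These p - 1 linear conditions leave a nonzero x in the span of the u i with i ≤ k and in the
  -- span of the v i with i ≥ k. Its two quadratic forms are then bounded by γ k from below and by μ
  -- k from above.
  let f : EuclideanSpace ℝ (Fin p) →ₗ[ℝ] ({i : Fin p // i ≠ k} → ℝ) :=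
    LinearMap.pi fun i => (innerSL ℝ (if k < i.1 then u i else v i)).toLinearMap
  have hker : LinearMap.ker f ≠ ⊥ := by
    refine LinearMap.ker_ne_bot_of_finrank_lt ?_
    rw [Module.finrank_fintype_fun_eq_card, finrank_euclideanSpace, Fintype.card_fin]
    have := Fintype.card_subtype_lt (p := fun i : Fin p => i ≠ k) (x := k) (by simp)
    simpa using this
  obtain ⟨x, hx, hx0⟩ := Submodule.exists_mem_ne_zero_of_ne_bot hker
  have hfx : ∀ i, i ≠ k → inner ℝ (if k < i then u i else v i) x = 0 := fun i hi =>
    congrFun (LinearMap.mem_ker.1 hx) ⟨i, hi⟩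
  have hpos : 0 < ‖x‖ ^ 2 := by positivity
  have h1 : γ k * ‖x‖ ^ 2 ≤ x.ofLp ⬝ᵥ M.mulVec x.ofLp := by
    rw [h.dotProduct_mulVec_eq, ← sum_inner_sq h.1, Finset.mul_sum]
    refine Finset.sum_le_sum fun i _ => ?_
    rw [← pow_two]
    rcases lt_or_ge k i with hi | hi
    · have := hfx i hi.ne'
      rw [if_pos hi] at this
      simp [this]
    · exact mul_le_mul_of_nonneg_right (h.2.1 hi) (sq_nonneg _)
  have h2 : x.ofLp ⬝ᵥ M'.mulVec x.ofLp ≤ μ k * ‖x‖ ^ 2 := by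
    rw [h'.dotProduct_mulVec_eq, ← sum_inner_sq h'.1, Finset.mul_sum]
    refine Finset.sum_le_sum fun i _ => ?_
    rw [← pow_two]
    rcases lt_or_ge i k with hi | hi
    · have := hfx i hi.ne
      rw [if_neg hi.not_gt] at this
      simp [this]
    · exact mul_le_mul_of_nonneg_right (h'.2.1 hi) (sq_nonneg _)
  have h3 := (abs_le.1 (abs_dotProduct_mulVec_sub_le he x x)).1
  rw [← pow_two] at h3
  refine le_of_mul_le_mul_right ?_ hpos
  linarith

lemma abs_eigenvalue_sub_le (h : IsOrderedEigenbasis M u γ) (h' : IsOrderedEigenbasis M' v μ)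
    {e : ℝ} (he : ∀ i j, |M' i j - M i j| ≤ e) (k : Fin p) : |μ k - γ k| ≤ p ^ 2 * e := by
  have h1 := h.eigenvalue_le h' he k
  have h2 := h'.eigenvalue_le h (fun i j => by rw [abs_sub_comm]; exact he i j) k
  rw [abs_le]
  constructor <;> linarith

/-- Evaluating the perturbation between two eigenvectors gives uᵢᵀ(M' - M)vₖ = (μₖ - γᵢ)⟨uᵢ, vₖ⟩. -/
lemma abs_inner_mul_le (h : IsOrderedEigenbasis M u γ) (h' : IsOrderedEigenbasis M' v μ) {e : ℝ}
    (he : ∀ i j, |M' i j - M i j| ≤ e) (i k : Fin p) :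
    |μ k - γ i| * |inner ℝ (u i) (v k)| ≤ p ^ 2 * e := by
  have h1 := abs_dotProduct_mulVec_sub_le he (u i) (v k)
  rw [h.dotProduct_mulVec_eq, h'.dotProduct_mulVec_eq, h.1.1, h'.1.1, mul_one, mul_one,
    Finset.sum_eq_single k, Finset.sum_eq_single i] at h1
  · rw [real_inner_self_eq_norm_sq, real_inner_self_eq_norm_sq, h.1.1, h'.1.1,
      real_inner_comm (u i) (v k)] at h1
    rw [← abs_mul]
    refine le_of_eq_of_le (congrArg _ ?_) h1
    ring
  · intro j _ hj
    rw [h.1.2 hj]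
    ring
  · simp
  · intro j _ hj
    rw [h'.1.2 hj]
    ring
  · simp

lemma inner_eq_zero (h : IsOrderedEigenbasis M u γ) (h' : IsOrderedEigenbasis M v μ)
    (hγ : StrictAnti γ) {i k : Fin p} (hik : i ≠ k) : inner ℝ (u i) (v k) = 0 := by
  have he : ∀ i j, |M i j - M i j| ≤ 0 := by simp
  have h1 := h.abs_eigenvalue_sub_le h' he k
  have h2 := h.abs_inner_mul_le h' he i k
  rw [mul_zero] at h1 h2
  rw [sub_eq_zero.1 (abs_nonpos_iff.1 h1)] at h2
  have h3 : 0 < |γ k - γ i| := abs_pos.2 (sub_ne_zero.2 (hγ.injective.ne hik.symm))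
  have h4 : |inner ℝ (u i) (v k)| ≤ 0 := by
    by_contra hlt
    exact absurd h2 (not_le.2 (mul_pos h3 (not_le.1 hlt)))
  exact abs_nonpos_iff.1 h4

/-- The eigenvectors of a matrix with distinct eigenvalues change, up to their sign, at most at the
order of the perturbation. -/
lemma eventually_abs_inner_le (h : IsOrderedEigenbasis M u γ) (hγ : StrictAnti γ)
    {M' : ℝ → Matrix (Fin p) (Fin p) ℝ} {v : ℝ → Fin p → EuclideanSpace ℝ (Fin p)}
    (h' : ∀ᶠ ε in 𝓝[>] (0 : ℝ), ∃ μ, IsOrderedEigenbasis (M' ε) (v ε) μ)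
    (hM : ∀ i j, (fun ε : ℝ => M' ε i j - M i j) =O[𝓝[>] 0] (fun ε : ℝ => ε)) (k : Fin p) :
    ∃ K, ∀ᶠ ε in 𝓝[>] (0 : ℝ), ∀ i, i ≠ k → |inner ℝ (u i) (v ε k)| ≤ K * ε := by
  have hM' : ∀ i j, ∃ C, ∀ᶠ ε in 𝓝[>] (0 : ℝ), |M' ε i j - M i j| ≤ C * ε := fun i j => by
    obtain ⟨C, hC⟩ := (hM i j).bound
    refine ⟨C, ?_⟩
    filter_upwards [hC, self_mem_nhdsWithin] with ε h1 (h2 : 0 < ε)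
    rwa [Real.norm_eq_abs, Real.norm_eq_abs, abs_of_pos h2] at h1
  choose C hC using hM'
  set D := ∑ i, ∑ j, |C i j| with hD
  have hCD : ∀ i j, C i j ≤ D := fun i j => (le_abs_self _).trans
    ((Finset.single_le_sum (f := fun j => |C i j|) (fun _ _ => abs_nonneg _)
      (Finset.mem_univ j)).trans (Finset.single_le_sum (f := fun i => ∑ j, |C i j|)
        (fun _ _ => Finset.sum_nonneg fun _ _ => abs_nonneg _) (Finset.mem_univ i)))
  have hclose : ∀ᶠ ε in 𝓝[>] (0 : ℝ), ∀ i j, |M' ε i j - M i j| ≤ D * ε := by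
    have h1 : ∀ᶠ ε in 𝓝[>] (0 : ℝ), ∀ i j, |M' ε i j - M i j| ≤ C i j * ε :=
      eventually_all.2 fun i => eventually_all.2 fun j => hC i j
    filter_upwards [h1, self_mem_nhdsWithin] with ε h2 (h3 : 0 < ε) i j
    exact (h2 i j).trans (mul_le_mul_of_nonneg_right (hCD i j) h3.le)
  set K := ∑ i, 2 * (p ^ 2 * D) / |γ k - γ i| with hK
  refine ⟨K, ?_⟩
  have hD0 : 0 ≤ D := Finset.sum_nonneg fun _ _ => Finset.sum_nonneg fun _ _ => abs_nonneg _
  -- Below half of the gap the perturbed eigenvalue stays at least half of the gap away from the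
  -- other γ i, which explains the factor 2 in `K`.
  have hsmall : ∀ᶠ ε in 𝓝[>] (0 : ℝ), ∀ i, i ≠ k → p ^ 2 * (D * ε) < |γ k - γ i| / 2 := by
    refine eventually_all.2 fun i => ?_
    by_cases hik : i = k
    · simp [hik]
    · have h3 : 0 < |γ k - γ i| := abs_pos.2 (sub_ne_zero.2 (hγ.injective.ne (Ne.symm hik)))
      have hcont : Continuous fun ε : ℝ => p ^ 2 * (D * ε) := by fun_prop
      have h4 := (hcont.tendsto 0).mono_left (nhdsWithin_le_nhds (s := Set.Ioi 0))
      rw [mul_zero, mul_zero] at h4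
      exact (h4.eventually (gt_mem_nhds (half_pos h3))).mono fun ε hε _ => hε
  filter_upwards [h', hclose, hsmall, self_mem_nhdsWithin] with ε ⟨μ, hμ⟩ hc hs (hε : 0 < ε) i hik
  have h1 := h.abs_eigenvalue_sub_le hμ hc k
  have h2 := h.abs_inner_mul_le hμ hc i k
  have h3 : 0 < |γ k - γ i| := abs_pos.2 (sub_ne_zero.2 (hγ.injective.ne hik.symm))
  have h4 : |γ k - γ i| / 2 ≤ |μ k - γ i| := by
    have := abs_sub_abs_le_abs_sub (γ k - γ i) (γ k - μ k)
    rw [show γ k - γ i - (γ k - μ k) = μ k - γ i by ring, abs_sub_comm (γ k) (μ k)] at this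
    linarith [hs i hik]
  have h5 : |γ k - γ i| / 2 * |inner ℝ (u i) (v ε k)| ≤ p ^ 2 * (D * ε) :=
    (mul_le_mul_of_nonneg_right h4 (abs_nonneg _)).trans h2
  have h6 : |inner ℝ (u i) (v ε k)| ≤ 2 * (p ^ 2 * D) / |γ k - γ i| * ε := by
    rw [div_mul_eq_mul_div, le_div_iff₀ h3]
    linarith
  refine h6.trans (mul_le_mul_of_nonneg_right ?_ hε.le)
  exact Finset.single_le_sum (f := fun i => 2 * (p ^ 2 * D) / |γ k - γ i|)
    (fun _ _ => by positivity) (Finset.mem_univ i)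

end IsOrderedEigenbasis

end Perturbation

/-! ### Products of normal distributions -/

section NormalProduct

variable {p : ℕ} {l : Fin p → ℝ}

/-- The product of centered normal distributions with variances `l i`. -/
def normalProduct (l : Fin p → ℝ) : Measure (Fin p → ℝ) :=
  Measure.pi fun i => gaussianReal 0 (l i).toNNReal

/-- The Lebesgue density of `normalProduct`. -/
def normalProductDensity (l : Fin p → ℝ) (y : Fin p → ℝ) : ℝ :=
  ∏ i, gaussianPDFReal 0 (l i).toNNReal (y i)

lemma measurable_normalProductDensity : Measurable (normalProductDensity l) :=
  Finset.measurable_prod _ fun i _ =>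
    (measurable_gaussianPDFReal 0 (l i).toNNReal).comp (measurable_pi_apply i)

lemma normalProductDensity_nonneg (y : Fin p → ℝ) : 0 ≤ normalProductDensity l y :=
  Finset.prod_nonneg fun _ _ => gaussianPDFReal_nonneg _ _ _

lemma normalProduct_eq_withDensity (hl : ∀ i, 0 < l i) :
    normalProduct l
      = volume.withDensity fun y => ENNReal.ofReal (normalProductDensity l y) := by
  refine Measure.pi_eq fun s hs => ?_
  rw [withDensity_apply _ (MeasurableSet.univ_pi hs), volume_pi, Measure.restrict_pi_pi,
    ← ofReal_integral_eq_lintegral_ofReal]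
  · unfold normalProductDensity
    rw [integral_fintype_prod_eq_prod (f := fun i x => gaussianPDFReal 0 (l i).toNNReal x),
      ENNReal.ofReal_prod_of_nonneg fun i _ => integral_nonneg fun x => gaussianPDFReal_nonneg _ _ _]
    refine Finset.prod_congr rfl fun i _ => ?_
    rw [gaussianReal_apply_eq_integral 0 (by simpa using hl i)]
  · exact Integrable.fintype_prod (f := fun i x => gaussianPDFReal 0 (l i).toNNReal x)
      fun i => (integrable_gaussianPDFReal 0 _).restrict
  · exact ae_of_all _ normalProductDensity_nonneg

lemma normalProductDensity_eq (hl : ∀ i, 0 < l i) :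
    ∃ C, 0 < C ∧ ∀ y, normalProductDensity l y = C * Real.exp (-∑ i, y i ^ 2 / (2 * l i)) := by
  refine ⟨∏ i, (Real.sqrt (2 * Real.pi * l i))⁻¹, Finset.prod_pos fun i _ => ?_, fun y => ?_⟩
  · have := hl i
    positivity
  · rw [← Finset.sum_neg_distrib, Real.exp_sum, ← Finset.prod_mul_distrib]
    refine Finset.prod_congr rfl fun i _ => ?_
    rw [gaussianPDFReal, Real.coe_toNNReal _ (hl i).le, sub_zero, neg_div]

lemma sum_sq_swap_sub (y : Fin p → ℝ) {i j : Fin p} (hij : i ≠ j) :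
    (∑ m, y (Equiv.swap i j m) ^ 2 / (2 * l m)) - ∑ m, y m ^ 2 / (2 * l m) =
      (y i ^ 2 - y j ^ 2) * (1 / (2 * l j) - 1 / (2 * l i)) := by
  rw [← Finset.sum_sub_distrib, Fintype.sum_eq_add i j hij]
  · rw [Equiv.swap_apply_left, Equiv.swap_apply_right]
    ring
  · rintro m ⟨h1, h2⟩
    rw [Equiv.swap_apply_of_ne_of_ne h1 h2, sub_self]

/-- Exchanging two coordinates lowers the density where the coordinate with the larger variance is
larger in absolute value. -/
lemma mul_density_sub_swap (hl : ∀ i, 0 < l i) {i j : Fin p} (hij : l j < l i) (y : Fin p → ℝ) :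
    0 ≤ (y i ^ 2 - y j ^ 2) *
      (normalProductDensity l y - normalProductDensity l fun m => y (Equiv.swap i j m)) ∧
    ((y i ^ 2 - y j ^ 2) *
      (normalProductDensity l y - normalProductDensity l fun m => y (Equiv.swap i j m)) = 0 →
        y i ^ 2 = y j ^ 2) := by
  obtain ⟨C, hC, hf⟩ := normalProductDensity_eq hl
  have hne : i ≠ j := fun h => by simp [h] at hij
  have hκ : 0 < 1 / (2 * l j) - 1 / (2 * l i) :=
    sub_pos.2 (one_div_lt_one_div_of_lt (by linarith [hl j]) (by linarith))
  have hs := sum_sq_swap_sub (l := l) y hne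
  simp only [hf]
  rcases lt_trichotomy (y i ^ 2) (y j ^ 2) with h | h | h
  · have h1 : Real.exp (-∑ m, y m ^ 2 / (2 * l m)) <
        Real.exp (-∑ m, y (Equiv.swap i j m) ^ 2 / (2 * l m)) :=
      Real.exp_lt_exp.2 (by nlinarith)
    have h2 := mul_lt_mul_of_pos_left h1 hC
    have h3 := mul_pos_of_neg_of_neg (sub_neg.2 h) (sub_neg.2 h2)
    exact ⟨h3.le, fun h0 => absurd h0 h3.ne'⟩
  · simp [h]
  · have h1 : Real.exp (-∑ m, y (Equiv.swap i j m) ^ 2 / (2 * l m)) <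
        Real.exp (-∑ m, y m ^ 2 / (2 * l m)) :=
      Real.exp_lt_exp.2 (by nlinarith)
    have h2 := mul_lt_mul_of_pos_left h1 hC
    have h3 := mul_pos (sub_pos.2 h) (sub_pos.2 h2)
    exact ⟨h3.le, fun h0 => absurd h0 h3.ne'⟩

lemma measurePreserving_swap (i j : Fin p) :
    MeasurePreserving (fun (y : Fin p → ℝ) m => y (Equiv.swap i j m)) volume volume := by
  have := volume_measurePreserving_piCongrLeft (fun _ : Fin p => ℝ) (Equiv.swap i j)
  convert! this using 1
  ext y m
  obtain ⟨n, rfl⟩ := (Equiv.swap i j).surjective m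
  rw [MeasurableEquiv.coe_piCongrLeft, Equiv.piCongrLeft_apply_apply, Equiv.swap_apply_self]

lemma integral_normalProduct (hl : ∀ i, 0 < l i) (h : (Fin p → ℝ) → ℝ) :
    ∫ y, h y ∂normalProduct l = ∫ y, normalProductDensity l y * h y := by
  rw [normalProduct_eq_withDensity hl, integral_withDensity_eq_integral_toReal_smul
    measurable_normalProductDensity.ennreal_ofReal (by simp)]
  simp only [ENNReal.toReal_ofReal (normalProductDensity_nonneg _), smul_eq_mul]

lemma integrable_normalProduct_iff (hl : ∀ i, 0 < l i) (h : (Fin p → ℝ) → ℝ) :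
    Integrable h (normalProduct l) ↔ Integrable fun y => normalProductDensity l y * h y := by
  rw [normalProduct_eq_withDensity hl, integrable_withDensity_iff_integrable_smul'
    measurable_normalProductDensity.ennreal_ofReal (by simp)]
  simp only [ENNReal.toReal_ofReal (normalProductDensity_nonneg _), smul_eq_mul]

/-- Weighted second moments of a product of normal distributions, for a weight that is invariant
under exchange of the coordinates, are ordered as the variances. -/
lemma integral_mul_sq_lt (hl : ∀ i, 0 < l i) {i j : Fin p} (hij : l j < l i)
    {W : (Fin p → ℝ) → ℝ} (hW0 : ∀ y, 0 ≤ W y)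
    (hW : ∀ y, W (fun m => y (Equiv.swap i j m)) = W y)
    (hi : Integrable (fun y => W y * y i ^ 2) (normalProduct l))
    (hj : Integrable (fun y => W y * y j ^ 2) (normalProduct l))
    (hne : ¬ ∀ᵐ y ∂normalProduct l, W y = 0 ∨ y i ^ 2 = y j ^ 2) :
    ∫ y, W y * y j ^ 2 ∂normalProduct l < ∫ y, W y * y i ^ 2 ∂normalProduct l := by
  set D : (Fin p → ℝ) → ℝ := fun y =>
    normalProductDensity l y * (W y * y i ^ 2 - W y * y j ^ 2) with hD
  have hDi : Integrable D := (integrable_normalProduct_iff hl _).1 (hi.sub hj)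
  have hmp := measurePreserving_swap i j
  have hinv : Function.Involutive fun (y : Fin p → ℝ) m => y (Equiv.swap i j m) := fun y => by
    ext m
    simp
  have hemb := (MeasurableEquiv.ofInvolutive _ hinv hmp.measurable).measurableEmbedding
  have hDs : Integrable fun y : Fin p → ℝ => D fun m => y (Equiv.swap i j m) :=
    (hmp.integrable_comp_emb hemb).2 hDi
  have e1 : ∫ y, D y = ∫ y, W y * y i ^ 2 ∂normalProduct l - ∫ y, W y * y j ^ 2 ∂normalProduct l := by
    rw [← integral_sub hi hj, integral_normalProduct hl]
  have e2 : ∫ y : Fin p → ℝ, D (fun m => y (Equiv.swap i j m)) = ∫ y, D y :=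
    hmp.integral_comp hemb D
  -- Symmetrizing over the swap makes the integrand non-negative, and its integral is twice the
  -- difference of the two moments.
  have e3 : ∀ y, D y + D (fun m => y (Equiv.swap i j m)) = W y * ((y i ^ 2 - y j ^ 2) *
      (normalProductDensity l y - normalProductDensity l fun m => y (Equiv.swap i j m))) := by
    intro y
    simp only [hD, hW, Equiv.swap_apply_left, Equiv.swap_apply_right]
    ring
  have hnn : ∀ y, 0 ≤ D y + D (fun m => y (Equiv.swap i j m)) := fun y => by
    rw [e3]
    exact mul_nonneg (hW0 y) (mul_density_sub_swap hl hij y).1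
  have e4 := integral_add hDi hDs
  rw [e2, e1] at e4
  have h5 : 0 ≤ ∫ y, D y + D (fun m => y (Equiv.swap i j m)) := integral_nonneg hnn
  refine lt_of_le_of_ne (by linarith) fun heq => hne ?_
  have h6 : ∫ y, D y + D (fun m => y (Equiv.swap i j m)) = 0 := by linarith
  have h7 := (integral_eq_zero_iff_of_nonneg hnn (hDi.add hDs)).1 h6
  have hac : normalProduct l ≪ volume := by
    rw [normalProduct_eq_withDensity hl]
    exact withDensity_absolutelyContinuous _ _
  refine hac.ae_le ?_
  filter_upwards [h7] with y hy
  rw [Pi.zero_apply, e3] at hy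
  exact (mul_eq_zero.1 hy).imp_right (mul_density_sub_swap hl hij y).2

/-- Weighted mixed moments vanish, for a weight that is invariant under a change of sign. -/
lemma integral_mul_mul_eq_zero {i j : Fin p} (hij : i ≠ j) {W : (Fin p → ℝ) → ℝ}
    (hW : ∀ y, W (fun m => if m = i then -y m else y m) = W y) :
    ∫ y, W y * (y i * y j) ∂normalProduct l = 0 := by
  have hmp : MeasurePreserving (fun (y : Fin p → ℝ) m => if m = i then -y m else y m)
      (normalProduct l) (normalProduct l) := by
    have := measurePreserving_pi (fun i => gaussianReal 0 (l i).toNNReal)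
      (fun i => gaussianReal 0 (l i).toNNReal) (f := fun m (t : ℝ) => if m = i then -t else t)
      fun m => by
        by_cases hm : m = i
        · simp only [hm, if_true]
          refine ⟨measurable_neg, ?_⟩
          have := gaussianReal_map_neg (μ := 0) (v := (l i).toNNReal)
          rwa [neg_zero] at this
        · simp only [hm, if_false]
          exact MeasurePreserving.id _
    exact this
  have hinv : Function.Involutive fun (y : Fin p → ℝ) m => if m = i then -y m else y m := by
    intro y
    ext m
    by_cases hm : m = i <;> simp [hm]
  have hemb := (MeasurableEquiv.ofInvolutive _ hinv hmp.measurable).measurableEmbedding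
  have h := hmp.integral_comp hemb fun y => W y * (y i * y j)
  simp only [hW, if_true, hij.symm, if_false] at h
  have e : ∀ y : Fin p → ℝ, W y * (-y i * y j) = -(W y * (y i * y j)) := fun y => by ring
  simp only [e, integral_neg] at h
  linarith

end NormalProduct

/-! ### Elliptical normal distributions and their generalized spatial sign covariance matrix -/

section Elliptical

variable {p : ℕ} {H : Measure (EuclideanSpace ℝ (Fin p))} {A : Matrix (Fin p) (Fin p) ℝ}
  {u : Fin p → EuclideanSpace ℝ (Fin p)} {l : Fin p → ℝ}

open IsOrderedEigenbasis

lemma IsOrderedEigenbasis.quadratic_eq (hu : IsOrderedEigenbasis A u l)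
    (a : EuclideanSpace ℝ (Fin p)) :
    a.ofLp ⬝ᵥ A.mulVec a.ofLp = ∑ i, l i * inner ℝ (u i) a ^ 2 := by
  rw [hu.dotProduct_mulVec_eq]
  simp only [pow_two]

lemma IsOrderedEigenbasis.eigenvalue_pos (hu : IsOrderedEigenbasis A u l) (hA : A.PosDef)
    (i : Fin p) : 0 < l i := by
  have hne : (u i).ofLp ≠ 0 := fun h => by
    have h1 : u i = 0 := by
      ext j
      simp [h]
    have h2 := hu.1.1 i
    rw [h1, norm_zero] at h2
    exact zero_ne_one h2
  have h := hA.dotProduct_mulVec_pos hne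
  rw [star_trivial, hu.quadratic_eq, Finset.sum_eq_single i] at h
  · rw [real_inner_self_eq_norm_sq, hu.1.1] at h
    simpa using h
  · intro j _ hj
    rw [hu.1.2 hj]
    ring
  · simp

/-- The coordinates with respect to an orthonormal basis. -/
def basisCoordinates (u : Fin p → EuclideanSpace ℝ (Fin p)) (x : EuclideanSpace ℝ (Fin p)) :
    Fin p → ℝ := fun i => inner ℝ (u i) x

lemma measurable_basisCoordinates : Measurable (basisCoordinates u) :=
  measurable_pi_lambda _ fun i => by unfold basisCoordinates; fun_prop

lemma map_inner_eq (hu : IsOrderedEigenbasis A u l) (hH : HasProjectedLaw H A (gaussianReal 0 1))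
    (a : EuclideanSpace ℝ (Fin p)) :
    H.map (fun x => inner ℝ a x) =
      stdNormal.map fun t => Real.sqrt (∑ i, l i * inner ℝ (u i) a ^ 2) * t := by
  rw [hH a, hu.quadratic_eq]

lemma ae_inner_ne_zero (hu : IsOrderedEigenbasis A u l) (hl : ∀ i, 0 < l i)
    (hH : HasProjectedLaw H A (gaussianReal 0 1)) {a : EuclideanSpace ℝ (Fin p)} {i : Fin p}
    (ha : inner ℝ (u i) a ≠ 0) : ∀ᵐ x ∂H, inner ℝ a x ≠ 0 := by
  have hs : 0 < ∑ i, l i * inner ℝ (u i) a ^ 2 :=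
    Finset.sum_pos' (fun j _ => mul_nonneg (hl j).le (sq_nonneg _))
      ⟨i, Finset.mem_univ i, mul_pos (hl i) (by positivity)⟩
  have h1 : ∀ᵐ t ∂(H.map fun x => inner ℝ a x), t ≠ 0 := by
    rw [map_inner_eq hu hH]
    refine (ae_map_iff (p := fun t => t ≠ 0) (by fun_prop)
      (measurableSet_singleton (0 : ℝ)).compl).2 ?_
    filter_upwards [ae_stdNormal_ne 0] with t ht
    exact mul_ne_zero (Real.sqrt_pos.2 hs).ne' ht
  exact ae_of_ae_map (f := fun x => inner ℝ a x) (p := fun t => t ≠ 0) (by fun_prop) h1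

variable [IsProbabilityMeasure H]

/-- The Cramér–Wold argument: the characteristic function at t is that of the projection on ∑ tᵢ uᵢ,
a normal law with variance ∑ lᵢ tᵢ², and therefore factors. -/
lemma map_basisCoordinates (hu : IsOrderedEigenbasis A u l) (hl : ∀ i, 0 < l i)
    (hH : HasProjectedLaw H A (gaussianReal 0 1)) :
    H.map (basisCoordinates u) = normalProduct l := by
  have hm := measurable_basisCoordinates (u := u)
  have : IsProbabilityMeasure (H.map (basisCoordinates u)) :=
    Measure.isProbabilityMeasure_map hm.aemeasurable
  refine charFun_eq_pi_iff.1 fun t => ?_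
  set a : EuclideanSpace ℝ (Fin p) := ∑ i, t i • u i with ha
  have hcoef : ∀ i, inner ℝ (u i) a = t i := fun i => by
    rw [ha, hu.1.inner_right_fintype]
  have e1 : charFun ((H.map (basisCoordinates u)).map (WithLp.toLp 2)) t
      = charFun (H.map fun x => inner ℝ a x) 1 := by
    rw [charFun_apply, charFun_apply_real, integral_map (by fun_prop) (by fun_prop),
      integral_map (by fun_prop) (by fun_prop), integral_map (by fun_prop) (by fun_prop)]
    refine integral_congr_ae (ae_of_all _ fun x => ?_)
    have : inner ℝ (WithLp.toLp 2 (basisCoordinates u x)) t = inner ℝ a x := by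
      rw [ha, sum_inner, PiLp.inner_apply]
      refine Finset.sum_congr rfl fun i _ => ?_
      rw [real_inner_smul_left]
      simp [basisCoordinates]
    simp [this]
  have hs : 0 ≤ ∑ i, l i * t i ^ 2 :=
    Finset.sum_nonneg fun i _ => mul_nonneg (hl i).le (sq_nonneg _)
  rw [e1, map_inner_eq hu hH, stdNormal_map_mul, charFun_gaussianReal]
  simp_rw [hcoef, charFun_gaussianReal]
  rw [Real.sq_sqrt hs, ← Complex.exp_sum, Real.coe_toNNReal _ hs]
  congr 1
  simp only [Real.coe_toNNReal _ (hl _).le]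
  push_cast
  simp [Finset.sum_div]

lemma norm_eq_sqrt_sum_basisCoordinates (hu : Orthonormal ℝ u) (x : EuclideanSpace ℝ (Fin p)) :
    ‖x‖ = Real.sqrt (∑ i, basisCoordinates u x i ^ 2) := by
  unfold basisCoordinates
  rw [sum_inner_sq hu, Real.sqrt_sq (norm_nonneg x)]

variable {T : Measure (EuclideanSpace ℝ (Fin p)) → EuclideanSpace ℝ (Fin p)}
  {ξ : Measure (EuclideanSpace ℝ (Fin p)) → ℝ → ℝ}

/-- At a centered normal distribution, the generalized spatial sign covariance matrix has the same
eigenvectors as the scatter matrix, in the same order, with distinct eigenvalues. -/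
lemma exists_eigenbasis_gsscm (hu : IsOrderedEigenbasis A u l) (hpos : ∀ i, 0 < l i)
    (hl : StrictAnti l) (hH : HasProjectedLaw H A (gaussianReal 0 1)) (hT : T H = 0)
    (hξ : Measurable (ξ H))
    (hξ0 : ¬ (fun x : EuclideanSpace ℝ (Fin p) => ξ H ‖x‖) =ᵐ[H] 0)
    (hξ2 : Integrable (fun x => ‖generalizedSign T ξ H x‖ ^ 2) H) :
    ∃ γ, StrictAnti γ ∧ IsOrderedEigenbasis (gsscm T ξ H) u γ := by
  -- Being radial, the weight is invariant under sign changes and permutations of the coordinates.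
  set W : (Fin p → ℝ) → ℝ := fun y => ξ H (Real.sqrt (∑ i, y i ^ 2)) ^ 2 with hWdef
  have hYm := measurable_basisCoordinates (u := u)
  have hlaw := map_basisCoordinates hu hpos hH
  have hWm : Measurable W := by
    have : Measurable fun y : Fin p → ℝ => Real.sqrt (∑ i, y i ^ 2) := by fun_prop
    exact (hξ.comp this).pow_const 2
  have hg : ∀ x, generalizedSign T ξ H x = ξ H ‖x‖ • x := fun x => by
    rw [generalizedSign, hT, sub_zero]
  have hgm : Measurable (generalizedSign T ξ H) := by
    have : generalizedSign T ξ H = fun x => ξ H ‖x‖ • x := funext hg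
    rw [this]
    exact (hξ.comp measurable_norm).smul measurable_id
  have hprod : ∀ i j x, inner ℝ (u i) (generalizedSign T ξ H x) *
      inner ℝ (u j) (generalizedSign T ξ H x) =
        W (basisCoordinates u x) * (basisCoordinates u x i * basisCoordinates u x j) := by
    intro i j x
    rw [hg, real_inner_smul_right, real_inner_smul_right, hWdef]
    simp only [← norm_eq_sqrt_sum_basisCoordinates hu.1 x]
    simp only [basisCoordinates]
    ring
  have hgint : ∀ a b : EuclideanSpace ℝ (Fin p), Integrable (fun x =>
      inner ℝ a (generalizedSign T ξ H x) * inner ℝ b (generalizedSign T ξ H x)) H := by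
    intro a b
    refine (hξ2.const_mul (‖a‖ * ‖b‖)).mono' (by fun_prop) (ae_of_all _ fun x => ?_)
    rw [norm_mul]
    calc _ ≤ (‖a‖ * ‖generalizedSign T ξ H x‖) * (‖b‖ * ‖generalizedSign T ξ H x‖) :=
          mul_le_mul (norm_inner_le_norm _ _) (norm_inner_le_norm _ _) (norm_nonneg _)
            (by positivity)
      _ = _ := by ring
  set γ : Fin p → ℝ := fun i => ∫ x, inner ℝ (u i) (generalizedSign T ξ H x) *
    inner ℝ (u i) (generalizedSign T ξ H x) ∂H with hγ
  have hmom : ∀ i j, ∫ x, inner ℝ (u i) (generalizedSign T ξ H x) *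
      inner ℝ (u j) (generalizedSign T ξ H x) ∂H = ∫ y, W y * (y i * y j) ∂normalProduct l := by
    intro i j
    simp_rw [hprod]
    rw [← hlaw, integral_map hYm.aemeasurable
      (Measurable.aestronglyMeasurable (by fun_prop))]
  have hsq : ∀ i, Integrable (fun y => W y * y i ^ 2) (normalProduct l) := fun i => by
    rw [← hlaw, integrable_map_measure (Measurable.aestronglyMeasurable (by fun_prop))
      hYm.aemeasurable]
    refine (hgint (u i) (u i)).congr (ae_of_all _ fun x => ?_)
    simp only [hprod, Function.comp_apply]
    ring
  have hγanti : StrictAnti γ := by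
    intro i j hij
    have hlt := hl hij
    have hγ' : ∀ m, γ m = ∫ y, W y * y m ^ 2 ∂normalProduct l := fun m => by
      rw [hγ]
      simp only [pow_two]
      exact hmom m m
    rw [hγ', hγ']
    refine integral_mul_sq_lt hpos hlt (fun y => sq_nonneg _) (fun y => ?_) (hsq i) (hsq j) ?_
    · simp only [hWdef]
      rw [Equiv.sum_comp (Equiv.swap i j) fun m => y m ^ 2]
    · intro hall
      rw [← hlaw] at hall
      have h1 := ae_of_ae_map hYm.aemeasurable hall
      -- The set yᵢ² = yⱼ² is a union of two hyperplanes, both null, so strictness fails only if the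
      -- radial function vanishes almost surely.
      have h2 : ∀ᵐ x ∂H, inner ℝ (u i - u j) x ≠ 0 :=
        ae_inner_ne_zero (i := i) hu hpos hH (by
          rw [inner_sub_right, hu.1.2 hij.ne, real_inner_self_eq_norm_sq, hu.1.1]
          norm_num)
      have h3 : ∀ᵐ x ∂H, inner ℝ (u i + u j) x ≠ 0 :=
        ae_inner_ne_zero (i := i) hu hpos hH (by
          rw [inner_add_right, hu.1.2 hij.ne, real_inner_self_eq_norm_sq, hu.1.1]
          norm_num)
      refine hξ0 ?_
      filter_upwards [h1, h2, h3] with x hx1 hx2 hx3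
      rcases hx1 with h | h
      · simp only [hWdef, ← norm_eq_sqrt_sum_basisCoordinates hu.1 x] at h
        exact pow_eq_zero_iff two_ne_zero |>.1 h
      · rw [inner_sub_left] at hx2
        rw [inner_add_left] at hx3
        simp only [basisCoordinates] at h
        exact absurd h (fun h => mul_ne_zero hx2 hx3 (by linarith))
  refine ⟨γ, hγanti, hu.1, hγanti.antitone, fun j => ?_⟩
  ext i
  have hoff : ∀ n, n ≠ j → ∫ x, inner ℝ (u n) (generalizedSign T ξ H x) *
      inner ℝ (u j) (generalizedSign T ξ H x) ∂H = 0 := fun n hn => by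
    rw [hmom]
    refine integral_mul_mul_eq_zero hn fun y => ?_
    simp only [hWdef]
    congr 3
    refine Finset.sum_congr rfl fun m _ => ?_
    by_cases hm : m = n <;> simp [hm]
  have hcoord : ∀ x : EuclideanSpace ℝ (Fin p), ∀ m, x m = inner ℝ (EuclideanSpace.single m 1) x :=
    fun x m => by simp [EuclideanSpace.inner_single_left]
  have hgij : ∀ m n, Integrable
      (fun x => generalizedSign T ξ H x m * generalizedSign T ξ H x n) H := fun m n => by
    simp only [hcoord]
    exact hgint _ _
  have e1 : (gsscm T ξ H).mulVec (u j).ofLp i =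
      ∫ x, generalizedSign T ξ H x i * inner ℝ (u j) (generalizedSign T ξ H x) ∂H := by
    simp only [Matrix.mulVec, dotProduct, gsscm, Matrix.of_apply]
    simp_rw [← integral_mul_const]
    rw [← integral_finsetSum _ fun m _ => (hgij i m).mul_const _]
    refine integral_congr_ae (ae_of_all _ fun x => ?_)
    simp only [PiLp.inner_apply, Finset.mul_sum, RCLike.inner_apply, conj_trivial]
    refine Finset.sum_congr rfl fun m _ => ?_
    ring
  have e2 : ∀ x, generalizedSign T ξ H x i * inner ℝ (u j) (generalizedSign T ξ H x) =
      ∑ n, (u n) i * (inner ℝ (u n) (generalizedSign T ξ H x) *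
        inner ℝ (u j) (generalizedSign T ξ H x)) := by
    intro x
    have h1 : generalizedSign T ξ H x i =
        ∑ n, inner ℝ (u n) (generalizedSign T ξ H x) * (u n) i := by
      conv_lhs => rw [← sum_inner_smul hu.1 (generalizedSign T ξ H x)]
      simp
    rw [h1, Finset.sum_mul]
    refine Finset.sum_congr rfl fun n _ => ?_
    ring
  rw [e1]
  simp_rw [e2]
  rw [integral_finsetSum _ fun n _ => (hgint _ _).const_mul _, Finset.sum_eq_single j]
  · rw [integral_const_mul, Pi.smul_apply, smul_eq_mul, mul_comm]
  · intro n _ hn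
    rw [integral_const_mul, hoff n hn, mul_zero]
  · simp

end Elliptical

/-! ### The corrected eigenvalues -/

/-- From (στ)² - c = σ²(τ² - 1) + (σ² - c), where the last term is o(ε). Squaring produces the
factor 2c; positivity of τ is needed to recover τ → 1 from τ² → 1. -/
lemma tendsto_sq_slope_iff {σ τ : ℝ → ℝ} {c y : ℝ} (hc : 0 < c)
    (hσ : Tendsto (fun ε => (σ ε ^ 2 - c) / ε) (𝓝[>] 0) (𝓝 0))
    (hτ : ∀ᶠ ε in 𝓝[>] (0 : ℝ), 0 < τ ε) :
    Tendsto (fun ε => ((σ ε * τ ε) ^ 2 - c) / ε) (𝓝[>] 0) (𝓝 (2 * c * y)) ↔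
      Tendsto (fun ε => (τ ε - 1) / ε) (𝓝[>] 0) (𝓝 y) := by
  have hid : Tendsto (fun ε : ℝ => ε) (𝓝[>] 0) (𝓝 0) := tendsto_id.mono_left nhdsWithin_le_nhds
  have key : ∀ {f : ℝ → ℝ} {a b : ℝ}, Tendsto (fun ε => (f ε - a) / ε) (𝓝[>] 0) (𝓝 b) →
      Tendsto f (𝓝[>] 0) (𝓝 a) := by
    intro f a b h
    have h1 := (h.mul hid).add_const a
    rw [mul_zero, zero_add] at h1
    refine h1.congr' ?_
    filter_upwards [self_mem_nhdsWithin] with ε (hε : 0 < ε)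
    field_simp
    ring
  have hσ' := key hσ
  constructor
  · intro h
    have h1 := key h
    have h2 : Tendsto (fun ε => τ ε ^ 2) (𝓝[>] 0) (𝓝 1) := by
      have h3 := h1.div hσ' hc.ne'
      rw [div_self hc.ne'] at h3
      refine h3.congr' ?_
      filter_upwards [hσ'.eventually (lt_mem_nhds hc)] with ε hε
      have : σ ε ≠ 0 := fun h => by simp [h] at hε
      change (σ ε * τ ε) ^ 2 / σ ε ^ 2 = τ ε ^ 2
      field_simp
    have h3 : Tendsto τ (𝓝[>] 0) (𝓝 1) := by
      have h4 := h2.sqrt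
      rw [Real.sqrt_one] at h4
      refine h4.congr' ?_
      filter_upwards [hτ] with ε hε
      exact Real.sqrt_sq hε.le
    have h4 := (h.sub hσ).div (hσ'.mul (h3.add_const 1)) (by positivity)
    rw [show (2 * c * y - 0) / (c * (1 + 1)) = y by field_simp; ring] at h4
    refine h4.congr' ?_
    filter_upwards [self_mem_nhdsWithin, hσ'.eventually (lt_mem_nhds hc), hτ]
      with ε (hε : 0 < ε) h5 h6
    have : σ ε ≠ 0 := fun h => by simp [h] at h5
    have h7 : τ ε + 1 ≠ 0 := by linarith
    change (((σ ε * τ ε) ^ 2 - c) / ε - (σ ε ^ 2 - c) / ε) / (σ ε ^ 2 * (τ ε + 1)) = (τ ε - 1) / ε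
    field_simp
    ring
  · intro h
    have h4 := (h.mul (hσ'.mul ((key h).add_const 1))).add hσ
    rw [show y * (c * (1 + 1)) + 0 = 2 * c * y by ring] at h4
    refine h4.congr' ?_
    filter_upwards [self_mem_nhdsWithin] with ε (hε : 0 < ε)
    field_simp
    ring

section Eigenvalue

variable {p : ℕ} {H : Measure (EuclideanSpace ℝ (Fin p))} [IsProbabilityMeasure H]
  {A : Matrix (Fin p) (Fin p) ℝ} {u : Fin p → EuclideanSpace ℝ (Fin p)} {l : Fin p → ℝ}
  {v : Measure (EuclideanSpace ℝ (Fin p)) → Fin p → EuclideanSpace ℝ (Fin p)}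

open IsOrderedEigenbasis

/-- A unit vector whose components across `u k` are of first order has, up to second order,
the variance `l k`. -/
lemma tendsto_variance (hu : Orthonormal ℝ u) {a : ℝ → EuclideanSpace ℝ (Fin p)} {k : Fin p}
    (ha : ∀ᶠ ε in 𝓝[>] (0 : ℝ), ‖a ε‖ = 1) {K : ℝ}
    (hK : ∀ᶠ ε in 𝓝[>] (0 : ℝ), ∀ i, i ≠ k → |inner ℝ (u i) (a ε)| ≤ K * ε) :
    Tendsto (fun ε => ((∑ i, l i * inner ℝ (u i) (a ε) ^ 2) - l k) / ε) (𝓝[>] 0) (𝓝 0) := by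
  have hid : Tendsto (fun ε : ℝ => ε) (𝓝[>] 0) (𝓝 0) := tendsto_id.mono_left nhdsWithin_le_nhds
  have hlim : Tendsto (fun ε : ℝ => (∑ i, |l i - l k|) * K ^ 2 * ε) (𝓝[>] 0) (𝓝 0) := by
    simpa using hid.const_mul ((∑ i, |l i - l k|) * K ^ 2)
  refine squeeze_zero_norm' ?_ hlim
  filter_upwards [ha, hK, self_mem_nhdsWithin] with ε h1 h2 (hε : 0 < ε)
  -- The unit norm removes the k-th term, and the other terms are squares of quantities of order ε.
  have e : (∑ i, l i * inner ℝ (u i) (a ε) ^ 2) - l k =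
      ∑ i, (l i - l k) * inner ℝ (u i) (a ε) ^ 2 := by
    simp_rw [sub_mul]
    rw [Finset.sum_sub_distrib, ← Finset.mul_sum, sum_inner_sq hu, h1]
    ring
  rw [e, Real.norm_eq_abs, abs_div, abs_of_pos hε, div_le_iff₀ hε]
  refine (Finset.abs_sum_le_sum_abs _ _).trans ?_
  rw [show (∑ i, |l i - l k|) * K ^ 2 * ε * ε = ∑ i, |l i - l k| * (K * ε) ^ 2 by
    rw [← Finset.sum_mul]; ring]
  refine Finset.sum_le_sum fun i _ => ?_
  rw [abs_mul, abs_pow]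
  by_cases hik : i = k
  · simp [hik]
  · exact mul_le_mul_of_nonneg_left (pow_le_pow_left₀ (abs_nonneg _) (h2 i hik) 2) (abs_nonneg _)

/-- The sign of an eigenvector may jump with ε, so only absolute values converge; this is enough for
even scores. -/
lemma tendsto_abs_inner (hu : Orthonormal ℝ u) {a : ℝ → EuclideanSpace ℝ (Fin p)} {k : Fin p}
    (ha : ∀ᶠ ε in 𝓝[>] (0 : ℝ), ‖a ε‖ = 1) {K : ℝ}
    (hK : ∀ᶠ ε in 𝓝[>] (0 : ℝ), ∀ i, i ≠ k → |inner ℝ (u i) (a ε)| ≤ K * ε)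
    (x : EuclideanSpace ℝ (Fin p)) :
    Tendsto (fun ε => |inner ℝ (a ε) x|) (𝓝[>] 0) (𝓝 |inner ℝ (u k) x|) := by
  have hid : Tendsto (fun ε : ℝ => ε) (𝓝[>] 0) (𝓝 0) := tendsto_id.mono_left nhdsWithin_le_nhds
  have hsmall : ∀ i, i ≠ k → Tendsto (fun ε => inner ℝ (u i) (a ε)) (𝓝[>] 0) (𝓝 0) := by
    intro i hi
    refine squeeze_zero_norm' (a := fun ε => K * ε) ?_ (by simpa using hid.const_mul K)
    filter_upwards [hK] with ε h
    exact h i hi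
  have hk : Tendsto (fun ε => |inner ℝ (u k) (a ε)|) (𝓝[>] 0) (𝓝 1) := by
    have h1 : Tendsto (fun ε => 1 - ∑ i ∈ Finset.univ.erase k, inner ℝ (u i) (a ε) ^ 2) (𝓝[>] 0)
        (𝓝 (1 - ∑ i ∈ Finset.univ.erase k, (0 : ℝ) ^ 2)) :=
      (tendsto_finsetSum _ fun i hi => (hsmall i (Finset.ne_of_mem_erase hi)).pow 2).const_sub 1
    have h2 := h1.sqrt
    simp only [ne_eq, OfNat.ofNat_ne_zero, not_false_eq_true, zero_pow, Finset.sum_const_zero,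
      sub_zero, Real.sqrt_one] at h2
    refine h2.congr' ?_
    filter_upwards [ha] with ε h3
    have h4 := sum_inner_sq hu (a ε)
    rw [h3, ← Finset.add_sum_erase _ _ (Finset.mem_univ k)] at h4
    rw [← Real.sqrt_sq_eq_abs]
    congr 1
    linarith
  have hexp : ∀ ε, inner ℝ (a ε) x = ∑ i, inner ℝ (u i) (a ε) * inner ℝ (u i) x := by
    intro ε
    conv_lhs => rw [← sum_inner_smul hu (a ε)]
    rw [sum_inner]
    simp_rw [real_inner_smul_left]
  have hdiff : Tendsto (fun ε => inner ℝ (a ε) x - inner ℝ (u k) (a ε) * inner ℝ (u k) x)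
      (𝓝[>] 0) (𝓝 0) := by
    have h1 : Tendsto (fun ε => ∑ i ∈ Finset.univ.erase k,
        inner ℝ (u i) (a ε) * inner ℝ (u i) x) (𝓝[>] 0)
        (𝓝 (∑ i ∈ Finset.univ.erase k, 0 * inner ℝ (u i) x)) :=
      tendsto_finsetSum _ fun i hi => (hsmall i (Finset.ne_of_mem_erase hi)).mul_const _
    simp only [zero_mul, Finset.sum_const_zero] at h1
    refine h1.congr fun ε => ?_
    rw [hexp, ← Finset.add_sum_erase _ _ (Finset.mem_univ k)]
    ring
  have hmain := hk.mul_const |inner ℝ (u k) x|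
  rw [one_mul] at hmain
  have h0 : Tendsto (fun ε => |inner ℝ (a ε) x| - |inner ℝ (u k) (a ε)| * |inner ℝ (u k) x|)
      (𝓝[>] 0) (𝓝 0) := by
    refine squeeze_zero_norm (fun ε => ?_) (tendsto_zero_iff_norm_tendsto_zero.1 hdiff)
    rw [← abs_mul]
    exact abs_abs_sub_abs_le_abs_sub _ _
  simpa using h0.add hmain

lemma isScaleLike_correctedEigenvalue (hA : A.PosDef) (hu : IsOrderedEigenbasis A u l)
    (hl : StrictAnti l) (hH : HasProjectedLaw H A (gaussianReal 0 1))
    {T : Measure (EuclideanSpace ℝ (Fin p)) → EuclideanSpace ℝ (Fin p)} (hT : T H = 0)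
    {ξ : Measure (EuclideanSpace ℝ (Fin p)) → ℝ → ℝ} (hξ : Measurable (ξ H))
    (hξ0 : ¬ (fun x : EuclideanSpace ℝ (Fin p) => ξ H ‖x‖) =ᵐ[H] 0)
    (hξ2 : Integrable (fun x => ‖generalizedSign T ξ H x‖ ^ 2) H)
    (hreg : ∀ x i j, (fun ε : ℝ => gsscm T ξ (contaminated H x ε) i j - gsscm T ξ H i j)
      =O[𝓝[>] 0] (fun ε : ℝ => ε))
    (hv : IsGSPCA T ξ v) (k : Fin p) :
    IsScaleLike (correctedEigenvalue v k) H (2 * l k)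
      (fun x => inner ℝ (u k) x / Real.sqrt (l k)) := by
  have hpos := hu.eigenvalue_pos hA
  have hlk := hpos k
  have hsk : 0 < Real.sqrt (l k) := Real.sqrt_pos.2 hlk
  obtain ⟨γ, hγ, hG⟩ := exists_eigenbasis_gsscm hu hpos hl hH hT hξ hξ0 hξ2
  have hself : ∑ i, l i * inner ℝ (u i) (u k) ^ 2 = l k := by
    rw [Finset.sum_eq_single k]
    · rw [real_inner_self_eq_norm_sq, hu.1.1]
      ring
    · intro i _ hi
      rw [hu.1.2 hi]
      ring
    · simp
  -- The selected eigenvector at H is u k up to sign, so its projection has variance l k.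
  have hmodel : ∀ S : Measure ℝ → ℝ, FisherConsistent S → correctedEigenvalue v k S H = l k := by
    intro S hS
    obtain ⟨μ, hμ⟩ := hv H inferInstance
    have h1 : ∑ i, l i * inner ℝ (u i) (v H k) ^ 2 = l k := by
      have h2 := sum_inner_sq hu.1 (v H k)
      rw [hμ.1.1, Finset.sum_eq_single k] at h2
      · rw [Finset.sum_eq_single k]
        · rw [h2]
          ring
        · intro i _ hi
          rw [hG.inner_eq_zero hμ hγ hi]
          ring
        · simp
      · intro i _ hi
        rw [hG.inner_eq_zero hμ hγ hi]
        ring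
      · simp
    rw [correctedEigenvalue, map_inner_eq hu hH, h1, stdNormal_map_mul, hS _ hsk,
      Real.sq_sqrt hlk.le]
  refine ⟨by positivity, by fun_prop, fun t => ⟨(t * Real.sqrt (l k)) • u k, ?_⟩, ?_, fun x => ?_⟩
  · simp only [real_inner_smul_right, real_inner_self_eq_norm_sq, hu.1.1]
    field_simp
  · have e : (fun x => inner ℝ (u k) x / Real.sqrt (l k)) =
        (fun t => t / Real.sqrt (l k)) ∘ fun x => inner ℝ (u k) x := rfl
    rw [e, ← Measure.map_map (by fun_prop) (by fun_prop), map_inner_eq hu hH, hself,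
      Measure.map_map (by fun_prop) (by fun_prop)]
    have e2 : (fun t => t / Real.sqrt (l k)) ∘ (fun t => Real.sqrt (l k) * t) = id := by
      ext t
      simp [hsk.ne']
    rw [e2, Measure.map_id]
  · set F : ℝ → Measure (EuclideanSpace ℝ (Fin p)) := fun ε => contaminated H x ε with hF
    set a : ℝ → EuclideanSpace ℝ (Fin p) := fun ε => v (F ε) k with ha
    have hbasis : ∀ᶠ ε in 𝓝[>] (0 : ℝ), ∃ μ,
        IsOrderedEigenbasis (gsscm T ξ (F ε)) (v (F ε)) μ := by
      filter_upwards [eventually_mem_Ioo] with ε h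
      exact hv _ (isProbabilityMeasure_contaminated H x h.1.le h.2.le)
    obtain ⟨K, hK⟩ := hG.eventually_abs_inner_le hγ hbasis (hreg x) k
    have ha1 : ∀ᶠ ε in 𝓝[>] (0 : ℝ), ‖a ε‖ = 1 := hbasis.mono fun ε ⟨μ, hμ⟩ => hμ.1.1 k
    set q : ℝ → ℝ := fun ε => ∑ i, l i * inner ℝ (u i) (a ε) ^ 2 with hq
    have hvar : Tendsto (fun ε => (q ε - l k) / ε) (𝓝[>] 0) (𝓝 0) := tendsto_variance hu.1 ha1 hK
    have hq0 : ∀ ε, 0 ≤ q ε := fun ε =>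
      Finset.sum_nonneg fun i _ => mul_nonneg (hpos i).le (sq_nonneg _)
    have hvar' : Tendsto (fun ε => (Real.sqrt (q ε) ^ 2 - l k) / ε) (𝓝[>] 0) (𝓝 0) := by
      simpa only [Real.sq_sqrt (hq0 _)] using hvar
    have hqlim : Tendsto q (𝓝[>] 0) (𝓝 (l k)) := by
      have hid : Tendsto (fun ε : ℝ => ε) (𝓝[>] 0) (𝓝 0) :=
        tendsto_id.mono_left nhdsWithin_le_nhds
      have h1 := (hvar.mul hid).add_const (l k)
      rw [mul_zero, zero_add] at h1
      refine h1.congr' ?_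
      filter_upwards [self_mem_nhdsWithin] with ε (hε : 0 < ε)
      field_simp
      ring
    have hσpos : ∀ᶠ ε in 𝓝[>] (0 : ℝ), 0 < Real.sqrt (q ε) :=
      (hqlim.eventually (lt_mem_nhds hlk)).mono fun ε h => Real.sqrt_pos.2 h
    -- Projecting the contaminated H gives a dilated contaminated standard normal law, with the
    -- contaminating point divided by the current standard deviation.
    have hmap : ∀ᶠ ε in 𝓝[>] (0 : ℝ), (F ε).map (fun x => inner ℝ (a ε) x) =
        (contaminated stdNormal (inner ℝ (a ε) x / Real.sqrt (q ε)) ε).map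
          fun t => Real.sqrt (q ε) * t := by
      filter_upwards [hσpos] with ε hε
      rw [hF, contaminated_map H x ε (by fun_prop), contaminated_map _ _ ε (by fun_prop),
        map_inner_eq hu hH, mul_div_cancel₀ _ hε.ne']
    refine ⟨fun ε => Real.sqrt (q ε), fun ε => inner ℝ (a ε) x / Real.sqrt (q ε), hσpos, ?_,
      fun S hS hSpos y => ?_⟩
    · have h1 := (tendsto_abs_inner hu.1 ha1 hK x).div hqlim.sqrt hsk.ne'
      refine (h1.congr fun ε => ?_).trans (le_of_eq ?_)
      · change |inner ℝ (a ε) x| / Real.sqrt (q ε) = _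
        rw [abs_div, abs_of_nonneg (Real.sqrt_nonneg _)]
      · rw [abs_div, abs_of_pos hsk]
    · have hτ : ∀ᶠ ε in 𝓝[>] (0 : ℝ), 0 < S ((contaminated stdNormal
          (inner ℝ (a ε) x / Real.sqrt (q ε)) ε).map fun t => Real.sqrt (q ε) * t) /
            Real.sqrt (q ε) := by
        filter_upwards [hSpos, hσpos] with ε h1 h2
        exact div_pos h1 h2
      rw [← tendsto_sq_slope_iff hlk hvar' hτ, HasInfluence, hmodel S hS]
      refine tendsto_congr' ?_
      filter_upwards [hmap, hσpos] with ε h1 h2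
      rw [correctedEigenvalue]
      change (S ((F ε).map fun x => inner ℝ (a ε) x) ^ 2 - l k) / ε = _
      rw [h1, mul_div_cancel₀ _ h2.ne']

end Eigenvalue

end

theorem corollary2 {p : ℕ}
    -- the distribution: centered elliptical, positive definite scatter matrix with distinct
    -- eigenvalues, standardized projections distributed as `N(0,1)`
    (H : Measure (EuclideanSpace ℝ (Fin p))) [IsProbabilityMeasure H]
    (A : Matrix (Fin p) (Fin p) ℝ) (hA : A.PosDef)
    (u : Fin p → EuclideanSpace ℝ (Fin p)) (l : Fin p → ℝ)
    (hu : IsOrderedEigenbasis A u l) (hl : StrictAnti l)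
    (hH : HasProjectedLaw H A (gaussianReal 0 1))
    -- the GSPCA loading vectors, from a location functional and a radial function
    (T : Measure (EuclideanSpace ℝ (Fin p)) → EuclideanSpace ℝ (Fin p)) (hT : T H = 0)
    (ξ : Measure (EuclideanSpace ℝ (Fin p)) → ℝ → ℝ) (hξ : Measurable (ξ H))
    (hξ0 : ¬ (fun x : EuclideanSpace ℝ (Fin p) => ξ H ‖x‖) =ᵐ[H] 0)
    (hξ2 : Integrable (fun x => ‖generalizedSign T ξ H x‖ ^ 2) H)
    -- regularity, weaker than existence of the influence function of the matrix functional
    (hreg : ∀ x i j, (fun ε : ℝ => gsscm T ξ (contaminated H x ε) i j - gsscm T ξ H i j)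
      =O[𝓝[>] 0] (fun ε : ℝ => ε))
    (v : Measure (EuclideanSpace ℝ (Fin p)) → Fin p → EuclideanSpace ℝ (Fin p))
    (hv : IsGSPCA T ξ v) (k : Fin p) :
    -- the MAD is a Fisher consistent M-estimator of scale
    (IsConsistentMScale madScore madKnownCenter ∧ FisherConsistent mad) ∧
    -- for each `b > 0` there is exactly one Fisher consistent Huber M-estimator
    (∀ b : ℝ, 0 < b → ∃! a : ℝ, ∃ S, IsConsistentMScale (huberScore a b) S) ∧
    -- estimation of the `k`-th eigenvalue: the MAD is most B-robust, Huber's M-estimator is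
    -- optimal B-robust; the classical estimator has asymptotic variance `2 λₖ²`
    (MadMostBRobust (correctedEigenvalue v k) H ∧
      HuberOptimalBRobust (correctedEigenvalue v k) H (ENNReal.ofReal (2 * l k ^ 2))) ∧
    -- the same for the estimation of scale itself at `N(0,1)`; the standard deviation has
    -- asymptotic variance `1/2`
    (MadMostBRobust (fun S => S) stdNormal ∧
      HuberOptimalBRobust (fun S => S) stdNormal (1 / 2)) := by
  have h1 := isScaleLike_correctedEigenvalue hA hu hl hH hT hξ hξ0 hξ2 hreg hv k
  exact ⟨⟨isConsistentMScale_madScore, fisherConsistent_of_mad (.inl rfl)⟩,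
    fun b hb => existsUnique_huber hb,
    ⟨h1.madMostBRobust, h1.huberOptimalBRobust _⟩,
    isScaleLike_self.madMostBRobust, isScaleLike_self.huberOptimalBRobust _⟩
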